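/- Every $10$-connected finite simple graph is $C_5$-minor-linked. Here a graph $G$ is $k$-connected if $|V(G)|>k$ and $G-S$ is connected for every $S\subseteq V(G)$ with $|S|<k$. For $k\ge 3$ and distinct vertices $x_1,\dots,x_k$ of $G$, we say that $(G,x_1x_2\ldots x_k)$ has a $C_k$-minor if there are pairwise disjoint sets $X_1,\dots,X_k\subseteq V(G)$ such that, for all $i\in\{1,\dots,k\}$, the induced subgraph $G[X_i]$ is connected, $x_i\in X_i$, and $G$ has an edge between $X_i$ and $X_{i+1}$, where $X_{k+1}=X_1$. For $X\subseteq V(G)$, the pair $(G,X)$ is cycle-linked if either $|X|\ge 3$ and $(G,x_1x_2\ldots x_{|X|})$ has a $C_{|X|}$-minor for every ordering $x_1,\dots,x_{|X|}$ of the elements of $X$, or $|X|\in\{1,2\}$ and $G$ contains a path between the vertices of $X$. The graph $G$ is $C_k$-minor-linked if $(G,X)$ is cycle-linked for every $X\subseteq V(G)$ with $|X|=k$. In other words: if $G$ is a $10$-connected finite simple graph, then for all distinct vertices $x_1,\dots,x_5$ of $G$ there are pairwise disjoint sets $X_1,\dots,X_5\subseteq V(G)$ such that, for each $i\in\{1,\dots,5\}$,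 $G[X_i]$ is connected, $x_i\in X_i$, and $G$ has an edge between $X_i$ and $X_{i+1}$, where $X_6=X_1$. -/

import Mathlib

namespace SimpleGraph

/-- `G` is `k`-connected: it has more than `k` vertices, and deleting any set of fewer than `k`
vertices leaves a connected graph. -/
def IsKConnected {V : Type*} (G : SimpleGraph V) (k : ℕ) : Prop :=
  k < Nat.card V ∧ ∀ S : Finset V, S.card < k → (G.induce ((S : Set V)ᶜ)).Connected

/-- `(G, x₁x₂…x_k)` has a `C_k`-minor: there are pairwise disjoint vertex sets `B i` with `x i ∈ B i`
inducing connected subgraphs, and an edge of `G` between `B i` and `B (i + 1)`, indices mod `k`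
(`finRotate k` is the map `i ↦ i + 1` mod `k` on `Fin k`). -/
def HasRootedCycleMinor {V : Type*} (G : SimpleGraph V) {k : ℕ} (x : Fin k → V) : Prop :=
  ∃ B : Fin k → Set V,
    (∀ i j, i ≠ j → Disjoint (B i) (B j)) ∧
    (∀ i, (G.induce (B i)).Connected) ∧
    (∀ i, x i ∈ B i) ∧
    (∀ i, ∃ u ∈ B i, ∃ v ∈ B (finRotate k i), G.Adj u v)

/-- `(G, X)` is cycle-linked: either `|X| ≥ 3` and `(G, x)` has a `C_{|X|}`-minor for every
ordering `x` of the elements of `X`, or `|X| ∈ {1, 2}` and `G` contains a path between the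
vertices of `X`. -/
def IsCycleLinked {V : Type*} (G : SimpleGraph V) (X : Finset V) : Prop :=
  (3 ≤ X.card ∧ ∀ x : Fin X.card → V, Function.Injective x → Set.range x = (X : Set V) →
    G.HasRootedCycleMinor x) ∨
  ((X.card = 1 ∨ X.card = 2) ∧ ∀ u ∈ X, ∀ v ∈ X, G.Reachable u v)

/-- `G` is `C_k`-minor-linked: `(G, X)` is cycle-linked for every set `X` of `k` vertices. -/
def IsCycleMinorLinked {V : Type*} (G : SimpleGraph V) (k : ℕ) : Prop :=
  ∀ X : Finset V, X.card = k → G.IsCycleLinked X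

end SimpleGraph

/-! Connectivity does not survive the reductions of an induction, so it is replaced by an edge
count. Let `U` contain the set `X` of at most five roots. The pair is `Massed` if more than `5|U \
X|` edges of `G[U]` meet `U \ X`, while every part of `U \ X` whose boundary is smaller than `X` has
at most five edges per vertex. The core statement is `Massed.linked_or_exceptional`: a massed pair
is linked unless two non-roots are adjacent to all of five roots. One further edge makes the
exceptional pairs linked as well (`Massed.linked_of_exceptional`), and a 10-connected graph has
edges to spare (`massed_of_isKConnected`).

Consider a counterexample with fewest vertices, then fewest edges (`Critical`). A part with small
boundary that is linked to its boundary can be replaced by a clique on the boundary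
(`Critical.not_rigid_of_lt`). With Menger's theorem (`linkage_of_minimal`), this excludes every set
all of whose relevant boundary sets are linked (`Critical.not_core`). Deleting an edge shows that
there are exactly `5|U \ X| + 1` edges (`Critical.rho_eq`). Contracting an edge `uv` with `v` not a
root must lose at least five edges besides `uv` (`Critical.codeg_ge`); the hard case is a
contraction that is exceptional, which is handled by building the minor from the two common
neighbours, `v` and the dense parts left over.

By the edge count some non-root `v` has degree `d ≤ 9`, where `d` plus its number of root neighbours
is at most 10. The codegree bound makes each neighbour of `v` miss at most `d - 6` of the others,
apart from pairs of roots. In so dense a neighbourhood, `v` serves one root and the few remaining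
neighbours serve the rest of the cycle (`Dense.rootedMinor`). Hence `{v}` is one of the excluded
sets, a contradiction. -/

namespace CycleMinor

open Finset
open scoped Classical

variable {V : Type*}

/-! ### Connected vertex sets and components -/

/-- The finite vertex set `S` is nonempty and every proper cut of it is crossed by an edge of `G`. -/
def Conn (G : SimpleGraph V) (S : Finset V) : Prop :=
  S.Nonempty ∧ ∀ T ⊆ S, T.Nonempty → T ≠ S → ∃ a ∈ T, ∃ b ∈ S, b ∉ T ∧ G.Adj a b

/-- Some edge of `G` joins `A` to `B`. -/
def Touch (G : SimpleGraph V) (A B : Finset V) : Prop := ∃ a ∈ A, ∃ b ∈ B, G.Adj a b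

/-- The vertices of `U` outside `S` with a neighbour in `S`. -/
noncomputable def bdry (G : SimpleGraph V) (U S : Finset V) : Finset V :=
  U.filter fun y => y ∉ S ∧ ∃ s ∈ S, G.Adj s y

theorem mem_bdry {G : SimpleGraph V} {U S : Finset V} {y : V} :
    y ∈ bdry G U S ↔ y ∈ U ∧ y ∉ S ∧ ∃ s ∈ S, G.Adj s y := by
  simp [bdry]

theorem bdry_subset {G : SimpleGraph V} {U S : Finset V} : bdry G U S ⊆ U := filter_subset _ _

theorem Touch.mono {G H : SimpleGraph V} (hGH : G ≤ H) {A B A' B' : Finset V} (hA : A ⊆ A')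
    (hB : B ⊆ B') (h : Touch G A B) : Touch H A' B' := by
  obtain ⟨a, ha, b, hb, hab⟩ := h
  exact ⟨a, hA ha, b, hB hb, hGH hab⟩

theorem conn_singleton (G : SimpleGraph V) (a : V) : Conn G {a} := by
  refine ⟨singleton_nonempty a, fun T hT hne hTa => ?_⟩
  rcases subset_singleton_iff.1 hT with h | h
  · simp [h] at hne
  · exact absurd h hTa

theorem Conn.mono {G H : SimpleGraph V} {S : Finset V} (hGH : G ≤ H) (h : Conn G S) :
    Conn H S := by
  refine ⟨h.1, fun T hT hne hTS => ?_⟩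
  obtain ⟨a, ha, b, hb, hbT, hab⟩ := h.2 T hT hne hTS
  exact ⟨a, ha, b, hb, hbT, hGH hab⟩

/-- A cut that is crossed by no edge does not split a connected set. -/
theorem Conn.subset_or_disjoint {G : SimpleGraph V} {S T : Finset V} (h : Conn G S)
    (hT : ∀ a ∈ S, a ∈ T → ∀ b ∈ S, G.Adj a b → b ∈ T) : S ⊆ T ∨ Disjoint S T := by
  by_contra! hcon
  obtain ⟨h1, h2⟩ := hcon
  rw [not_disjoint_iff] at h2
  obtain ⟨x, hxS, hxT⟩ := h2
  obtain ⟨a, ha, b, hb, hbT, hab⟩ := h.2 (S ∩ T) inter_subset_left ⟨x, by simp [hxS, hxT]⟩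
    (fun heq => h1 (by rw [← heq]; exact inter_subset_right))
  simp only [mem_inter, not_and] at ha hbT
  exact hbT hb (hT a ha.1 ha.2 b hb hab)

/-- Here `T` need not lie in `S`, so the same closed set can be tested against each member of a
union. -/
theorem conn_of_cut {G : SimpleGraph V} {S : Finset V} (hne : S.Nonempty)
    (h : ∀ T : Finset V, (∀ a ∈ S, a ∈ T → ∀ b ∈ S, G.Adj a b → b ∈ T) →
      (∃ a ∈ S, a ∈ T) → S ⊆ T) : Conn G S := by
  refine ⟨hne, fun T hT hTne hTS => ?_⟩
  by_contra! hcon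
  refine hTS (hT.antisymm (h T ?_ ?_))
  · intro a _ haT b hb hab
    by_contra hbT
    exact hcon a haT b hb hbT hab
  · obtain ⟨a, ha⟩ := hTne
    exact ⟨a, hT ha, ha⟩

/-- A union of connected sets indexed by a connected pattern is connected: here any two members
meet a common connected core. -/
theorem conn_union_core {G : SimpleGraph V} {ι : Type*} {C : Finset V} {I : Finset ι}
    {P : ι → Finset V} (hC : Conn G C) (hP : ∀ i ∈ I, Conn G (P i))
    (hmeet : ∀ i ∈ I, ¬ Disjoint C (P i) ∨ Touch G C (P i)) : Conn G (C ∪ I.biUnion P) := by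
  obtain ⟨c, hc⟩ := hC.1
  refine conn_of_cut ⟨c, mem_union_left _ hc⟩ fun T hT hTm => ?_
  have hsub : ∀ i ∈ I, P i ⊆ C ∪ I.biUnion P := fun i hi =>
    (subset_biUnion_of_mem P hi).trans subset_union_right
  have key : ∀ D ⊆ C ∪ I.biUnion P, Conn G D → D ⊆ T ∨ Disjoint D T := fun D hD hcD =>
    hcD.subset_or_disjoint fun a ha haT b hb hab => hT a (hD ha) haT b (hD hb) hab
  have hCP : ∀ i ∈ I, (C ⊆ T ↔ P i ⊆ T) := by
    intro i hi
    have k1 := key C subset_union_left hC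
    have k2 := key (P i) (hsub i hi) (hP i hi)
    have hpt : ∀ {D : Finset V}, D ⊆ T ∨ Disjoint D T → ∀ x ∈ D, (D ⊆ T ↔ x ∈ T) := by
      intro D hD x hx
      rcases hD with h | h
      · exact ⟨fun _ => h hx, fun _ => h⟩
      · exact ⟨fun h' => h' hx, fun hxT => absurd hxT (disjoint_left.1 h hx)⟩
    rcases hmeet i hi with h | ⟨a, ha, b, hb, hab⟩
    · obtain ⟨x, hx1, hx2⟩ := not_disjoint_iff.1 h
      rw [hpt k1 x hx1, hpt k2 x hx2]
    · rw [hpt k1 a ha, hpt k2 b hb]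
      exact ⟨fun h => hT a (mem_union_left _ ha) h b (hsub i hi hb) hab,
        fun h => hT b (hsub i hi hb) h a (mem_union_left _ ha) hab.symm⟩
  have hCT : C ⊆ T := by
    obtain ⟨a, ha, haT⟩ := hTm
    rcases mem_union.1 ha with h | h
    · rcases key C subset_union_left hC with h' | h'
      · exact h'
      · exact absurd haT (disjoint_left.1 h' h)
    · obtain ⟨i, hi, hai⟩ := mem_biUnion.1 h
      refine (hCP i hi).2 ?_
      rcases key (P i) (hsub i hi) (hP i hi) with h' | h'
      · exact h'
      · exact absurd haT (disjoint_left.1 h' hai)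
  exact union_subset hCT (biUnion_subset.2 fun i hi => (hCP i hi).1 hCT)

theorem Conn.union {G : SimpleGraph V} {A B : Finset V} (hA : Conn G A) (hB : Conn G B)
    (h : Touch G A B) : Conn G (A ∪ B) := by
  have := conn_union_core (I := {()}) (P := fun _ : Unit => B) hA (fun _ _ => hB)
    (fun _ _ => Or.inr h)
  simpa using this

theorem Conn.union_of_mem {G : SimpleGraph V} {A B : Finset V} (hA : Conn G A) (hB : Conn G B)
    {x : V} (hxA : x ∈ A) (hxB : x ∈ B) : Conn G (A ∪ B) := by
  have := conn_union_core (I := {()}) (P := fun _ : Unit => B) hA (fun _ _ => hB)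
    (fun _ _ => Or.inl (not_disjoint_iff.2 ⟨x, hxA, hxB⟩))
  simpa using this

theorem Conn.insert_vertex {G : SimpleGraph V} {A : Finset V} {x : V} (hA : Conn G A)
    (h : ∃ a ∈ A, G.Adj x a) : Conn G (insert x A) := by
  obtain ⟨a, ha, hxa⟩ := h
  rw [insert_eq]
  exact (conn_singleton G x).union hA ⟨x, mem_singleton_self x, a, ha, hxa⟩

/-- The vertex set of the component of `G[U]` that contains `s`. -/
noncomputable def comp (G : SimpleGraph V) (U : Finset V) (s : V) : Finset V :=
  (U.powerset.filter fun K => s ∈ K ∧ Conn G K).biUnion id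

theorem comp_subset {G : SimpleGraph V} {U : Finset V} {s : V} : comp G U s ⊆ U := by
  intro y hy
  simp only [comp, mem_biUnion, mem_filter, mem_powerset, id] at hy
  obtain ⟨K, ⟨hK, _⟩, hyK⟩ := hy
  exact hK hyK

theorem Conn.subset_comp {G : SimpleGraph V} {U K : Finset V} {s : V} (hK : Conn G K)
    (hKU : K ⊆ U) (hs : s ∈ K) : K ⊆ comp G U s := by
  intro y hy
  simp only [comp, mem_biUnion, mem_filter, mem_powerset, id]
  exact ⟨K, ⟨hKU, hs, hK⟩, hy⟩

theorem mem_comp_self {G : SimpleGraph V} {U : Finset V} {s : V} (hs : s ∈ U) : s ∈ comp G U s :=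
  (conn_singleton G s).subset_comp (by simpa using hs) (mem_singleton_self s) (mem_singleton_self s)

theorem conn_comp {G : SimpleGraph V} {U : Finset V} {s : V} (hs : s ∈ U) :
    Conn G (comp G U s) := by
  have h := conn_union_core (G := G) (C := {s}) (I := U.powerset.filter fun K => s ∈ K ∧ Conn G K)
    (P := id) (conn_singleton G s) (fun K hK => (mem_filter.1 hK).2.2)
    (fun K hK => Or.inl (by simpa using (mem_filter.1 hK).2.1))
  change Conn G ({s} ∪ comp G U s) at h
  rwa [union_eq_right.2 (singleton_subset_iff.2 (mem_comp_self hs))] at h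

theorem comp_closed {G : SimpleGraph V} {U : Finset V} {s x y : V} (hs : s ∈ U)
    (hx : x ∈ comp G U s) (hy : y ∈ U) (hxy : G.Adj x y) : y ∈ comp G U s := by
  have h : Conn G (insert y (comp G U s)) := (conn_comp hs).insert_vertex ⟨x, hx, hxy.symm⟩
  exact h.subset_comp (insert_subset hy comp_subset) (mem_insert_of_mem (mem_comp_self hs))
    (mem_insert_self _ _)

/-! ### Menger's theorem for sets of least boundary -/

/-- Menger's theorem between `bdry G U T` and `bdry G U S`, for a set `T ⊇ S` of least boundary:
there are disjoint connected sets, one for each vertex `c` of the boundary of `T`, that lead from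
`c` to a vertex of the boundary of `S`. -/
def Linkage (G : SimpleGraph V) (U S T : Finset V) : Prop :=
  ∃ P : V → Finset V, (∀ c ∈ bdry G U T, c ∈ P c ∧ Conn G (P c) ∧
      P c ⊆ (T ∪ bdry G U T) \ S ∧ ∃ q, P c ∩ bdry G U S = {q}) ∧
    ∀ c ∈ bdry G U T, ∀ d ∈ bdry G U T, c ≠ d → Disjoint (P c) (P d)

theorem bdry_subset_union {G : SimpleGraph V} {U S T : Finset V} (h : S ⊆ T) :
    bdry G U S ⊆ T ∪ bdry G U T := by
  intro y hy
  obtain ⟨hyU, -, s, hs, hsy⟩ := mem_bdry.1 hy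
  by_cases hyT : y ∈ T
  · exact mem_union_left _ hyT
  · exact mem_union_right _ (mem_bdry.2 ⟨hyU, hyT, s, h hs, hsy⟩)

theorem linkage_refl (G : SimpleGraph V) (U S : Finset V) : Linkage G U S S := by
  refine ⟨fun c => {c}, fun c hc => ⟨mem_singleton_self c, conn_singleton G c, ?_, c, ?_⟩, ?_⟩
  · simp [hc, (mem_bdry.1 hc).2.1]
  · simp [hc]
  · intro c _ d _ hcd
    simpa using hcd

/-- The outer paths avoid `T` and the inner ones stay in `T` and its boundary. They can therefore
meet only in `bdry G U T`, which each outer path meets in a single vertex, and there they are glued.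
-/
theorem Linkage.trans {G : SimpleGraph V} {U S T W : Finset V} (hST : S ⊆ T) (hTW : T ⊆ W)
    (h1 : Linkage G U S T) (h2 : Linkage G U T W) : Linkage G U S W := by
  obtain ⟨P, hP, hPd⟩ := h2
  obtain ⟨Q, hQ, hQd⟩ := h1
  have hq : ∀ c : V, ∃ q, c ∈ bdry G U W → P c ∩ bdry G U T = {q} := by
    intro c
    by_cases hc : c ∈ bdry G U W
    · obtain ⟨q, hq⟩ := (hP c hc).2.2.2
      exact ⟨q, fun _ => hq⟩
    · exact ⟨c, fun h => absurd h hc⟩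
  choose q hq using hq
  have hqP : ∀ c ∈ bdry G U W, q c ∈ P c ∧ q c ∈ bdry G U T := fun c hc => by
    have : q c ∈ P c ∩ bdry G U T := by rw [hq c hc]; simp
    simpa using this
  have hqd : ∀ c ∈ bdry G U W, ∀ d ∈ bdry G U W, c ≠ d → q c ≠ q d := fun c hc d hd hcd heq =>
    disjoint_left.1 (hPd c hc d hd hcd) (hqP c hc).1 (heq ▸ (hqP d hd).1)
  have hcross : ∀ c ∈ bdry G U W, ∀ d ∈ bdry G U W, c ≠ d → Disjoint (P c) (Q (q d)) := by
    intro c hc d hd hcd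
    rw [disjoint_left]
    intro y hyP hyQ
    have h1 := (hP c hc).2.2.1 hyP
    have h2 := (hQ _ (hqP d hd).2).2.2.1 hyQ
    simp only [mem_sdiff, mem_union] at h1 h2
    have hyT : y ∈ bdry G U T := h2.1.resolve_left h1.2
    have hyc : y = q c := by
      have : y ∈ P c ∩ bdry G U T := mem_inter.2 ⟨hyP, hyT⟩
      rw [hq c hc] at this
      simpa using this
    subst hyc
    exact disjoint_left.1 (hQd _ (hqP c hc).2 _ (hqP d hd).2 (hqd c hc d hd hcd))
      (hQ _ (hqP c hc).2).1 hyQ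
  refine ⟨fun c => P c ∪ Q (q c), fun c hc => ⟨mem_union_left _ (hP c hc).1, ?_, ?_, ?_⟩, ?_⟩
  · exact (hP c hc).2.1.union_of_mem (hQ _ (hqP c hc).2).2.1 (hqP c hc).1 (hQ _ (hqP c hc).2).1
  · refine union_subset ((hP c hc).2.2.1.trans (sdiff_subset_sdiff subset_rfl hST)) ?_
    refine (hQ _ (hqP c hc).2).2.2.1.trans (sdiff_subset_sdiff (union_subset ?_ ?_) subset_rfl)
    · exact hTW.trans subset_union_left
    · exact bdry_subset_union hTW
  · obtain ⟨r, hr⟩ := (hQ _ (hqP c hc).2).2.2.2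
    refine ⟨r, ?_⟩
    rw [union_inter_distrib_right, hr, union_eq_right]
    intro y hy
    rw [← hr]
    obtain ⟨hyP, hyS⟩ := mem_inter.1 hy
    have h1 := (hP c hc).2.2.1 hyP
    simp only [mem_sdiff, mem_union] at h1
    have hyT : y ∈ bdry G U T := (mem_union.1 (bdry_subset_union hST hyS)).resolve_left h1.2
    have hyc : y = q c := by
      have : y ∈ P c ∩ bdry G U T := mem_inter.2 ⟨hyP, hyT⟩
      rw [hq c hc] at this
      simpa using this
    subst hyc
    exact mem_inter.2 ⟨(hQ _ (hqP c hc).2).1, hyS⟩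
  · intro c hc d hd hcd
    rw [disjoint_union_left, disjoint_union_right, disjoint_union_right]
    exact ⟨⟨hPd c hc d hd hcd, hcross c hc d hd hcd⟩, (hcross d hd c hc hcd.symm).symm,
      hQd _ (hqP c hc).2 _ (hqP d hd).2 (hqd c hc d hd hcd)⟩

theorem bdry_erase_subset {G : SimpleGraph V} {U T : Finset V} {t : V} :
    bdry G U (T.erase t) ⊆ insert t (bdry G U T) := by
  intro y hy
  obtain ⟨hyU, hyT, s, hs, hsy⟩ := mem_bdry.1 hy
  by_cases hyt : y = t
  · exact mem_insert.2 (Or.inl hyt)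
  · refine mem_insert_of_mem (mem_bdry.2 ⟨hyU, fun h => hyT (mem_erase.2 ⟨hyt, h⟩), s,
      (mem_erase.1 hs).2, hsy⟩)

/-- Extending a linkage by one vertex whose removal does not enlarge the boundary. -/
theorem Linkage.of_erase {G : SimpleGraph V} {U S T : Finset V} {t : V} (hS : S ⊆ T)
    (htT : t ∈ T) (htS : t ∉ S) (hcard : (bdry G U (T.erase t)).card = (bdry G U T).card)
    (h : Linkage G U S (T.erase t)) : Linkage G U S T := by
  have hSe : S ⊆ T.erase t := fun y hy => mem_erase.2 ⟨fun h => htS (h ▸ hy), hS hy⟩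
  by_cases ht : t ∈ bdry G U (T.erase t)
  · have htb : t ∉ bdry G U T := fun h => (mem_bdry.1 h).2.1 htT
    have hsub : (bdry G U (T.erase t)).erase t ⊆ bdry G U T := by
      intro y hy
      obtain ⟨hyt, hy⟩ := mem_erase.1 hy
      exact (mem_insert.1 (bdry_erase_subset hy)).resolve_left hyt
    have hcard' : ((bdry G U (T.erase t)).erase t).card < (bdry G U T).card := by
      rw [card_erase_of_mem ht, ← hcard]
      exact Nat.sub_lt (card_pos.2 ⟨t, ht⟩) one_pos
    -- Passing from `T.erase t` to `T` trades the boundary vertex `t` for one new vertex `c'`, a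
    -- neighbour of `t`. The path of `c'` is that of `t`, prolonged by this edge.
    obtain ⟨c', hc', hc'n⟩ := exists_mem_notMem_of_card_lt_card hcard'
    have hc't : c' ≠ t := fun h => htb (h ▸ hc')
    have hc'e : c' ∉ bdry G U (T.erase t) := fun h => hc'n (mem_erase.2 ⟨hc't, h⟩)
    have hins : bdry G U T = insert c' ((bdry G U (T.erase t)).erase t) := by
      symm
      apply eq_of_subset_of_card_le (insert_subset hc' hsub)
      rw [card_insert_of_notMem hc'n, card_erase_of_mem ht, ← hcard]
      omega
    have hc'T : c' ∉ T := (mem_bdry.1 hc').2.1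
    have hadj : G.Adj c' t := by
      obtain ⟨hU, -, s, hs, hsc⟩ := mem_bdry.1 hc'
      by_cases hst : s = t
      · exact hst ▸ hsc.symm
      · exact absurd (mem_bdry.2 ⟨hU, fun h => hc'T (mem_erase.1 h).2, s,
          mem_erase.2 ⟨hst, hs⟩, hsc⟩) hc'e
    have hc'S : c' ∉ bdry G U S := by
      intro h
      rcases mem_union.1 (bdry_subset_union hSe h) with h | h
      · exact hc'T (mem_erase.1 h).2
      · exact hc'e h
    obtain ⟨P, hP, hPd⟩ := h
    have hsubset : (T.erase t ∪ bdry G U (T.erase t)) \ S ⊆ (T ∪ bdry G U T) \ S := by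
      refine sdiff_subset_sdiff (union_subset ((erase_subset _ _).trans subset_union_left) ?_)
        subset_rfl
      exact bdry_subset_union (erase_subset _ _)
    have hc'P : ∀ c ∈ bdry G U (T.erase t), c' ∉ P c := by
      intro c hc hcc
      have := (hP c hc).2.2.1 hcc
      simp only [mem_sdiff, mem_union, mem_erase] at this
      rcases this.1 with h | h
      · exact hc'T h.2
      · exact hc'e h
    have hold : ∀ c ∈ bdry G U T, c ≠ c' → c ≠ t ∧ c ∈ bdry G U (T.erase t) := by
      intro c hc hcc
      rw [hins] at hc
      exact mem_erase.1 ((mem_insert.1 hc).resolve_left hcc)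
    refine ⟨fun c => if c = c' then insert c' (P t) else P c, ?_, ?_⟩
    · intro c hc
      by_cases hcc : c = c'
      · subst hcc
        simp only [if_true]
        obtain ⟨h1, h2, h3, q, h4⟩ := hP t ht
        refine ⟨mem_insert_self _ _, h2.insert_vertex ⟨t, h1, hadj⟩, ?_, q, ?_⟩
        · refine insert_subset ?_ (h3.trans hsubset)
          simp only [mem_sdiff, mem_union]
          exact ⟨Or.inr hc, fun h => hc'T (hS h)⟩
        · rw [insert_inter_of_notMem hc'S, h4]
      · simp only [hcc, if_false]
        obtain ⟨h1, h2, h3, h4⟩ := hP c (hold c hc hcc).2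
        exact ⟨h1, h2, h3.trans hsubset, h4⟩
    · intro c hc d hd hcd
      by_cases hcc : c = c'
      · subst hcc
        have hd' := hold d hd hcd.symm
        simp only [if_true, hcd.symm, if_false, disjoint_insert_left]
        exact ⟨hc'P d hd'.2, hPd t ht d hd'.2 hd'.1.symm⟩
      · have hc'' := hold c hc hcc
        by_cases hdd : d = c'
        · subst hdd
          simp only [if_true, hcc, if_false, disjoint_insert_right]
          exact ⟨hc'P c hc''.2, hPd c hc''.2 t ht hc''.1⟩
        · simp only [hcc, hdd, if_false]
          exact hPd c hc''.2 d (hold d hd hdd).2 hcd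
  · have hsub : bdry G U (T.erase t) ⊆ bdry G U T := fun y hy =>
      (mem_insert.1 (bdry_erase_subset hy)).resolve_left (fun h => ht (h ▸ hy))
    have heq := eq_of_subset_of_card_le hsub hcard.ge
    obtain ⟨P, hP, hPd⟩ := h
    rw [heq] at hP hPd
    refine ⟨P, fun c hc => ?_, hPd⟩
    obtain ⟨h1, h2, h3, h4⟩ := hP c hc
    exact ⟨h1, h2, h3.trans (sdiff_subset_sdiff
      (union_subset_union (erase_subset _ _) subset_rfl) subset_rfl), h4⟩

/-- The case of Menger's theorem in which a matching suffices. -/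
theorem linkage_of_hall {G : SimpleGraph V} {U S T : Finset V} (hS : S ⊆ T)
    (hmin : ∀ T', S ⊆ T' → T' ⊆ T → (bdry G U T).card ≤ (bdry G U T').card)
    (hTS : T \ S ⊆ bdry G U S) (hcard : (bdry G U S).card ≤ (bdry G U T).card) :
    Linkage G U S T := by
  let nb : {t // t ∈ T \ S} → Finset V := fun t => (bdry G U T \ bdry G U S).filter (G.Adj t)
  -- Hall's condition: the boundary of `S ∪ J` loses `J` and gains only neighbours of `J`, so by
  -- minimality there are at least `|J|` of these.
  have hall : ∀ J : Finset {t // t ∈ T \ S}, J.card ≤ (J.biUnion nb).card := by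
    intro J
    have hJT : J.map (Function.Embedding.subtype _) ⊆ T \ S := by
      intro y hy
      obtain ⟨t, -, rfl⟩ := mem_map.1 hy
      exact t.2
    set J' := J.map (Function.Embedding.subtype _) with hJ'
    have h1 := hmin (S ∪ J') subset_union_left (union_subset hS (hJT.trans sdiff_subset))
    have h2 : bdry G U (S ∪ J') ⊆ (bdry G U S \ J') ∪ J.biUnion nb := by
      intro y hy
      obtain ⟨hyU, hyS, s, hs, hsy⟩ := mem_bdry.1 hy
      rw [mem_union, not_or] at hyS
      by_cases hyb : y ∈ bdry G U S
      · exact mem_union_left _ (mem_sdiff.2 ⟨hyb, hyS.2⟩)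
      · rcases mem_union.1 hs with hs | hs
        · exact absurd (mem_bdry.2 ⟨hyU, hyS.1, s, hs, hsy⟩) hyb
        · obtain ⟨t, htJ, rfl⟩ := mem_map.1 hs
          refine mem_union_right _ (mem_biUnion.2 ⟨t, htJ, ?_⟩)
          have hyT : y ∉ T := fun h => hyb (hTS (mem_sdiff.2 ⟨h, hyS.1⟩))
          exact mem_filter.2 ⟨mem_sdiff.2 ⟨mem_bdry.2 ⟨hyU, hyT, t, (mem_sdiff.1 t.2).1, hsy⟩,
            hyb⟩, hsy⟩
    have h3 := (card_le_card h2).trans (card_union_le _ _)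
    rw [card_sdiff_of_subset (hJT.trans hTS)] at h3
    have h4 : J'.card = J.card := card_map _
    have h5 := card_le_card (hJT.trans hTS)
    omega
  obtain ⟨f, hfinj, hf⟩ := (all_card_le_biUnion_card_iff_exists_injective nb).1 hall
  have hf' : ∀ t, f t ∈ bdry G U T ∧ f t ∉ bdry G U S ∧ G.Adj t (f t) := fun t => by
    have := hf t
    simp only [nb, mem_filter, mem_sdiff] at this
    exact ⟨this.1.1, this.1.2, this.2⟩
  have hsurj : ∀ c ∈ bdry G U T, c ∉ bdry G U S → ∃ t, f t = c := by
    -- The two boundaries have equal size and `T \ S` is `bdry G U S \ bdry G U T`, so the matching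
    -- is perfect.
    have himg : univ.image f = bdry G U T \ bdry G U S := by
      apply eq_of_subset_of_card_le
      · intro y hy
        obtain ⟨t, -, rfl⟩ := mem_image.1 hy
        exact mem_sdiff.2 ⟨(hf' t).1, (hf' t).2.1⟩
      · rw [card_image_of_injective _ hfinj, card_univ, Fintype.card_coe]
        have h1 := card_sdiff_add_card_inter (bdry G U T) (bdry G U S)
        have h2 := card_sdiff_add_card_inter (bdry G U S) (bdry G U T)
        have h3 : bdry G U S \ bdry G U T = T \ S := by
          ext y
          simp only [mem_sdiff]
          constructor
          · rintro ⟨h, h'⟩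
            exact ⟨(mem_union.1 (bdry_subset_union hS h)).resolve_right h', (mem_bdry.1 h).2.1⟩
          · rintro ⟨h, h'⟩
            exact ⟨hTS (mem_sdiff.2 ⟨h, h'⟩), fun h2 => (mem_bdry.1 h2).2.1 h⟩
        have h4 := hmin S subset_rfl hS
        rw [inter_comm] at h2
        rw [h3] at h2
        omega
    intro c hc hcS
    have : c ∈ univ.image f := by rw [himg]; exact mem_sdiff.2 ⟨hc, hcS⟩
    simpa using this
  have hcT : ∀ c ∈ bdry G U T, c ∉ T := fun c hc => (mem_bdry.1 hc).2.1
  refine ⟨fun c => insert c ((univ.filter fun t => f t = c).map (Function.Embedding.subtype _)),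
    fun c hc => ⟨mem_insert_self _ _, ?_, ?_, ?_⟩, ?_⟩
  · by_cases h : ∃ t, f t = c
    · obtain ⟨t, rfl⟩ := h
      have : (univ.filter fun t' => f t' = f t) = {t} := by
        ext t'
        simp [hfinj.eq_iff]
      beta_reduce
      rw [this, map_singleton]
      exact (conn_singleton G _).insert_vertex ⟨t, by simp, (hf' t).2.2.symm⟩
    · have : (univ.filter fun t' => f t' = c) = ∅ := by
        ext t'
        simp only [mem_filter, mem_univ, true_and, notMem_empty, iff_false]
        exact fun h' => h ⟨t', h'⟩
      beta_reduce
      rw [this, map_empty]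
      exact conn_singleton G c
  · intro y hy
    rcases mem_insert.1 hy with rfl | hy
    · exact mem_sdiff.2 ⟨mem_union_right _ hc, fun h => hcT y hc (hS h)⟩
    · obtain ⟨t, -, rfl⟩ := mem_map.1 hy
      exact mem_sdiff.2 ⟨mem_union_left _ (mem_sdiff.1 t.2).1, (mem_sdiff.1 t.2).2⟩
  · by_cases hcS : c ∈ bdry G U S
    · refine ⟨c, ?_⟩
      have : (univ.filter fun t' => f t' = c) = ∅ := by
        ext t'
        simp only [mem_filter, mem_univ, true_and, notMem_empty, iff_false]
        rintro rfl
        exact (hf' t').2.1 hcS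
      beta_reduce
      rw [this, map_empty]
      simp [hcS]
    · obtain ⟨t, rfl⟩ := hsurj c hc hcS
      have : (univ.filter fun t' => f t' = f t) = {t} := by
        ext t'
        simp [hfinj.eq_iff]
      refine ⟨t, ?_⟩
      beta_reduce
      rw [this, map_singleton, insert_inter_of_notMem hcS]
      exact inter_eq_left.2 (by simpa using hTS t.2)
  · intro c hc d hd hcd
    rw [disjoint_left]
    intro y hy hy'
    rcases mem_insert.1 hy with rfl | hy
    · rcases mem_insert.1 hy' with h | hy'
      · exact hcd h
      · obtain ⟨t, -, rfl⟩ := mem_map.1 hy'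
        exact hcT _ hc (mem_sdiff.1 t.2).1
    · obtain ⟨t, ht, rfl⟩ := mem_map.1 hy
      rcases mem_insert.1 hy' with h | hy'
      · exact hcT _ hd (h ▸ (mem_sdiff.1 t.2).1)
      · obtain ⟨t', ht', htt⟩ := mem_map.1 hy'
        obtain rfl : t' = t := Subtype.ext htt
        exact hcd ((mem_filter.1 ht).2.symm.trans (mem_filter.1 ht').2)

theorem bdry_erase_left {G : SimpleGraph V} {U S : Finset V} {t : V} :
    bdry G (U.erase t) S = (bdry G U S).erase t := by
  ext y
  simp only [mem_bdry, mem_erase]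
  tauto

/-- Induction on `|T \ S|`. If no vertex can be erased without enlarging the boundary, a set
strictly between `S` and `T` with no larger boundary splits the problem. If there is none, every
intermediate boundary has one vertex to spare, so a vertex may be deleted from `U`, until only a
matching problem is left. -/
theorem linkage_of_minimal {G : SimpleGraph V} {U S T : Finset V} (hS : S ⊆ T)
    (hmin : ∀ T', S ⊆ T' → T' ⊆ T → (bdry G U T).card ≤ (bdry G U T').card) :
    Linkage G U S T := by
  induction hn : (T \ S).card using Nat.strong_induction_on generalizing U S T with
  | _ n ih =>
  by_cases hTS : T = S
  · subst hTS
    exact linkage_refl G U T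
  by_cases hA : ∃ t ∈ T \ S, (bdry G U (T.erase t)).card ≤ (bdry G U T).card
  · obtain ⟨t, ht, hc⟩ := hA
    obtain ⟨htT, htS⟩ := mem_sdiff.1 ht
    have hSe : S ⊆ T.erase t := fun y hy => mem_erase.2 ⟨fun h => htS (h ▸ hy), hS hy⟩
    have hcard := le_antisymm hc (hmin _ hSe (erase_subset _ _))
    refine Linkage.of_erase hS htT htS hcard (ih _ ?_ hSe (fun T' h1 h2 => ?_) rfl)
    · rw [← hn, erase_sdiff_comm]
      exact card_erase_lt_of_mem ht
    · rw [hcard]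
      exact hmin T' h1 (h2.trans (erase_subset _ _))
  by_cases hB : ∃ T', S ⊆ T' ∧ T' ⊆ T ∧ T' ≠ S ∧ T' ≠ T ∧ (bdry G U T').card ≤ (bdry G U T).card
  · obtain ⟨T', h1, h2, h3, h4, h5⟩ := hB
    refine Linkage.trans h1 h2 (ih _ ?_ h1 (fun T'' g1 g2 => h5.trans (hmin T'' g1 (g2.trans h2)))
      rfl) (ih _ ?_ h2 (fun T'' g1 g2 => hmin T'' (h1.trans g1) g2) rfl)
    · rw [← hn]
      apply card_lt_card
      refine ⟨sdiff_subset_sdiff h2 subset_rfl, fun h => h4 (h2.antisymm fun y hy => ?_)⟩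
      by_cases hyS : y ∈ S
      · exact h1 hyS
      · exact (mem_sdiff.1 (h (mem_sdiff.2 ⟨hy, hyS⟩))).1
    · rw [← hn]
      apply card_lt_card
      refine ⟨sdiff_subset_sdiff subset_rfl h1, fun h => h3 (Subset.antisymm (fun y hy => ?_) h1)⟩
      by_contra hyS
      exact (mem_sdiff.1 (h (mem_sdiff.2 ⟨h2 hy, hyS⟩))).2 hy
  -- Deleting `t` from `U` lowers a boundary by at most one. Strictly intermediate sets can afford
  -- that because `hB` fails, and `S` can by the choice of `t`.
  by_cases hC : ∃ t ∈ T \ S, (bdry G U T).card < (bdry G U S).card ∨ t ∉ bdry G U S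
  · obtain ⟨t, ht, hc⟩ := hC
    obtain ⟨htT, htS⟩ := mem_sdiff.1 ht
    have hSe : S ⊆ T.erase t := fun y hy => mem_erase.2 ⟨fun h => htS (h ▸ hy), hS hy⟩
    push Not at hA hB
    have hlt := hA t ht
    have htb : t ∉ bdry G U T := fun h => (mem_bdry.1 h).2.1 htT
    have heq : bdry G U (T.erase t) = insert t (bdry G U T) := by
      apply eq_of_subset_of_card_le bdry_erase_subset
      rw [card_insert_of_notMem htb]
      exact hlt
    have heq' : bdry G (U.erase t) (T.erase t) = bdry G U T := by
      rw [bdry_erase_left, heq, erase_insert htb]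
    have hlink : Linkage G (U.erase t) S (T.erase t) := by
      refine ih _ ?_ hSe (fun T' h1 h2 => ?_) rfl
      · rw [← hn, erase_sdiff_comm]
        exact card_erase_lt_of_mem ht
      · rw [heq', bdry_erase_left]
        have hT'T := h2.trans (erase_subset _ _)
        by_cases htT' : t ∈ bdry G U T'
        · rw [card_erase_of_mem htT']
          by_cases hT'S : T' = S
          · subst hT'S
            rcases hc with hc | hc
            · omega
            · exact absurd htT' hc
          · have := hB T' h1 hT'T hT'S (fun h => by
              rw [h] at h2
              exact (mem_erase.1 (h2 htT)).1 rfl)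
            omega
        · rw [erase_eq_of_notMem htT']
          exact hmin T' h1 hT'T
    obtain ⟨P, hP, hPd⟩ := hlink
    rw [heq'] at hP hPd
    refine ⟨P, fun c hc => ?_, hPd⟩
    obtain ⟨h1, h2, h3, q, h4⟩ := hP c hc
    refine ⟨h1, h2, h3.trans (sdiff_subset_sdiff
      (union_subset_union (erase_subset _ _) subset_rfl) subset_rfl), q, ?_⟩
    rw [← h4, bdry_erase_left, inter_erase, erase_eq_of_notMem]
    intro h
    have := h3 (mem_inter.1 h).1
    simp only [mem_sdiff, mem_union, mem_erase] at this
    rcases this.1 with h | h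
    · exact h.1 rfl
    · exact htb h
  · push Not at hC
    obtain ⟨t, ht⟩ : (T \ S).Nonempty := by
      rw [sdiff_nonempty]
      exact fun h => hTS (h.antisymm hS)
    exact linkage_of_hall hS hmin (fun t ht => (hC t ht).2) (hC t ht).1

/-! ### Rooted minors and linkedness -/

/-- Inside `U` there is a `C₅`-minor rooted at `x 0, …, x 4` in this cyclic order. -/
def RootedMinor (G : SimpleGraph V) (U : Finset V) (x : Fin 5 → V) : Prop :=
  ∃ B : Fin 5 → Finset V, (∀ i, x i ∈ B i ∧ B i ⊆ U ∧ Conn G (B i)) ∧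
    (∀ i j, i ≠ j → Disjoint (B i) (B j)) ∧ ∀ i, Touch G (B i) (B (i + 1))

/-- For every distribution of the vertices of `X` over five places in cyclic order, `G[U]` has
disjoint connected sets through the vertices with a common place, with edges between the sets of
consecutive places. -/
def Linked (G : SimpleGraph V) (U X : Finset V) : Prop :=
  ∀ col : V → Fin 5, ∃ B : Fin 5 → Finset V, (∀ i, B i ⊆ U) ∧
    (∀ i j, i ≠ j → Disjoint (B i) (B j)) ∧ (∀ x ∈ X, x ∈ B (col x) ∧ Conn G (B (col x))) ∧
    ∀ x ∈ X, ∀ y ∈ X, col y = col x + 1 → Touch G (B (col x)) (B (col y))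

theorem Linked.mono {G : SimpleGraph V} {U U' X X' : Finset V} (h : Linked G U X) (hU : U ⊆ U')
    (hX : X' ⊆ X) : Linked G U' X' := by
  intro col
  obtain ⟨B, h1, h2, h3, h4⟩ := h col
  exact ⟨B, fun i => (h1 i).trans hU, h2, fun x hx => h3 x (hX hx),
    fun x hx y hy => h4 x (hX hx) y (hX hy)⟩

theorem Linked.rootedMinor {G : SimpleGraph V} {U X : Finset V} (h : Linked G U X)
    {x : Fin 5 → V} (hx : Function.Injective x) (hX : ∀ i, x i ∈ X) : RootedMinor G U x := by
  have hinv : ∀ i, Function.invFun x (x i) = i := Function.leftInverse_invFun hx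
  obtain ⟨B, h1, h2, h3, h4⟩ := h (Function.invFun x)
  refine ⟨B, fun i => ?_, h2, fun i => ?_⟩
  · have := h3 (x i) (hX i)
    rw [hinv] at this
    exact ⟨this.1, h1 i, this.2⟩
  · have := h4 (x i) (hX i) (x (i + 1)) (hX _)
    rw [hinv, hinv] at this
    exact this rfl

/-- Merging the branch sets of a rooted minor along a monotone map. -/
theorem conn_biUnion_monotone {G : SimpleGraph V} {B : Fin 5 → Finset V} {g : Fin 5 → Fin 5}
    (hg : Monotone g) (hB : ∀ i, Conn G (B i)) (ht : ∀ i, Touch G (B i) (B (i + 1))) {k : Fin 5}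
    (hk : ∃ j, g j = k) : Conn G ((univ.filter fun j => g j = k).biUnion B) := by
  obtain ⟨j₀, hj₀⟩ := hk
  obtain ⟨b, hb⟩ := (hB j₀).1
  refine conn_of_cut ⟨b, mem_biUnion.2 ⟨j₀, by simpa using hj₀, hb⟩⟩ fun T hT hTm => ?_
  have hsub : ∀ j, g j = k → B j ⊆ (univ.filter fun j => g j = k).biUnion B := fun j hj =>
    subset_biUnion_of_mem B (by simpa using hj)
  have hdich : ∀ j, g j = k → ∀ y ∈ B j, y ∈ T → B j ⊆ T := by
    intro j hj y hy hyT
    rcases (hB j).subset_or_disjoint fun a ha haT b hb hab =>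
      hT a (hsub j hj ha) haT b (hsub j hj hb) hab with h | h
    · exact h
    · exact absurd hyT (disjoint_left.1 h hy)
  have hstep : ∀ j, g j = k → g (j + 1) = k → (B j ⊆ T ↔ B (j + 1) ⊆ T) := by
    intro j hj hj1
    obtain ⟨a, ha, b, hb, hab⟩ := ht j
    constructor
    · intro h
      exact hdich _ hj1 b hb (hT a (hsub j hj ha) (h ha) b (hsub _ hj1 hb) hab)
    · intro h
      exact hdich _ hj a ha (hT b (hsub _ hj1 hb) (h hb) a (hsub j hj ha) hab.symm)
  have hup : ∀ (d : ℕ) (i j : Fin 5), g i = k → g j = k → i.val + d = j.val →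
      (B i ⊆ T ↔ B j ⊆ T) := by
    intro d
    induction d with
    | zero =>
      intro i j _ _ hij
      obtain rfl : i = j := Fin.ext (by simpa using hij)
      rfl
    | succ d ih =>
      intro i j hi hj hij
      have hlt : i.val + 1 < 5 := by omega
      have hi1 : (i + 1).val = i.val + 1 := by
        rw [Fin.val_add_one_of_lt' hlt]
      -- Fibres of a monotone map are intervals, so consecutive steps inside the fibre suffice.
      have hgi1 : g (i + 1) = k := by
        apply le_antisymm
        · rw [← hj]
          exact hg (Fin.le_def.2 (by omega))
        · rw [← hi]
          exact hg (Fin.le_def.2 (by omega))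
      rw [hstep i hi hgi1]
      exact ih _ _ hgi1 hj (by omega)
  obtain ⟨a, ha, haT⟩ := hTm
  obtain ⟨i, hi, hai⟩ := mem_biUnion.1 ha
  have hi' : g i = k := by simpa using hi
  have hiT := hdich i hi' a hai haT
  refine biUnion_subset.2 fun j hj => ?_
  have hj' : g j = k := by simpa using hj
  rcases le_total i.val j.val with h | h
  · exact (hup (j.val - i.val) i j hi' hj' (by omega)).1 hiT
  · exact (hup (i.val - j.val) j i hj' hi' (by omega)).2 hiT

/-- For the wrap-around from 4 to 0 the index `4` works. Otherwise the values are consecutive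
integers, and the index just before the first one with value `g j` works. -/
theorem exists_consecutive : ∀ g : Fin 5 → Fin 5, (∀ i j, i ≤ j → g i ≤ g j) →
    ∀ i j, g j = g i + 1 → ∃ l, g l = g i ∧ g (l + 1) = g j := by
  intro g hg i j hij
  by_cases h4 : g i = 4
  · have hj0 : g j = 0 := by rw [hij, h4]; rfl
    refine ⟨4, le_antisymm (by rw [h4]; exact Fin.le_last _) (hg _ _ (Fin.le_last i)), ?_⟩
    rw [hj0]
    exact le_antisymm (hj0 ▸ hg _ _ (Fin.zero_le j)) (Fin.zero_le _)
  · have hgi : (g i).val + 1 < 5 := by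
      have := (g i).isLt
      have : (g i).val ≠ 4 := fun h => h4 (Fin.ext h)
      omega
    have hgj : (g j).val = (g i).val + 1 := by rw [hij, Fin.val_add_one_of_lt' hgi]
    have hex : ∃ n, ∃ h : n < 5, g ⟨n, h⟩ = g j := ⟨j.val, j.isLt, rfl⟩
    obtain ⟨hn, hgn⟩ := Nat.find_spec hex
    set n := Nat.find hex with hndef
    have hin : i.val < n := by
      by_contra hcon
      have := hg ⟨n, hn⟩ i (Fin.le_def.2 (by simpa using Nat.le_of_not_lt hcon))
      rw [hgn, Fin.le_def] at this
      omega
    have hm : n - 1 < 5 := by omega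
    have hsucc : (⟨n - 1, hm⟩ : Fin 5) + 1 = ⟨n, hn⟩ := by
      apply Fin.ext
      rw [Fin.val_add_one_of_lt' (by simp only; omega)]
      simp only
      omega
    refine ⟨⟨n - 1, hm⟩, ?_, by rw [hsucc, hgn]⟩
    have h1 := hg i ⟨n - 1, hm⟩ (Fin.le_def.2 (by simp only; omega))
    have h2 := hg ⟨n - 1, hm⟩ ⟨n, hn⟩ (Fin.le_def.2 (by simp))
    have h3 : g ⟨n - 1, hm⟩ ≠ g j := fun h => Nat.find_min hex (m := n - 1) (by omega) ⟨hm, h⟩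
    rw [hgn] at h2
    apply Fin.ext
    rw [Fin.le_def] at h1 h2
    have : (g ⟨n - 1, hm⟩).val ≠ (g j).val := fun h => h3 (Fin.ext h)
    omega

/-- If every cyclic ordering of a set of five vertices roots a `C₅`-minor, the set is linked. -/
theorem linked_of_rootedMinor {G : SimpleGraph V} {U X : Finset V} (hX : X.card = 5)
    (h : ∀ x : Fin 5 → V, Function.Injective x → (∀ i, x i ∈ X) → RootedMinor G U x) :
    Linked G U X := by
  intro col
  let e : Fin 5 ≃ {y // y ∈ X} := (finCongr hX.symm).trans X.equivFin.symm
  let f : Fin 5 → Fin 5 := fun j => col (e j)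
  -- Listing the roots by increasing place makes vertices of equal place adjacent in the order, so
  -- that branch sets of one place merge into a connected set.
  let σ := Tuple.sort f
  have hmono : Monotone (f ∘ σ) := Tuple.monotone_sort f
  let x : Fin 5 → V := fun j => e (σ j)
  have hxinj : Function.Injective x := fun i j hij => σ.injective (e.injective (Subtype.ext hij))
  obtain ⟨B, h1, h2, h3⟩ := h x hxinj fun i => (e (σ i)).2
  have hcol : ∀ y ∈ X, ∃ j, x j = y ∧ (f ∘ σ) j = col y := by
    intro y hy
    refine ⟨σ.symm (e.symm ⟨y, hy⟩), ?_, ?_⟩ <;> simp [x, f]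
  refine ⟨fun k => (univ.filter fun j => (f ∘ σ) j = k).biUnion B, fun i => ?_, ?_, ?_, ?_⟩
  · exact biUnion_subset.2 fun j _ => (h1 j).2.1
  · intro i j hij
    rw [disjoint_biUnion_left]
    intro k hk
    rw [disjoint_biUnion_right]
    intro l hl
    refine h2 k l fun hkl => hij ?_
    simp only [mem_filter, mem_univ, true_and] at hk hl
    rw [← hk, ← hl, hkl]
  · intro y hy
    obtain ⟨j, hj, hj'⟩ := hcol y hy
    refine ⟨mem_biUnion.2 ⟨j, by simpa using hj', hj ▸ (h1 j).1⟩, ?_⟩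
    exact conn_biUnion_monotone hmono (fun i => (h1 i).2.2) h3 ⟨j, hj'⟩
  · intro y hy z hz hyz
    obtain ⟨j, -, hj⟩ := hcol y hy
    obtain ⟨k, -, hk⟩ := hcol z hz
    obtain ⟨l, hl1, hl2⟩ := exists_consecutive (f ∘ σ) (fun _ _ hij => hmono hij) j k
      (by rw [hj, hk, hyz])
    refine (h3 l).mono le_rfl (subset_biUnion_of_mem B ?_) (subset_biUnion_of_mem B ?_)
    · rw [← hj]
      simpa using hl1
    · rw [← hk]
      simpa using hl2

/-! ### Replacing a piece by a clique, and rigid sets -/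

/-- `G` with all edges between vertices of `Z` added. -/
def addClique (G : SimpleGraph V) (Z : Finset V) : SimpleGraph V where
  Adj a b := G.Adj a b ∨ (a ≠ b ∧ a ∈ Z ∧ b ∈ Z)
  symm := ⟨fun _ _ h => h.imp SimpleGraph.Adj.symm fun h => ⟨h.1.symm, h.2.2, h.2.1⟩⟩
  loopless := ⟨fun _ h => h.elim (fun h => G.loopless.irrefl _ h) fun h => h.1 rfl⟩

theorem le_addClique (G : SimpleGraph V) (Z : Finset V) : G ≤ addClique G Z := fun _ _ h => Or.inl h

/-- A clique can be replaced by a piece in which its vertices are linked. -/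
theorem Linked.of_addClique {G : SimpleGraph V} {A S Z Y : Finset V} (hSA : Disjoint S A)
    (hZA : Z ⊆ A) (h : Linked (addClique G Z) A Y) (hZ : Linked G (S ∪ Z) Z) :
    Linked G (A ∪ S) Y := by
  intro col
  obtain ⟨B, h1, h2, h3, h4⟩ := h col
  -- The clique vertices are coloured by the branch set that contains them; vertices in no branch
  -- set get the dummy colour `0`.
  have hex : ∀ z, ∃ i, (∃ j, z ∈ B j) → z ∈ B i := by
    intro z
    by_cases hz : ∃ j, z ∈ B j
    · obtain ⟨j, hj⟩ := hz
      exact ⟨j, fun _ => hj⟩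
    · exact ⟨0, fun h => absurd h hz⟩
  choose c hc using hex
  have hc' : ∀ z i, z ∈ B i → c z = i := by
    intro z i hz
    by_contra hne
    exact disjoint_left.1 (h2 _ _ hne) (hc z ⟨i, hz⟩) hz
  obtain ⟨C, g1, g2, g3, g4⟩ := hZ c
  -- `C i` may be added only when `B i` meets `Z`: otherwise nothing ties the two together.
  let D : Fin 5 → Finset V := fun i => if Disjoint (B i) Z then B i else B i ∪ C i
  have hBD : ∀ i, B i ⊆ D i := by
    intro i
    by_cases h : Disjoint (B i) Z <;> simp [D, h]
  have hCD : ∀ i z, z ∈ B i → z ∈ Z → C i ⊆ D i := by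
    intro i z hz hzZ
    have : ¬ Disjoint (B i) Z := not_disjoint_iff.2 ⟨z, hz, hzZ⟩
    simp [D, this]
  have hDs : ∀ i, D i ⊆ B i ∪ C i := by
    intro i
    by_cases h : Disjoint (B i) Z <;> simp [D, h]
  have hzC : ∀ z i, z ∈ B i → z ∈ Z → z ∈ C i ∧ Conn G (C i) := by
    intro z i hz hzZ
    have := g3 z hzZ
    rwa [hc' z i hz] at this
  have hBC : ∀ i j, i ≠ j → Disjoint (B i) (C j) := by
    intro i j hij
    rw [disjoint_left]
    intro z hzB hzC'
    have hzZ : z ∈ Z := by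
      rcases mem_union.1 (g1 j hzC') with h | h
      · exact absurd (h1 i hzB) (disjoint_left.1 hSA h)
      · exact h
    exact disjoint_left.1 (g2 i j hij) (hzC z i hzB hzZ).1 hzC'
  have hconn : ∀ i, Conn (addClique G Z) (B i) → Conn G (D i) := by
    intro i hi
    have hcut : ∀ T : Finset V, (∀ a ∈ D i, a ∈ T → ∀ b ∈ D i, G.Adj a b → b ∈ T) →
        B i ⊆ T ∨ Disjoint (B i) T := by
      intro T hT
      refine hi.subset_or_disjoint fun a ha haT b hb hab => ?_
      rcases hab with hab | ⟨-, haZ, hbZ⟩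
      · exact hT a (hBD i ha) haT b (hBD i hb) hab
      · have hCi := hCD i a ha haZ
        rcases (hzC a i ha haZ).2.subset_or_disjoint (T := T) fun a ha haT b hb hab =>
          hT a (hCi ha) haT b (hCi hb) hab with h | h
        · exact h (hzC b i hb hbZ).1
        · exact absurd haT (disjoint_left.1 h (hzC a i ha haZ).1)
    refine conn_of_cut (hi.1.mono (hBD i)) fun T hT hTm => ?_
    by_cases hd : Disjoint (B i) Z
    · have hDi : D i = B i := by simp [D, hd]
      rw [hDi] at hTm ⊢
      rcases hcut T hT with h | h
      · exact h
      · obtain ⟨a, ha, haT⟩ := hTm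
        exact absurd haT (disjoint_left.1 h ha)
    · obtain ⟨z, hz, hzZ⟩ := not_disjoint_iff.1 hd
      have hCi := hCD i z hz hzZ
      have hCdich := (hzC z i hz hzZ).2.subset_or_disjoint (T := T) fun a ha haT b hb hab =>
          hT a (hCi ha) haT b (hCi hb) hab
      have hzT : z ∈ T := by
        obtain ⟨a, ha, haT⟩ := hTm
        rcases mem_union.1 (hDs i ha) with h | h
        · rcases hcut T hT with h' | h'
          · exact h' hz
          · exact absurd haT (disjoint_left.1 h' h)
        · rcases hCdich with h' | h'
          · exact h' (hzC z i hz hzZ).1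
          · exact absurd haT (disjoint_left.1 h' h)
      refine (hDs i).trans (union_subset ?_ ?_)
      · exact (hcut T hT).resolve_right fun h => disjoint_left.1 h hz hzT
      · exact hCdich.resolve_right fun h => disjoint_left.1 h (hzC z i hz hzZ).1 hzT
  refine ⟨D, fun i => (hDs i).trans (union_subset ((h1 i).trans subset_union_left)
    ((g1 i).trans (union_subset subset_union_right (hZA.trans subset_union_left)))), ?_, ?_, ?_⟩
  · intro i j hij
    refine disjoint_of_subset_left (hDs i) (disjoint_of_subset_right (hDs j) ?_)
    rw [disjoint_union_left, disjoint_union_right, disjoint_union_right]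
    exact ⟨⟨h2 i j hij, hBC i j hij⟩, (hBC j i hij.symm).symm, g2 i j hij⟩
  · intro y hy
    exact ⟨hBD _ (h3 y hy).1, hconn _ (h3 y hy).2⟩
  · intro y hy z hz hyz
    obtain ⟨a, ha, b, hb, hab⟩ := h4 y hy z hz hyz
    rcases hab with hab | ⟨-, haZ, hbZ⟩
    · exact ⟨a, hBD _ ha, b, hBD _ hb, hab⟩
    · have := g4 a haZ b hbZ (by rw [hc' a _ ha, hc' b _ hb, hyz])
      rw [hc' a _ ha, hc' b _ hb] at this
      exact this.mono le_rfl (hCD _ a ha haZ) (hCD _ b hb hbZ)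

/-- Transport of linkedness along a linkage from `bdry G U T` to `bdry G U S`. -/
theorem Linked.of_linkage {G : SimpleGraph V} {U S T : Finset V} {P : V → Finset V} {q : V → V}
    (hST : S ⊆ T)
    (hP : ∀ c ∈ bdry G U T, c ∈ P c ∧ Conn G (P c) ∧ P c ⊆ (T ∪ bdry G U T) \ S ∧
      P c ∩ bdry G U S = {q c})
    (hPd : ∀ c ∈ bdry G U T, ∀ d ∈ bdry G U T, c ≠ d → Disjoint (P c) (P d))
    (h : Linked G (S ∪ bdry G U S) ((bdry G U T).image q)) :
    Linked G (T ∪ bdry G U T) (bdry G U T) := by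
  intro col
  have hq : ∀ c ∈ bdry G U T, q c ∈ P c ∧ q c ∈ bdry G U S := fun c hc => by
    have : q c ∈ P c ∩ bdry G U S := by rw [(hP c hc).2.2.2]; simp
    simpa using this
  -- `p` inverts `q` on the ends of the linkage and pulls the colouring back along it; elsewhere its
  -- value is immaterial.
  have hex : ∀ r, ∃ c, (∃ c' ∈ bdry G U T, q c' = r) → c ∈ bdry G U T ∧ q c = r := by
    intro r
    by_cases hr : ∃ c' ∈ bdry G U T, q c' = r
    · obtain ⟨c', hc', hr'⟩ := hr
      exact ⟨c', fun _ => ⟨hc', hr'⟩⟩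
    · exact ⟨r, fun h => absurd h hr⟩
  choose p hp using hex
  have hpq : ∀ c ∈ bdry G U T, p (q c) = c := by
    intro c hc
    obtain ⟨h1, h2⟩ := hp (q c) ⟨c, hc, rfl⟩
    by_contra hne
    refine disjoint_left.1 (hPd _ h1 _ hc hne) (hq _ h1).1 ?_
    rw [h2]
    exact (hq c hc).1
  obtain ⟨B, h1, h2, h3, h4⟩ := h fun r => col (p r)
  have h3' : ∀ c ∈ bdry G U T, q c ∈ B (col c) ∧ Conn G (B (col c)) := by
    intro c hc
    have := h3 (q c) (mem_image_of_mem q hc)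
    rwa [hpq c hc] at this
  have hPB : ∀ c ∈ bdry G U T, ∀ j, col c ≠ j → Disjoint (P c) (B j) := by
    intro c hc j hcj
    rw [disjoint_left]
    intro y hyP hyB
    have hyb : y ∈ bdry G U S := by
      have h5 := (hP c hc).2.2.1 hyP
      exact (mem_union.1 (h1 j hyB)).resolve_left (mem_sdiff.1 h5).2
    have : y ∈ P c ∩ bdry G U S := mem_inter.2 ⟨hyP, hyb⟩
    rw [(hP c hc).2.2.2, mem_singleton] at this
    subst this
    exact disjoint_left.1 (h2 _ _ hcj) (h3' c hc).1 hyB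
  let D : Fin 5 → Finset V := fun i => B i ∪ ((bdry G U T).filter fun c => col c = i).biUnion P
  have hBD : ∀ i, B i ⊆ D i := fun i => subset_union_left
  refine ⟨D, fun i => union_subset ?_ (biUnion_subset.2 fun c hc => ?_), ?_, ?_, ?_⟩
  · exact (h1 i).trans (union_subset (hST.trans subset_union_left) (bdry_subset_union hST))
  · exact (hP c (mem_filter.1 hc).1).2.2.1.trans sdiff_subset
  · intro i j hij
    rw [disjoint_union_left, disjoint_union_right, disjoint_union_right]
    refine ⟨⟨h2 i j hij, ?_⟩, ?_, ?_⟩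
    · rw [disjoint_biUnion_right]
      intro c hc
      obtain ⟨hcT, rfl⟩ := mem_filter.1 hc
      exact (hPB c hcT i hij.symm).symm
    · rw [disjoint_biUnion_left]
      intro c hc
      obtain ⟨hcT, rfl⟩ := mem_filter.1 hc
      exact hPB c hcT j hij
    · rw [disjoint_biUnion_left]
      intro c hc
      rw [disjoint_biUnion_right]
      intro d hd
      obtain ⟨hcT, rfl⟩ := mem_filter.1 hc
      obtain ⟨hdT, rfl⟩ := mem_filter.1 hd
      exact hPd c hcT d hdT fun h => hij (h ▸ rfl)
  · intro c hc
    refine ⟨mem_union_right _ (mem_biUnion.2 ⟨c, by simp [hc], (hP c hc).1⟩), ?_⟩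
    refine conn_union_core (h3' c hc).2 (fun d hd => (hP d (mem_filter.1 hd).1).2.1)
      fun d hd => Or.inl ?_
    obtain ⟨hd, hdc⟩ := mem_filter.1 hd
    rw [not_disjoint_iff]
    exact ⟨q d, hdc ▸ (h3' d hd).1, (hq d hd).1⟩
  · intro c hc d hd hcd
    have := h4 (q c) (mem_image_of_mem q hc) (q d) (mem_image_of_mem q hd)
      (by rw [hpq c hc, hpq d hd, hcd])
    rw [hpq c hc, hpq d hd] at this
    exact this.mono le_rfl (hBD _) (hBD _)

/-- A set `S` all of whose boundary sets (of bounded size, containing the roots on the boundary)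
are linked makes either the roots linked, or a set with smaller boundary. -/
theorem exists_rigid {G : SimpleGraph V} {U X S : Finset V} (hXU : X ⊆ U) (hS : S ⊆ U \ X)
    (h : ∀ R ⊆ bdry G U S, bdry G U S ∩ X ⊆ R → R.card ≤ X.card →
      Linked G (S ∪ bdry G U S) R) :
    Linked G U X ∨ ∃ T, S ⊆ T ∧ T ⊆ U \ X ∧ (bdry G U T).card < X.card ∧
      Linked G (T ∪ bdry G U T) (bdry G U T) := by
  have key : ∀ T, S ⊆ T → T ⊆ U \ X → (bdry G U T).card ≤ X.card →
      (∀ T', S ⊆ T' → T' ⊆ U \ X → (bdry G U T).card ≤ (bdry G U T').card) →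
      Linked G (T ∪ bdry G U T) (bdry G U T) := by
    intro T hST hT hcard hmin
    obtain ⟨P, hP, hPd⟩ := linkage_of_minimal hST fun T' h1 h2 => hmin T' h1 (h2.trans hT)
    have hq : ∀ c, ∃ q, c ∈ bdry G U T → P c ∩ bdry G U S = {q} := by
      intro c
      by_cases hc : c ∈ bdry G U T
      · obtain ⟨q, hq⟩ := (hP c hc).2.2.2
        exact ⟨q, fun _ => hq⟩
      · exact ⟨c, fun h => absurd h hc⟩
    choose q hq using hq
    refine Linked.of_linkage hST (fun c hc => ⟨(hP c hc).1, (hP c hc).2.1, (hP c hc).2.2.1,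
      hq c hc⟩) hPd (h _ ?_ ?_ (card_image_le.trans hcard))
    · intro r hr
      obtain ⟨c, hc, rfl⟩ := mem_image.1 hr
      have : q c ∈ P c ∩ bdry G U S := by rw [hq c hc]; simp
      exact (mem_inter.1 this).2
    -- A root on the boundary of `S` also lies on the boundary of `T`, so it is the end of its own
    -- path.
    · intro y hy
      obtain ⟨hyS, hyX⟩ := mem_inter.1 hy
      have hyT : y ∈ bdry G U T := (mem_union.1 (bdry_subset_union hST hyS)).resolve_left
        fun h => (mem_sdiff.1 (hT h)).2 hyX
      refine mem_image.2 ⟨y, hyT, ?_⟩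
      have : y ∈ P y ∩ bdry G U S := mem_inter.2 ⟨(hP y hyT).1, hyS⟩
      rw [hq y hyT, mem_singleton] at this
      exact this.symm
  have hbX : bdry G U (U \ X) ⊆ X := by
    intro y hy
    obtain ⟨h1, h2, -⟩ := mem_bdry.1 hy
    by_contra h
    exact h2 (mem_sdiff.2 ⟨h1, h⟩)
  -- `T` has the least boundary among all sets between `S` and `U \ X`. If this is not below `|X|`,
  -- then `U \ X`, with boundary `X`, is itself a minimiser.
  obtain ⟨T, hT, hmin⟩ := exists_min_image ((U \ X).powerset.filter (S ⊆ ·))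
    (fun T => (bdry G U T).card) ⟨U \ X, by simpa using hS⟩
  simp only [mem_filter, mem_powerset] at hT hmin
  by_cases hlt : (bdry G U T).card < X.card
  · exact Or.inr ⟨T, hT.2, hT.1, hlt, key T hT.2 hT.1 hlt.le fun T' h1 h2 => hmin T' ⟨h2, h1⟩⟩
  · left
    have hle := hmin (U \ X) ⟨subset_rfl, hS⟩
    have hle' := card_le_card hbX
    have heq : bdry G U (U \ X) = X := eq_of_subset_of_card_le hbX (by omega)
    have := key (U \ X) hS subset_rfl hle' fun T' h1 h2 => hle'.trans
      ((not_lt.1 hlt).trans (hmin T' ⟨h2, h1⟩))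
    rw [heq] at this
    exact this.mono (union_subset sdiff_subset hXU) subset_rfl

/-! ### Counting the edges at a set -/

/-- The edges of `G[U]` that have an end in `S`. -/
noncomputable def inc (G : SimpleGraph V) (U S : Finset V) : Finset (Sym2 V) :=
  U.sym2.filter fun e => e ∈ G.edgeSet ∧ ∃ s ∈ S, s ∈ e

/-- The number of edges of `G[U]` that have an end in `S`. -/
noncomputable def rho (G : SimpleGraph V) (U S : Finset V) : ℕ := (inc G U S).card

theorem mk_mem_inc {G : SimpleGraph V} {U S : Finset V} {a b : V} :
    s(a, b) ∈ inc G U S ↔ a ∈ U ∧ b ∈ U ∧ G.Adj a b ∧ (a ∈ S ∨ b ∈ S) := by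
  simp only [inc, mem_filter, mk_mem_sym2_iff, SimpleGraph.mem_edgeSet, Sym2.mem_iff]
  constructor
  · rintro ⟨⟨h1, h2⟩, h3, s, hs, rfl | rfl⟩
    · exact ⟨h1, h2, h3, Or.inl hs⟩
    · exact ⟨h1, h2, h3, Or.inr hs⟩
  · rintro ⟨h1, h2, h3, h4 | h4⟩
    · exact ⟨⟨h1, h2⟩, h3, a, h4, Or.inl rfl⟩
    · exact ⟨⟨h1, h2⟩, h3, b, h4, Or.inr rfl⟩

theorem inc_subset_inc {G H : SimpleGraph V} {U S W T : Finset V}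
    (h : ∀ a b, a ∈ U → b ∈ U → G.Adj a b → a ∈ S →
      (a ∈ W ∧ b ∈ W ∧ H.Adj a b ∧ (a ∈ T ∨ b ∈ T))) : inc G U S ⊆ inc H W T := by
  intro e
  induction e with
  | _ a b =>
    rw [mk_mem_inc, mk_mem_inc]
    rintro ⟨h1, h2, h3, h4 | h4⟩
    · exact h a b h1 h2 h3 h4
    · obtain ⟨g1, g2, g3, g4⟩ := h b a h2 h1 h3.symm h4
      exact ⟨g2, g1, g3.symm, g4.symm⟩

theorem rho_mono {G H : SimpleGraph V} {U S W T : Finset V} (hGH : G ≤ H) (hU : U ⊆ W)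
    (hS : S ⊆ T) : rho G U S ≤ rho H W T :=
  card_le_card (inc_subset_inc fun _ _ h1 h2 h3 h4 => ⟨hU h1, hU h2, hGH h3, Or.inl (hS h4)⟩)

/-- The edges at `T` not already counted at `S` are those with both ends outside `S`, hence the
smaller ground set in the second term. -/
theorem rho_union (G : SimpleGraph V) (U S T : Finset V) :
    rho G U (S ∪ T) = rho G U S + rho G (U \ S) T := by
  rw [rho, rho, rho, ← card_union_of_disjoint]
  · congr 1
    ext e
    induction e with
    | _ a b =>
      simp only [mem_union, mk_mem_inc, mem_sdiff]
      tauto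
  · rw [disjoint_left]
    intro e
    induction e with
    | _ a b =>
      simp only [mk_mem_inc, mem_sdiff]
      tauto

theorem rho_union_le (G : SimpleGraph V) (U S T : Finset V) :
    rho G U (S ∪ T) ≤ rho G U S + rho G U T := by
  rw [rho_union]
  exact Nat.add_le_add_left (rho_mono le_rfl sdiff_subset subset_rfl) _

theorem rho_empty (G : SimpleGraph V) (U : Finset V) : rho G U ∅ = 0 := by
  simp [rho, inc]

/-- The number of neighbours of `a` in `W`. -/
noncomputable def dg (G : SimpleGraph V) (W : Finset V) (a : V) : ℕ := (W.filter (G.Adj a)).card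

theorem dg_le_card (G : SimpleGraph V) (W : Finset V) (a : V) : dg G W a ≤ W.card :=
  card_filter_le _ _

theorem dg_mono {G : SimpleGraph V} {W W' : Finset V} {a : V} (h : W ⊆ W') :
    dg G W a ≤ dg G W' a := card_le_card (filter_subset_filter _ h)

theorem dg_eq_card_iff {G : SimpleGraph V} {W : Finset V} {a : V} :
    dg G W a = W.card ↔ ∀ w ∈ W, G.Adj a w := card_filter_eq_iff

theorem dg_union_le (G : SimpleGraph V) (W W' : Finset V) (a : V) :
    dg G (W ∪ W') a ≤ dg G W a + dg G W' a := by
  rw [dg, filter_union]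
  exact card_union_le _ _

theorem dg_union {G : SimpleGraph V} {W W' : Finset V} (a : V) (h : Disjoint W W') :
    dg G (W ∪ W') a = dg G W a + dg G W' a := by
  rw [dg, filter_union, card_union_of_disjoint (disjoint_filter_filter h)]
  rfl

theorem rho_singleton {G : SimpleGraph V} {W : Finset V} {a : V} (ha : a ∈ W) :
    rho G W {a} = dg G W a := by
  rw [rho, dg, ← card_image_of_injective (s := W.filter (G.Adj a)) (f := fun b => s(a, b))
    (fun b c h => Sym2.congr_right.1 h)]
  congr 1
  ext e
  induction e with
  | _ b c =>
    simp only [mk_mem_inc, mem_singleton, mem_image, mem_filter, Sym2.eq_iff]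
    constructor
    · rintro ⟨h1, h2, h3, rfl | rfl⟩
      · exact ⟨c, ⟨h2, h3⟩, Or.inl ⟨rfl, rfl⟩⟩
      · exact ⟨b, ⟨h1, h3.symm⟩, Or.inr ⟨rfl, rfl⟩⟩
    · rintro ⟨d, ⟨h1, h2⟩, ⟨rfl, rfl⟩ | ⟨rfl, rfl⟩⟩
      · exact ⟨ha, h1, h2, Or.inl rfl⟩
      · exact ⟨h1, ha, h2.symm, Or.inr rfl⟩

/-- Restricting to `S` and its boundary does not change the edges at `S`. -/
theorem rho_restrict {G : SimpleGraph V} {U S T : Finset V} (hS : S ⊆ U) (hT : T ⊆ S) :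
    rho G (S ∪ bdry G U S) T = rho G U T := by
  refine le_antisymm (rho_mono le_rfl (union_subset hS bdry_subset) subset_rfl) ?_
  refine card_le_card (inc_subset_inc fun a b _ hb hab haT => ?_)
  refine ⟨mem_union_left _ (hT haT), ?_, hab, Or.inl haT⟩
  by_cases hbS : b ∈ S
  · exact mem_union_left _ hbS
  · exact mem_union_right _ (mem_bdry.2 ⟨hb, hbS, a, hT haT, hab⟩)

theorem bdry_restrict {G : SimpleGraph V} {U S T : Finset V} (hS : S ⊆ U) (hT : T ⊆ S) :
    bdry G (S ∪ bdry G U S) T = bdry G U T := by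
  ext y
  simp only [mem_bdry, mem_union]
  constructor
  · rintro ⟨h1 | h1, h2⟩
    · exact ⟨hS h1, h2⟩
    · exact ⟨h1.1, h2⟩
  · rintro ⟨h1, h2, s, hs, hsy⟩
    refine ⟨?_, h2, s, hs, hsy⟩
    by_cases hyS : y ∈ S
    · exact Or.inl hyS
    · exact Or.inr ⟨h1, hyS, s, hT hs, hsy⟩

theorem union_bdry_sdiff {G : SimpleGraph V} {U S : Finset V} :
    (S ∪ bdry G U S) \ bdry G U S = S := by
  rw [union_sdiff_right, Finset.sdiff_eq_self_iff_disjoint, disjoint_left]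
  exact fun y hy h => (mem_bdry.1 h).2.1 hy

/-- A subset with many edges contains a component with many edges. -/
theorem exists_conn_closed {G : SimpleGraph V} {U A : Finset V} (h : 5 * A.card < rho G U A) :
    ∃ K ⊆ A, Conn G K ∧ (∀ k ∈ K, ∀ y ∈ A, G.Adj k y → y ∈ K) ∧ 5 * K.card < rho G U K := by
  induction hn : A.card using Nat.strong_induction_on generalizing A with
  | _ n ih =>
  obtain ⟨s, hs⟩ : A.Nonempty := by
    rw [nonempty_iff_ne_empty]
    rintro rfl
    simp [rho_empty] at h
  have hcl : ∀ k ∈ comp G A s, ∀ y ∈ A, G.Adj k y → y ∈ comp G A s := fun k hk y hy hky =>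
    comp_closed hs hk hy hky
  by_cases hK : 5 * (comp G A s).card < rho G U (comp G A s)
  · exact ⟨_, comp_subset, conn_comp hs, hcl, hK⟩
  · have h1 := rho_union_le G U (comp G A s) (A \ comp G A s)
    rw [union_sdiff_of_subset comp_subset] at h1
    have h2 := card_sdiff_add_card_eq_card (comp_subset (G := G) (U := A) (s := s))
    have h3 : 0 < (comp G A s).card := card_pos.2 ⟨s, mem_comp_self hs⟩
    obtain ⟨K, hK1, hK2, hK3, hK4⟩ := ih (A \ comp G A s).card (by omega) (A := A \ comp G A s)
      (by omega) rfl
    refine ⟨K, hK1.trans sdiff_subset, hK2, fun k hk y hy hky => ?_, hK4⟩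
    refine hK3 k hk y (mem_sdiff.2 ⟨hy, fun hyc => ?_⟩) hky
    exact (mem_sdiff.1 (hK1 hk)).2 (hcl y hyc k (mem_sdiff.1 (hK1 hk)).1 hky.symm)

/-! ### Rooted minors from a few connected sets -/

theorem RootedMinor.of_rotate {G : SimpleGraph V} {U : Finset V} {x : Fin 5 → V} (k : Fin 5)
    (h : RootedMinor G U fun i => x (i + k)) : RootedMinor G U x := by
  obtain ⟨B, h1, h2, h3⟩ := h
  refine ⟨fun i => B (i - k), fun i => ?_, fun i j hij => h2 _ _ ?_, fun i => ?_⟩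
  · have := h1 (i - k)
    beta_reduce at this
    rwa [sub_add_cancel] at this
  · exact fun h => hij (sub_left_injective h)
  · have := h3 (i - k)
    rwa [sub_add_eq_add_sub] at this

/-- Five vertices with disjoint attachments. -/
theorem rootedMinor_of_attach {G : SimpleGraph V} {U : Finset V} {x : Fin 5 → V}
    (hx : Function.Injective x) (hxU : ∀ i, x i ∈ U) (A : Fin 5 → Finset V)
    (hAU : ∀ i, A i ⊆ U) (hxA : ∀ i j, x i ∉ A j) (hA : ∀ i j, i < j → Disjoint (A i) (A j))
    (hc : ∀ i, Conn G (insert (x i) (A i)))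
    (ht : ∀ i, Touch G (insert (x i) (A i)) (insert (x (i + 1)) (A (i + 1)))) :
    RootedMinor G U x := by
  refine ⟨fun i => insert (x i) (A i), fun i => ⟨mem_insert_self _ _,
    insert_subset (hxU i) (hAU i), hc i⟩, fun i j hij => ?_, ht⟩
  simp only [disjoint_insert_left, disjoint_insert_right, mem_insert, not_or]
  refine ⟨⟨hx.ne hij.symm, hxA j i⟩, hxA i j, ?_⟩
  rcases lt_or_gt_of_ne hij with h | h
  · exact hA i j h
  · exact (hA j i h).symm

/-- Three disjoint connected sets that between them provide the five edges of the cycle. -/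
theorem rootedMinor_of_three {G : SimpleGraph V} {U P Q S : Finset V} {x : Fin 5 → V}
    (hx : Function.Injective x) (hxU : ∀ i, x i ∈ U) (hPU : P ⊆ U) (hQU : Q ⊆ U) (hSU : S ⊆ U)
    (hP : Conn G P) (hQ : Conn G Q) (hS : Conn G S) (hPQ : Disjoint P Q) (hPS : Disjoint P S)
    (hQS : Disjoint Q S) (hxP : ∀ i, x i ∉ P) (hxQ : ∀ i, x i ∉ Q) (hxS : ∀ i, x i ∉ S)
    (k : Fin 5) (hS0 : ∃ s ∈ S, G.Adj (x k) s) (hS1 : ∃ s ∈ S, G.Adj (x (k + 1)) s)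
    (hP1 : ∃ s ∈ P, G.Adj (x (k + 1)) s) (hP2 : ∃ s ∈ P, G.Adj (x (k + 2)) s)
    (hP3 : ∃ s ∈ P, G.Adj (x (k + 3)) s) (hQ3 : ∃ s ∈ Q, G.Adj (x (k + 3)) s)
    (hQ4 : ∃ s ∈ Q, G.Adj (x (k + 4)) s) (hQ0 : ∃ s ∈ Q, G.Adj (x k) s) :
    RootedMinor G U x := by
  have left : ∀ {A B : Finset V} {a b : V}, (∃ s ∈ A, G.Adj b s) →
      Touch G (insert a A) (insert b B) := fun {A B a b} ⟨s, hs, hbs⟩ =>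
    ⟨s, mem_insert_of_mem hs, b, mem_insert_self _ _, hbs.symm⟩
  have right : ∀ {A B : Finset V} {a b : V}, (∃ s ∈ B, G.Adj a s) →
      Touch G (insert a A) (insert b B) := fun {A B a b} ⟨s, hs, has⟩ =>
    ⟨a, mem_insert_self _ _, s, mem_insert_of_mem hs, has⟩
  refine RootedMinor.of_rotate k ?_
  -- `S`, `P`, `Q` join the roots `x k`, `x (k + 2)`, `x (k + 4)`; the other two roots stay alone.
  refine rootedMinor_of_attach (fun i j h => add_left_injective k (hx h)) (fun i => hxU _)
    ![S, ∅, P, ∅, Q] ?_ ?_ ?_ ?_ ?_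
  · intro i; fin_cases i <;> simp [hSU, hPU, hQU]
  · intro i j; fin_cases j <;> simp [hxS, hxP, hxQ]
  · intro i j hij
    fin_cases i <;> fin_cases j <;> simp at hij <;> simp [hPQ, hPS.symm, hQS.symm]
  · intro i
    fin_cases i
    · simpa using hS.insert_vertex hS0
    · simpa using conn_singleton G _
    · exact hP.insert_vertex (by rw [add_comm] at hP2; exact hP2)
    · simpa using conn_singleton G _
    · exact hQ.insert_vertex (by rw [add_comm] at hQ4; exact hQ4)
  · intro i
    fin_cases i
    · exact left (by rw [add_comm] at hS1; exact hS1)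
    · exact right (by rw [add_comm] at hP1; exact hP1)
    · exact left (by rw [add_comm] at hP3; exact hP3)
    · exact right (by rw [add_comm] at hQ3; exact hQ3)
    · exact left (by
        have : (4 : Fin 5) + 1 + k = k := by rw [show (4 : Fin 5) + 1 = 0 from rfl, zero_add]
        change ∃ s ∈ Q, G.Adj (x (4 + 1 + k)) s
        rw [this]
        exact hQ0)

/-- The roots `y` and `z` are consecutive in the cyclic order `x`. -/
def Consecutive (x : Fin 5 → V) (y z : V) : Prop :=
  ∃ k, (x k = y ∧ x (k + 1) = z) ∨ (x k = z ∧ x (k + 1) = y)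

/-- Two disjoint connected sets attached to all roots and a third one attached to two consecutive
roots. -/
theorem rootedMinor_of_universal {G : SimpleGraph V} {U X P Q S : Finset V} {x : Fin 5 → V}
    (hXU : X ⊆ U) (hx : Function.Injective x) (hxX : ∀ i, x i ∈ X) (hPU : P ⊆ U \ X)
    (hQU : Q ⊆ U \ X) (hSU : S ⊆ U \ X)
    (hP : Conn G P) (hQ : Conn G Q) (hS : Conn G S) (hPQ : Disjoint P Q) (hPS : Disjoint P S)
    (hQS : Disjoint Q S) (hPx : ∀ y ∈ X, ∃ p ∈ P, G.Adj y p)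
    (hQx : ∀ y ∈ X, ∃ q ∈ Q, G.Adj y q) {y z : V} (hyz : Consecutive x y z)
    (hy : ∃ s ∈ S, G.Adj y s) (hz : ∃ s ∈ S, G.Adj z s) : RootedMinor G U x := by
  have hn : ∀ {A : Finset V}, A ⊆ U \ X → ∀ i, x i ∉ A := fun hA i h =>
    (mem_sdiff.1 (hA h)).2 (hxX i)
  have hU : ∀ {A : Finset V}, A ⊆ U \ X → A ⊆ U := fun hA => hA.trans sdiff_subset
  obtain ⟨k, ⟨rfl, rfl⟩ | ⟨rfl, rfl⟩⟩ := hyz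
  · exact rootedMinor_of_three hx (fun i => hXU (hxX i)) (hU hPU) (hU hQU) (hU hSU) hP hQ hS hPQ
      hPS hQS (hn hPU) (hn hQU) (hn hSU) k hy hz (hPx _ (hxX _)) (hPx _ (hxX _)) (hPx _ (hxX _))
      (hQx _ (hxX _)) (hQx _ (hxX _)) (hQx _ (hxX _))
  · exact rootedMinor_of_three hx (fun i => hXU (hxX i)) (hU hPU) (hU hQU) (hU hSU) hP hQ hS hPQ
      hPS hQS (hn hPU) (hn hQU) (hn hSU) k hz hy (hPx _ (hxX _)) (hPx _ (hxX _)) (hPx _ (hxX _))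
      (hQx _ (hxX _)) (hQx _ (hxX _)) (hQx _ (hxX _))

/-- An independent set of the 5-cycle has at most two vertices. -/
theorem exists_consecutive_mem : ∀ J : Finset (Fin 5), 3 ≤ J.card → ∃ i, i ∈ J ∧ i + 1 ∈ J := by
  decide

theorem range_eq_of_card {X : Finset V} (hX : X.card = 5) {x : Fin 5 → V}
    (hx : Function.Injective x) (hxX : ∀ i, x i ∈ X) : univ.image x = X := by
  apply eq_of_subset_of_card_le
  · intro y hy
    obtain ⟨i, -, rfl⟩ := mem_image.1 hy
    exact hxX i
  · rw [card_image_of_injective _ hx, hX]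
    simp

/-- Among three of the five roots two are consecutive. -/
theorem exists_consecutive_roots {X Y : Finset V} (hX : X.card = 5)
    {x : Fin 5 → V} (hx : Function.Injective x) (hxX : ∀ i, x i ∈ X) (hY : Y ⊆ X)
    (hYc : 3 ≤ Y.card) : ∃ y ∈ Y, ∃ z ∈ Y, Consecutive x y z := by
  have himg : (univ.filter fun i => x i ∈ Y).image x = Y := by
    ext y
    simp only [mem_image, mem_filter, mem_univ, true_and]
    constructor
    · rintro ⟨i, hi, rfl⟩
      exact hi
    · intro hy
      have : y ∈ univ.image x := by rw [range_eq_of_card hX hx hxX]; exact hY hy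
      obtain ⟨i, -, rfl⟩ := mem_image.1 this
      exact ⟨i, hy, rfl⟩
  have hcard : 3 ≤ (univ.filter fun i => x i ∈ Y).card := by
    rw [← card_image_of_injective _ hx, himg]
    exact hYc
  obtain ⟨k, hk, hk'⟩ := exists_consecutive_mem _ hcard
  simp only [mem_filter, mem_univ, true_and] at hk hk'
  exact ⟨_, hk, _, hk', k, Or.inl ⟨rfl, rfl⟩⟩

/-! ### Massed and exceptional pairs -/

/-- `G[U]` has many edges outside `X`, but no part of it with a small boundary does. -/
structure Massed (G : SimpleGraph V) (U X : Finset V) : Prop where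
  subset : X ⊆ U
  card_le : X.card ≤ 5
  mass : 5 * (U \ X).card < rho G U (U \ X)
  sep : ∀ S ⊆ U \ X, (bdry G U S).card < X.card → rho G U S ≤ 5 * S.card

/-- The five roots have two common neighbours. -/
def Exceptional (G : SimpleGraph V) (U X : Finset V) : Prop :=
  X.card = 5 ∧ ∃ a ∈ U \ X, ∃ b ∈ U \ X, a ≠ b ∧ (∀ x ∈ X, G.Adj a x) ∧ ∀ x ∈ X, G.Adj b x

/-- A part with too many edges and least boundary is a massed pair rooted at its own boundary, so
that induction applies to it. -/
theorem massed_restrict {G : SimpleGraph V} {U S : Finset V} (hS : S ⊆ U)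
    (hcard : (bdry G U S).card ≤ 5) (hmass : 5 * S.card < rho G U S)
    (hsep : ∀ T ⊆ S, (bdry G U T).card < (bdry G U S).card → rho G U T ≤ 5 * T.card) :
    Massed G (S ∪ bdry G U S) (bdry G U S) := by
  refine ⟨subset_union_right, hcard, ?_, ?_⟩
  · rwa [union_bdry_sdiff, rho_restrict hS subset_rfl]
  · rw [union_bdry_sdiff]
    intro T hT hlt
    rw [bdry_restrict hS hT] at hlt
    rw [rho_restrict hS hT]
    exact hsep T hT hlt

theorem rho_erase {G : SimpleGraph V} {U A : Finset V} (hA : A ⊆ U) {v : V} (hv : v ∈ A) :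
    rho G U A = rho G U (A.erase v) + dg G (U \ A) v := by
  have h1 : A = A.erase v ∪ {v} := by rw [union_comm, ← insert_eq, insert_erase hv]
  have h2 : U \ A.erase v = (U \ A) ∪ {v} := by
    ext y
    simp only [mem_sdiff, mem_erase, mem_union, mem_singleton]
    by_cases hy : y = v
    · subst hy
      simp [hA hv]
    · simp [hy]
  conv_lhs => rw [h1]
  rw [rho_union, rho_singleton (by rw [h2]; simp), h2, dg_union _ (by simp [hv])]
  simp [dg, filter_singleton]

/-- Edges at two vertices `a`, `b` and the remaining part of `U \ X`. -/
theorem rho_split_pair {G : SimpleGraph V} {U X : Finset V} (hX : X ⊆ U) {a b : V}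
    (ha : a ∈ U \ X) (hb : b ∈ U \ X) (hab : a ≠ b) :
    rho G U (U \ X) ≤ rho G U (((U \ X).erase a).erase b) + dg G X a + dg G X b + 1 := by
  have hb' : b ∈ (U \ X).erase a := mem_erase.2 ⟨hab.symm, hb⟩
  have h1 : U \ ((U \ X).erase a) ⊆ X ∪ {a} := by
    intro y
    simp only [mem_sdiff, mem_erase, mem_union, mem_singleton]
    tauto
  have h2 := (dg_mono (G := G) (a := b) h1).trans (dg_union_le _ _ _ _)
  have h3 := dg_le_card G {a} b
  rw [card_singleton] at h3
  rw [rho_erase sdiff_subset ha, rho_erase ((erase_subset _ _).trans sdiff_subset) hb',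
    Finset.sdiff_sdiff_eq_self hX]
  omega

/-- Edges at three vertices `a`, `b`, `c` and the remaining part of `U \ X`. -/
theorem rho_split_triple {G : SimpleGraph V} {U X : Finset V} (hX : X ⊆ U) {a b c : V}
    (ha : a ∈ U \ X) (hb : b ∈ U \ X) (hc : c ∈ U \ X) (hab : a ≠ b) (hac : a ≠ c)
    (hbc : b ≠ c) : rho G U (U \ X) ≤
      rho G U ((((U \ X).erase a).erase b).erase c) + dg G X a + dg G X b + dg G X c + 3 := by
  have hc' : c ∈ ((U \ X).erase a).erase b := mem_erase.2 ⟨hbc.symm, mem_erase.2 ⟨hac.symm, hc⟩⟩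
  have h1 : U \ (((U \ X).erase a).erase b) ⊆ X ∪ {a, b} := by
    intro y
    simp only [mem_sdiff, mem_erase, mem_union, mem_singleton, mem_insert]
    tauto
  have h2 := (dg_mono (G := G) (a := c) h1).trans (dg_union_le _ _ _ _)
  have h3 := (dg_le_card G {a, b} c).trans card_le_two
  have h4 := rho_split_pair (G := G) hX ha hb hab
  rw [rho_erase (((erase_subset _ _).trans (erase_subset _ _)).trans sdiff_subset) hc'] at h4
  omega

theorem card_erase_pair {A : Finset V} {a b : V} (ha : a ∈ A) (hb : b ∈ A) (hab : a ≠ b) :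
    ((A.erase a).erase b).card + 2 = A.card := by
  have hb' : b ∈ A.erase a := mem_erase.2 ⟨hab.symm, hb⟩
  have h1 := card_erase_add_one hb'
  have h2 := card_erase_add_one ha
  omega

/-- In the exceptional case a part `K` off the two common neighbours that is attached to three
roots yields every rooted minor. -/
theorem rootedMinor_of_exceptional {G : SimpleGraph V} {U X K : Finset V} {a b : V}
    (hXU : X ⊆ U) (hX : X.card = 5) (ha : a ∈ U \ X) (hb : b ∈ U \ X) (hab : a ≠ b)
    (haX : ∀ x ∈ X, G.Adj a x) (hbX : ∀ x ∈ X, G.Adj b x)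
    (hK : K ⊆ U \ X) (haK : a ∉ K) (hbK : b ∉ K) (hc : Conn G K)
    (h3 : 3 ≤ (bdry G U K ∩ X).card) {x : Fin 5 → V} (hx : Function.Injective x)
    (hxX : ∀ i, x i ∈ X) : RootedMinor G U x := by
  obtain ⟨y, hy, z, hz, hyz⟩ := exists_consecutive_roots hX hx hxX inter_subset_right h3
  have hatt : ∀ y ∈ bdry G U K ∩ X, ∃ s ∈ K, G.Adj y s := fun y hy => by
    obtain ⟨-, -, s, hs, hsy⟩ := mem_bdry.1 (mem_inter.1 hy).1
    exact ⟨s, hs, hsy.symm⟩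
  exact rootedMinor_of_universal (P := {a}) (Q := {b}) (S := K) hXU hx hxX
    (singleton_subset_iff.2 ha) (singleton_subset_iff.2 hb) hK (conn_singleton _ _)
    (conn_singleton _ _) hc (disjoint_singleton.2 hab) (disjoint_singleton_left.2 haK)
    (disjoint_singleton_left.2 hbK) (fun y hy => ⟨a, mem_singleton_self a, (haX y hy).symm⟩)
    (fun y hy => ⟨b, mem_singleton_self b, (hbX y hy).symm⟩) hyz (hatt y hy) (hatt z hz)

/-- Removing the two common neighbours costs at most 5 + 5 + 1 edges, one more than the two vertices
pay for, so the extra edge leaves a component `K` with more than `5|K|` edges. Its boundary has at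
least five vertices, all but two of them roots. Among three roots two are consecutive; `K` serves
these, and the common neighbours serve the rest. -/
theorem Massed.linked_of_exceptional {G : SimpleGraph V} {U X : Finset V} (h : Massed G U X)
    (hE : Exceptional G U X) (hmass : 5 * (U \ X).card + 1 < rho G U (U \ X)) :
    Linked G U X := by
  obtain ⟨hX, a, ha, b, hb, hab, haX, hbX⟩ := hE
  refine linked_of_rootedMinor hX fun x hx hxX => ?_
  have h1 := rho_split_pair (G := G) h.subset ha hb hab
  have h2 := card_erase_pair ha hb hab
  have h3 := dg_le_card G X a
  have h4 := dg_le_card G X b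
  obtain ⟨K, hK1, hK2, hK3, hK4⟩ := exists_conn_closed (G := G) (U := U)
    (A := ((U \ X).erase a).erase b) (by omega)
  have hKX : K ⊆ U \ X := hK1.trans ((erase_subset _ _).trans (erase_subset _ _))
  have haK : a ∉ K := fun h => by simpa using hK1 h
  have hbK : b ∉ K := fun h => by simpa using hK1 h
  have h5 : X.card ≤ (bdry G U K).card := by
    by_contra hlt
    have := h.sep K hKX (not_le.1 hlt)
    omega
  refine rootedMinor_of_exceptional h.subset hX ha hb hab haX hbX hKX haK hbK hK2 ?_ hx hxX
  have h6 : bdry G U K ⊆ (bdry G U K ∩ X) ∪ {a, b} := by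
    intro y hy
    obtain ⟨hyU, hyK, s, hs, hsy⟩ := mem_bdry.1 hy
    by_contra hcon
    simp only [mem_union, mem_inter, hy, true_and, mem_insert, mem_singleton, not_or] at hcon
    exact hyK (hK3 s hs y (mem_erase.2 ⟨hcon.2.2, mem_erase.2 ⟨hcon.2.1,
      mem_sdiff.2 ⟨hyU, hcon.1⟩⟩⟩) hsy)
  have h7 := (card_le_card h6).trans (card_union_le _ _)
  have h8 : ({a, b} : Finset V).card ≤ 2 := card_le_two
  omega

theorem Linked.mono_graph {G H : SimpleGraph V} {U X : Finset V} (hGH : G ≤ H)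
    (h : Linked G U X) : Linked H U X := by
  intro col
  obtain ⟨B, h1, h2, h3, h4⟩ := h col
  exact ⟨B, h1, h2, fun x hx => ⟨(h3 x hx).1, (h3 x hx).2.mono hGH⟩,
    fun x hx y hy hxy => (h4 x hx y hy hxy).mono hGH subset_rfl subset_rfl⟩

theorem Exceptional.mono_graph {G H : SimpleGraph V} {U X : Finset V} (hGH : G ≤ H)
    (h : Exceptional G U X) : Exceptional H U X := by
  obtain ⟨hX, a, ha, b, hb, hab, haX, hbX⟩ := h
  exact ⟨hX, a, ha, b, hb, hab, fun x hx => hGH (haX x hx), fun x hx => hGH (hbX x hx)⟩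

/-! ### Minimal counterexamples and their rigid parts -/

/-- A counterexample to the statement that massed implies linked or exceptional, with the fewest
vertices and then the fewest edges. -/
structure Critical (G : SimpleGraph V) (U X : Finset V) : Prop where
  massed : Massed G U X
  not_linked : ¬ Linked G U X
  not_exceptional : ¬ Exceptional G U X
  ih : ∀ (H : SimpleGraph V) (W Y : Finset V), W.card < U.card → Massed H W Y →
    Linked H W Y ∨ Exceptional H W Y
  ih_edges : ∀ H : SimpleGraph V, rho H U (U \ X) < rho G U (U \ X) → Massed H U X →
    Linked H U X ∨ Exceptional H U X

variable {G : SimpleGraph V} {U X : Finset V}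

theorem Critical.linked_of_card_ne (hc : Critical G U X) {H : SimpleGraph V} {W Y : Finset V}
    (hW : W.card < U.card) (hm : Massed H W Y) (hY : Y.card ≠ 5) : Linked H W Y :=
  (hc.ih H W Y hW hm).resolve_right fun h => hY h.1

theorem Critical.linked_of_mass (hc : Critical G U X) {H : SimpleGraph V} {W Y : Finset V}
    (hW : W.card < U.card) (hm : Massed H W Y) (hY : 5 * (W \ Y).card + 1 < rho H W (W \ Y)) :
    Linked H W Y :=
  (hc.ih H W Y hW hm).elim id fun h => hm.linked_of_exceptional h hY

/-- For a maximal such `S`, delete `S` and make its boundary `Z` a clique. The smaller pair is still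
massed, and whatever it yields by minimality lifts back to `G`. -/
theorem Critical.not_rigid_of_lt (hc : Critical G U X) {S : Finset V} (hS : S ⊆ U \ X)
    (hne : S.Nonempty) (hlt : (bdry G U S).card < X.card) :
    ¬ Linked G (S ∪ bdry G U S) (bdry G U S) := by
  intro hlink
  obtain ⟨S, hS', hmax⟩ := exists_max_image ((U \ X).powerset.filter fun S => S.Nonempty ∧
    (bdry G U S).card < X.card ∧ Linked G (S ∪ bdry G U S) (bdry G U S)) card
    ⟨S, by simp only [mem_filter, mem_powerset]; exact ⟨hS, hne, hlt, hlink⟩⟩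
  simp only [mem_filter, mem_powerset] at hS' hmax
  obtain ⟨hS, hne, hlt, hlink⟩ := hS'
  have hXU := hc.massed.subset
  have hX5 := hc.massed.card_le
  set Z := bdry G U S with hZdef
  set A := U \ S with hA
  have hSU : S ⊆ U := hS.trans sdiff_subset
  have hAU : A.card < U.card := by
    have := card_sdiff_add_card_eq_card hSU
    rw [← hA] at this
    have := card_pos.2 hne
    omega
  have hXA : X ⊆ A := fun x hx => mem_sdiff.2 ⟨hXU hx, fun h => (mem_sdiff.1 (hS h)).2 hx⟩
  have hZA : Z ⊆ A := fun z hz => mem_sdiff.2 ⟨(mem_bdry.1 hz).1, (mem_bdry.1 hz).2.1⟩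
  have hSA : Disjoint S A := disjoint_sdiff
  have hsplit : U \ X = S ∪ (A \ X) := by
    ext y
    have h1 := @hS y
    simp only [hA, mem_union, mem_sdiff] at h1 ⊢
    tauto
  have hcard : (U \ X).card = S.card + (A \ X).card := by
    rw [hsplit, card_union_of_disjoint (hSA.mono_right sdiff_subset)]
  -- By `sep`, the deleted part takes at most five edges per vertex with it.
  have hmassA : 5 * (A \ X).card < rho G A (A \ X) := by
    have h1 := hc.massed.mass
    have h2 := hc.massed.sep S hS hlt
    have h3 := rho_union G U S (A \ X)
    rw [← hsplit] at h3
    rw [← hA] at h3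
    omega
  have hGG := le_addClique G Z
  have hmassed : Massed (addClique G Z) A X := by
    refine ⟨hXA, hX5, hmassA.trans_le (rho_mono hGG subset_rfl subset_rfl), ?_⟩
    by_contra! hcon
    obtain ⟨T₀, hT₀⟩ := hcon
    obtain ⟨T, hT, hmin⟩ := exists_min_image ((A \ X).powerset.filter fun T =>
      (bdry (addClique G Z) A T).card < X.card ∧ 5 * T.card < rho (addClique G Z) A T)
      (fun T => (bdry (addClique G Z) A T).card)
      ⟨T₀, by simp only [mem_filter, mem_powerset]; exact ⟨hT₀.1, hT₀.2⟩⟩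
    simp only [mem_filter, mem_powerset] at hT hmin
    obtain ⟨hTA, hTlt, hTm⟩ := hT
    have hTS : ∀ t ∈ T, t ∉ S := fun t ht => (mem_sdiff.1 (mem_sdiff.1 (hTA ht)).1).2
    have hTU : ∀ t ∈ T, t ∈ U := fun t ht => (mem_sdiff.1 (mem_sdiff.1 (hTA ht)).1).1
    -- Off `Z` the new edges play no role, so a violating `T` already violates `sep` in `G`.
    by_cases hTZ : Disjoint T Z
    · have hTn : ∀ t ∈ T, ∀ y ∈ U, G.Adj t y → y ∈ A := by
        intro t ht y hy hty
        refine mem_sdiff.2 ⟨hy, fun hyS => disjoint_left.1 hTZ ht ?_⟩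
        exact mem_bdry.2 ⟨hTU t ht, hTS t ht, y, hyS, hty.symm⟩
      have hadj : ∀ t ∈ T, ∀ y, (addClique G Z).Adj t y → G.Adj t y := by
        rintro t ht y (h | h)
        · exact h
        · exact absurd h.2.1 (disjoint_left.1 hTZ ht)
      have h1 : bdry G U T ⊆ bdry (addClique G Z) A T := by
        intro y hy
        obtain ⟨hyU, hyT, t, ht, hty⟩ := mem_bdry.1 hy
        exact mem_bdry.2 ⟨hTn t ht y hyU hty, hyT, t, ht, hGG hty⟩
      have h2 : rho (addClique G Z) A T ≤ rho G U T :=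
        card_le_card (inc_subset_inc fun a b ha hb hab haT =>
          ⟨(mem_sdiff.1 ha).1, (mem_sdiff.1 hb).1, hadj a haT b hab, Or.inl haT⟩)
      have h3 := hc.massed.sep T (hTA.trans (sdiff_subset_sdiff sdiff_subset subset_rfl))
        ((card_le_card h1).trans_lt hTlt)
      omega
    -- The clique forces `Z` into `T` and its boundary. `T` is linked by minimality, as its boundary
    -- has fewer than five vertices, and then `T ∪ S` is a larger choice than `S`.
    · obtain ⟨z, hzT, hzZ⟩ := not_disjoint_iff.1 hTZ
      have hM := massed_restrict (G := addClique G Z) (U := A) (S := T) (hTA.trans sdiff_subset)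
        (by omega) hTm (fun T' hT' hlt' => by
          by_contra hcon
          have := hmin T' ⟨hT'.trans hTA, by omega, not_le.1 hcon⟩
          omega)
      have hsub : T ∪ bdry (addClique G Z) A T ⊆ A :=
        union_subset (hTA.trans sdiff_subset) bdry_subset
      have hL := hc.linked_of_card_ne ((card_le_card hsub).trans_lt hAU) hM (by omega)
      have hZT : Z ⊆ T ∪ bdry (addClique G Z) A T := by
        intro y hy
        by_cases hyT : y ∈ T
        · exact mem_union_left _ hyT
        · exact mem_union_right _ (mem_bdry.2 ⟨hZA hy, hyT, z, hzT,
            Or.inr ⟨fun h => hyT (h ▸ hzT), hzZ, hy⟩⟩)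
      have hL' := hL.of_addClique (hSA.mono_right hsub) hZT hlink
      have hb : bdry G U (T ∪ S) = bdry (addClique G Z) A T := by
        ext y
        constructor
        · intro hy
          obtain ⟨hyU, hyTS, s, hs, hsy⟩ := mem_bdry.1 hy
          rw [mem_union, not_or] at hyTS
          rcases mem_union.1 hs with h | h
          · exact mem_bdry.2 ⟨mem_sdiff.2 ⟨hyU, hyTS.2⟩, hyTS.1, s, h, hGG hsy⟩
          · exact (mem_union.1 (hZT (mem_bdry.2 ⟨hyU, hyTS.2, s, h, hsy⟩))).resolve_left hyTS.1
        · intro hy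
          obtain ⟨hyA, hyT, t, ht, hty⟩ := mem_bdry.1 hy
          obtain ⟨hyU, hyS⟩ := mem_sdiff.1 hyA
          have hyTS : y ∉ T ∪ S := by simp [hyT, hyS]
          rcases hty with h | ⟨-, -, hyZ⟩
          · exact mem_bdry.2 ⟨hyU, hyTS, t, mem_union_left _ ht, h⟩
          · obtain ⟨-, -, s, hs, hsy⟩ := mem_bdry.1 hyZ
            exact mem_bdry.2 ⟨hyU, hyTS, s, mem_union_right _ hs, hsy⟩
      have := hmax (T ∪ S) ⟨union_subset (hTA.trans (sdiff_subset_sdiff sdiff_subset subset_rfl))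
        hS, ⟨z, mem_union_left _ hzT⟩, by rw [hb]; exact hTlt, by
          rw [hb, union_right_comm]; exact hL'⟩
      rw [card_union_of_disjoint (disjoint_left.2 hTS)] at this
      have := card_pos.2 ⟨z, hzT⟩
      omega
  have hAS : A ∪ S = U := sdiff_union_of_subset hSU
  have hfin : Linked (addClique G Z) A X → False := fun h => by
    have := h.of_addClique hSA hZA hlink
    rw [hAS] at this
    exact hc.not_linked this
  rcases hc.ih _ A X hAU hmassed with h | h
  · exact hfin h
  · by_cases hmass : 5 * (A \ X).card + 1 < rho (addClique G Z) A (A \ X)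
    · exact hfin (hmassed.linked_of_exceptional h hmass)
    -- With no slack in the count, the clique added no edge at `A \ X`, so the two common neighbours
    -- are adjacent to the roots already in `G`.
    · have heq : inc G A (A \ X) = inc (addClique G Z) A (A \ X) := by
        apply eq_of_subset_of_card_le
        · exact inc_subset_inc fun a b ha hb hab haX => ⟨ha, hb, hGG hab, Or.inl haX⟩
        · change rho _ _ _ ≤ rho _ _ _
          omega
      have hadj : ∀ a ∈ A \ X, ∀ x ∈ X, (addClique G Z).Adj a x → G.Adj a x := by
        intro a ha x hx hax
        have : s(a, x) ∈ inc (addClique G Z) A (A \ X) :=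
          mk_mem_inc.2 ⟨(mem_sdiff.1 ha).1, hXA hx, hax, Or.inl ha⟩
        rw [← heq] at this
        exact (mk_mem_inc.1 this).2.2.1
      obtain ⟨h5, a, ha, b, hb, hab, haX, hbX⟩ := h
      have hAX : A \ X ⊆ U \ X := sdiff_subset_sdiff sdiff_subset subset_rfl
      exact hc.not_exceptional ⟨h5, a, hAX ha, b, hAX hb, hab,
        fun x hx => hadj a ha x hx (haX x hx), fun x hx => hadj b hb x hx (hbX x hx)⟩

/-- Sets whose boundary sets are all linked do not occur in a critical pair. -/
theorem Critical.not_core (hc : Critical G U X) {S : Finset V} (hS : S ⊆ U \ X)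
    (hne : S.Nonempty) : ¬ ∀ R ⊆ bdry G U S, bdry G U S ∩ X ⊆ R → R.card ≤ X.card →
      Linked G (S ∪ bdry G U S) R := by
  intro h
  rcases exists_rigid hc.massed.subset hS h with h | ⟨T, h1, h2, h3, h4⟩
  · exact hc.not_linked h
  · exact hc.not_rigid_of_lt h2 (hne.mono h1) h3 h4

theorem Critical.not_rigid (hc : Critical G U X) {S : Finset V} (hS : S ⊆ U \ X)
    (hne : S.Nonempty) : ¬ Linked G (S ∪ bdry G U S) (bdry G U S) := fun h =>
  hc.not_core hS hne fun _ hR _ _ => h.mono subset_rfl hR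

theorem nonempty_of_mass {S : Finset V} (hm : 5 * S.card < rho G U S) : S.Nonempty := by
  rw [nonempty_iff_ne_empty]
  rintro rfl
  simp [rho_empty] at hm

/-- A part with many edges has a boundary as large as `X`, and is itself exceptional. -/
theorem Critical.exceptional_piece (hc : Critical G U X) {S : Finset V} (hS : S ⊆ U \ X)
    (hb : (bdry G U S).card ≤ X.card) (hbX : bdry G U S ≠ X) (hm : 5 * S.card < rho G U S) :
    Exceptional G (S ∪ bdry G U S) (bdry G U S) ∧ rho G U S = 5 * S.card + 1 := by
  have hSU := hS.trans sdiff_subset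
  have hX5 := hc.massed.card_le
  have hM := massed_restrict hSU (hb.trans hX5) hm fun T hT hlt =>
    hc.massed.sep T (hT.trans hS) (hlt.trans_le hb)
  -- If the piece were all of `U`, its boundary would contain `X` and hence equal it by size.
  have hlt : (S ∪ bdry G U S).card < U.card := by
    apply card_lt_card
    refine ⟨union_subset hSU bdry_subset, fun hcon => hbX ?_⟩
    refine (eq_of_subset_of_card_le (fun x hx => ?_) hb).symm
    exact (mem_union.1 (hcon (hc.massed.subset hx))).resolve_left
      fun h => (mem_sdiff.1 (hS h)).2 hx
  have hnl := hc.not_rigid hS (nonempty_of_mass hm)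
  refine ⟨(hc.ih _ _ _ hlt hM).resolve_left hnl, ?_⟩
  by_contra hne
  refine hnl (hc.linked_of_mass hlt hM ?_)
  rw [union_bdry_sdiff, rho_restrict hSU subset_rfl]
  omega

/-! ### The exact number of edges of a minimal counterexample -/

/-- The degree sum over `S`. -/
theorem sum_dg (G : SimpleGraph V) {U S : Finset V} (hS : S ⊆ U) :
    ∑ v ∈ S, (dg G U v + dg G (U \ S) v) = 2 * rho G U S := by
  induction S using Finset.induction_on generalizing U with
  | empty => simp [rho_empty]
  | insert v S hv ih =>
    have hvU : v ∈ U := hS (mem_insert_self _ _)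
    have hSU : S ⊆ U.erase v := fun y hy => mem_erase.2 ⟨fun h => hv (h ▸ hy),
      hS (mem_insert_of_mem hy)⟩
    have h1 := ih hSU
    have h2 : U.erase v \ S = U \ insert v S := by
      ext y
      simp only [mem_sdiff, mem_erase, mem_insert]
      tauto
    have h3 : rho G U (insert v S) = dg G U v + rho G (U.erase v) S := by
      rw [insert_eq, rho_union, rho_singleton hvU, sdiff_singleton_eq_erase]
    have h4 : ∀ w ∈ S, dg G U w = dg G (U.erase v) w + if G.Adj v w then 1 else 0 := by
      intro w _
      have : U = U.erase v ∪ {v} := by rw [union_comm, ← insert_eq, insert_erase hvU]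
      conv_lhs => rw [this]
      rw [dg_union _ (by simp)]
      congr 1
      rw [dg, filter_singleton]
      simp only [G.adj_comm w v]
      split_ifs <;> simp
    have h5 : dg G U v = dg G (U \ insert v S) v + dg G S v := by
      have : U = (U \ insert v S) ∪ insert v S := (sdiff_union_of_subset hS).symm
      conv_lhs => rw [this]
      rw [dg_union _ sdiff_disjoint]
      congr 1
      rw [dg, dg, filter_insert]
      simp
    have h6 : ∑ w ∈ S, (if G.Adj v w then 1 else 0) = dg G S v := by
      rw [dg, card_filter]
    rw [sum_insert hv, h3, sum_congr rfl fun w hw => by rw [h4 w hw, ← h2, add_right_comm],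
      sum_add_distrib, h1, h6]
    omega

/-- Otherwise all neighbours of a non-root are roots, so each non-root contributes at most 5 + 5 to
the degree sum. -/
theorem Massed.exists_inner_edge (h : Massed G U X) :
    ∃ p ∈ U \ X, ∃ q ∈ U \ X, G.Adj p q := by
  by_contra! hcon
  have h1 := sum_dg G (sdiff_subset (s := U) (t := X))
  have h2 : U \ (U \ X) = X := Finset.sdiff_sdiff_eq_self h.subset
  rw [h2] at h1
  have h3 : ∀ v ∈ U \ X, dg G U v + dg G X v ≤ 10 := by
    intro v hv
    have h4 : dg G U v ≤ dg G X v := by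
      refine card_le_card fun y hy => ?_
      obtain ⟨hyU, hvy⟩ := mem_filter.1 hy
      refine mem_filter.2 ⟨?_, hvy⟩
      by_contra hyX
      exact hcon v hv y (mem_sdiff.2 ⟨hyU, hyX⟩) hvy
    have h5 := dg_le_card G X v
    have h6 := h.card_le
    omega
  have h4 := sum_le_card_nsmul _ _ _ h3
  have h5 := h.mass
  rw [h1, smul_eq_mul] at h4
  omega

/-- A critical pair has only just enough edges. -/
theorem Critical.rho_eq (hc : Critical G U X) : rho G U (U \ X) = 5 * (U \ X).card + 1 := by
  by_contra hne
  have hm := hc.massed.mass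
  obtain ⟨p, hp, q, hq, hpq⟩ := hc.massed.exists_inner_edge
  set H := G.deleteEdges {s(p, q)} with hH
  have hHG : H ≤ G := G.deleteEdges_le _
  have hHadj : ∀ a b, G.Adj a b → s(a, b) ≠ s(p, q) → H.Adj a b := by
    intro a b hab h
    simp [hH, hab, h]
  have hnH : ¬ H.Adj p q := by simp [hH]
  have hpqS : ∀ S : Finset V, S ⊆ U \ X → (p ∈ S ∨ q ∈ S) → rho H U S < rho G U S := by
    intro S hS h
    refine card_lt_card ⟨inc_subset_inc fun a b ha hb hab haS => ⟨ha, hb, hHG hab, Or.inl haS⟩,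
      fun hcon => hnH ?_⟩
    have : s(p, q) ∈ inc G U S := mk_mem_inc.2 ⟨(mem_sdiff.1 hp).1, (mem_sdiff.1 hq).1, hpq, h⟩
    exact (mk_mem_inc.1 (hcon this)).2.2.1
  have hdel : rho G U (U \ X) ≤ rho H U (U \ X) + 1 := by
    have : inc G U (U \ X) ⊆ insert s(p, q) (inc H U (U \ X)) := by
      intro e
      induction e with
      | _ a b =>
        intro he
        obtain ⟨h1, h2, h3, h4⟩ := mk_mem_inc.1 he
        by_cases h : s(a, b) = s(p, q)
        · rw [h]
          exact mem_insert_self _ _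
        · exact mem_insert_of_mem (mk_mem_inc.2 ⟨h1, h2, hHadj a b h3 h, h4⟩)
    exact (card_le_card this).trans (card_insert_le _ _)
  -- A violating `S` in `H` can have lost only one boundary vertex, an end of `pq`, whose other end
  -- lies in `S`. In `G` it is then a piece with exactly `5|S| + 1` edges, and the loss of `pq`
  -- brings it down to the permitted number.
  have hmH : Massed H U X := by
    refine ⟨hc.massed.subset, hc.massed.card_le, by omega, fun S hS hlt => ?_⟩
    by_contra hcon
    have hle := rho_mono hHG (subset_refl U) (subset_refl S)
    have hbig : ¬ (bdry G U S).card < X.card := fun h => by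
      have := hc.massed.sep S hS h
      omega
    have hlt' : (bdry H U S).card < (bdry G U S).card := by omega
    obtain ⟨y, hy, hyn⟩ := exists_mem_notMem_of_card_lt_card hlt'
    have hend : ∀ y ∈ bdry G U S, y ∉ bdry H U S → ∃ s ∈ S, s(s, y) = s(p, q) := by
      intro y hy hyn
      obtain ⟨hyU, hyS, s, hs, hsy⟩ := mem_bdry.1 hy
      refine ⟨s, hs, ?_⟩
      by_contra h
      exact hyn (mem_bdry.2 ⟨hyU, hyS, s, hs, hHadj s y hsy h⟩)
    obtain ⟨s, hs, hsy⟩ := hend y hy hyn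
    have hyX : y ∉ X := by
      rcases Sym2.eq_iff.1 hsy with ⟨-, rfl⟩ | ⟨-, rfl⟩
      · exact (mem_sdiff.1 hq).2
      · exact (mem_sdiff.1 hp).2
    have hpS : p ∈ S ∨ q ∈ S := by
      rcases Sym2.eq_iff.1 hsy with ⟨rfl, -⟩ | ⟨rfl, -⟩
      · exact Or.inl hs
      · exact Or.inr hs
    have hsub : bdry G U S ⊆ insert y (bdry H U S) := by
      intro z hz
      by_cases hzH : z ∈ bdry H U S
      · exact mem_insert_of_mem hzH
      · obtain ⟨s', hs', hsz⟩ := hend z hz hzH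
        rw [← hsy] at hsz
        rcases Sym2.eq_iff.1 hsz with ⟨-, rfl⟩ | ⟨rfl, -⟩
        · exact mem_insert_self _ _
        · exact absurd hs' (mem_bdry.1 hy).2.1
    have hcard := (card_le_card hsub).trans (card_insert_le _ _)
    have h1 := hpqS S hS hpS
    have h2 := (hc.exceptional_piece hS (by omega) (fun h => hyX (h ▸ hy)) (by omega)).2
    omega
  rcases hc.ih_edges H (hpqS _ subset_rfl (Or.inl hp)) hmH with h | h
  · exact hc.not_linked (h.mono_graph hHG)
  · exact hc.not_exceptional (h.mono_graph hHG)

/-! ### Contracting an edge -/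

/-- `G` with the neighbours of `v` made adjacent to `u`: off `v`, this is the contraction of the
edge `uv`. -/
def contract (G : SimpleGraph V) (u v : V) : SimpleGraph V where
  Adj a b := G.Adj a b ∨ (a = u ∧ b ≠ u ∧ G.Adj v b) ∨ (b = u ∧ a ≠ u ∧ G.Adj v a)
  symm := ⟨fun _ _ h => h.imp SimpleGraph.Adj.symm Or.symm⟩
  loopless := ⟨fun _ h => h.elim (fun h => G.loopless.irrefl _ h)
    fun h => h.elim (fun h => h.2.1 h.1) fun h => h.2.1 h.1⟩

theorem le_contract (G : SimpleGraph V) (u v : V) : G ≤ contract G u v := fun _ _ h => Or.inl h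

/-- Rooted minors of a contraction lift. -/
theorem Linked.of_contract {u v : V} (huv : G.Adj u v) {W Y : Finset V} (hv : v ∉ W)
    (h : Linked (contract G u v) W Y) : Linked G (insert v W) Y := by
  intro col
  obtain ⟨B, h1, h2, h3, h4⟩ := h col
  -- The contracted vertex is expanded by putting `v` into the branch set of `u`.
  let D : Fin 5 → Finset V := fun i => if u ∈ B i then insert v (B i) else B i
  have hvB : ∀ i, v ∉ B i := fun i h => hv (h1 i h)
  have hBD : ∀ i, B i ⊆ D i := by
    intro i
    by_cases hu : u ∈ B i <;> simp [D, hu]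
  have hDB : ∀ i, D i ⊆ insert v (B i) := by
    intro i
    by_cases hu : u ∈ B i <;> simp [D, hu]
  have hvD : ∀ i, v ∈ D i ↔ u ∈ B i := by
    intro i
    by_cases hu : u ∈ B i <;> simp [D, hu, hvB]
  have htouch : ∀ i j, Touch (contract G u v) (B i) (B j) → Touch G (D i) (D j) := by
    rintro i j ⟨a, ha, b, hb, h | ⟨rfl, -, h⟩ | ⟨rfl, -, h⟩⟩
    · exact ⟨a, hBD i ha, b, hBD j hb, h⟩
    · exact ⟨v, (hvD i).2 ha, b, hBD j hb, h⟩
    · exact ⟨a, hBD i ha, v, (hvD j).2 hb, h.symm⟩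
  refine ⟨D, fun i => (hDB i).trans (insert_subset_insert _ (h1 i)), fun i j hij => ?_,
    fun x hx => ⟨hBD _ (h3 x hx).1, ?_⟩, fun x hx y hy hxy => htouch _ _ (h4 x hx y hy hxy)⟩
  · rw [disjoint_left]
    intro y hyi hyj
    by_cases hyv : y = v
    · subst hyv
      exact disjoint_left.1 (h2 i j hij) ((hvD i).1 hyi) ((hvD j).1 hyj)
    · exact disjoint_left.1 (h2 i j hij) ((mem_insert.1 (hDB i hyi)).resolve_left hyv)
        ((mem_insert.1 (hDB j hyj)).resolve_left hyv)
  · set i := col x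
    obtain ⟨-, hc⟩ := h3 x hx
    refine conn_of_cut (hc.1.mono (hBD i)) fun T hT hTm => ?_
    have huT : u ∈ B i → (u ∈ T ↔ v ∈ T) := fun hu =>
      ⟨fun h => hT u (hBD i hu) h v ((hvD i).2 hu) huv,
        fun h => hT v ((hvD i).2 hu) h u (hBD i hu) huv.symm⟩
    have hd : B i ⊆ T ∨ Disjoint (B i) T := by
      refine hc.subset_or_disjoint ?_
      rintro a ha haT b hb (h | ⟨rfl, -, h⟩ | ⟨rfl, -, h⟩)
      · exact hT a (hBD i ha) haT b (hBD i hb) h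
      · exact hT v ((hvD i).2 ha) ((huT ha).1 haT) b (hBD i hb) h
      · exact (huT hb).2 (hT a (hBD i ha) haT v ((hvD i).2 hb) h.symm)
    have hsub : B i ⊆ T := by
      refine hd.resolve_right fun hdis => ?_
      obtain ⟨a, ha, haT⟩ := hTm
      rcases mem_insert.1 (hDB i ha) with rfl | haB
      · have hu := (hvD i).1 ha
        exact disjoint_left.1 hdis hu ((huT hu).2 haT)
      · exact disjoint_left.1 hdis haB haT
    intro y hy
    rcases mem_insert.1 (hDB i hy) with rfl | hyB
    · have hu := (hvD i).1 hy
      exact (huT hu).1 (hsub hu)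
    · exact hsub hyB

/-- The number of edges other than `uv` that are lost when `v` is contracted into `u`; edges
between vertices of `X` do not count. -/
noncomputable def codeg (G : SimpleGraph V) (U X : Finset V) (u v : V) : ℕ :=
  if u ∈ X then ((U \ X).filter fun y => G.Adj v y ∧ G.Adj u y).card + dg G (X.erase u) v
  else (U.filter fun y => G.Adj v y ∧ G.Adj u y).card

theorem rho_contract {u v : V} (hu : u ∈ U) (hv : v ∈ U \ X) (huv : G.Adj u v) :
    rho G U (U \ X) ≤
      rho (contract G u v) (U.erase v) (U.erase v \ X) + 1 + codeg G U X u v := by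
  obtain ⟨hvU, hvX⟩ := mem_sdiff.1 hv
  set W := U.erase v with hW
  have h1 : rho G U (U \ X) = dg G U v + rho G W (W \ X) := by
    have : U \ X = {v} ∪ (W \ X) := by
      ext y
      simp only [hW, mem_sdiff, mem_union, mem_singleton, mem_erase]
      by_cases hy : y = v
      · subst hy
        simp [hvU, hvX]
      · simp [hy]
    rw [this, rho_union, rho_singleton hvU, sdiff_singleton_eq_erase]
  -- `N` lists the neighbours of `v` that give a genuinely new edge at `u`, other than an edge
  -- between two roots. The remaining neighbours are `u` itself and those counted by `codeg`.
  set N := W.filter fun y => G.Adj v y ∧ y ≠ u ∧ ¬ G.Adj u y ∧ (u ∈ X → y ∉ X) with hN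
  have h2 : rho G W (W \ X) + N.card ≤ rho (contract G u v) W (W \ X) := by
    rw [← card_image_of_injective N (f := fun y => s(u, y)) (fun b c h => Sym2.congr_right.1 h),
      rho, ← card_union_of_disjoint]
    · apply card_le_card
      apply union_subset
      · exact inc_subset_inc fun a b ha hb hab haX => ⟨ha, hb, le_contract G u v hab, Or.inl haX⟩
      · intro e he
        obtain ⟨y, hy, rfl⟩ := mem_image.1 he
        obtain ⟨hyW, hvy, hyu, -, hyX⟩ := mem_filter.1 hy
        have huW : u ∈ W := mem_erase.2 ⟨huv.ne, hu⟩
        refine mk_mem_inc.2 ⟨huW, hyW, Or.inr (Or.inl ⟨rfl, hyu, hvy⟩), ?_⟩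
        by_cases huX : u ∈ X
        · exact Or.inr (mem_sdiff.2 ⟨hyW, hyX huX⟩)
        · exact Or.inl (mem_sdiff.2 ⟨huW, huX⟩)
    · rw [disjoint_left]
      intro e he he'
      obtain ⟨y, hy, rfl⟩ := mem_image.1 he'
      exact (mem_filter.1 hy).2.2.2.1 (mk_mem_inc.1 he).2.2.1
  have h3 : dg G U v ≤ N.card + 1 + codeg G U X u v := by
    by_cases huX : u ∈ X
    · have : U.filter (G.Adj v) ⊆ N ∪ {u} ∪
          (((U \ X).filter fun y => G.Adj v y ∧ G.Adj u y) ∪ (X.erase u).filter (G.Adj v)) := by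
        intro y hy
        obtain ⟨hyU, hvy⟩ := mem_filter.1 hy
        simp only [hN, hW, mem_union, mem_filter, mem_erase, mem_singleton, mem_sdiff]
        have := hvy.ne'
        tauto
      have h4 := (card_le_card this).trans (card_union_le _ _)
      have h5 := card_union_le N {u}
      have h6 := card_union_le ((U \ X).filter fun y => G.Adj v y ∧ G.Adj u y)
        ((X.erase u).filter (G.Adj v))
      rw [card_singleton] at h5
      simp only [codeg, huX, if_true, dg]
      omega
    · have : U.filter (G.Adj v) ⊆ N ∪ {u} ∪ (U.filter fun y => G.Adj v y ∧ G.Adj u y) := by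
        intro y hy
        obtain ⟨hyU, hvy⟩ := mem_filter.1 hy
        simp only [hN, hW, mem_union, mem_filter, mem_erase, mem_singleton]
        have := hvy.ne'
        tauto
      have h4 := (card_le_card this).trans (card_union_le _ _)
      have h5 := card_union_le N {u}
      rw [card_singleton] at h5
      simp only [codeg, huX, if_false, dg]
      omega
  omega

/-- Contraction does not increase the number of edges at a set off `u` and `v`, and common
neighbours of `u` and `v` decrease it. -/
theorem rho_contract_le {u v : V} {S : Finset V} (hu : u ∈ U) (hv : v ∈ U) (huv : G.Adj u v)
    (hS : S ⊆ U) (huS : u ∉ S) :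
    rho (contract G u v) (U.erase v) S + (S.filter fun y => G.Adj v y ∧ G.Adj u y).card ≤
      rho G U S := by
  set C := S.filter fun y => G.Adj v y ∧ G.Adj u y with hC
  have hinj : Function.Injective fun y => s(v, y) := fun b c h => Sym2.congr_right.1 h
  have hsub : C.image (fun y => s(v, y)) ⊆ inc G U S := by
    intro e he
    obtain ⟨y, hy, rfl⟩ := mem_image.1 he
    obtain ⟨hyS, hvy, -⟩ := mem_filter.1 hy
    exact mk_mem_inc.2 ⟨hv, hS hyS, hvy, Or.inr hyS⟩
  -- Each edge of the contraction at `S` comes from an edge of `G` under `v ↦ u`. The edges from `v`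
  -- to a common neighbour are not needed, as the edge from `u` gives the same image.
  have himg : inc (contract G u v) (U.erase v) S ⊆
      (inc G U S \ C.image fun y => s(v, y)).image (Sym2.map fun z => if z = v then u else z) := by
    have key : ∀ a b, a ∈ S → a ∈ U.erase v → b ∈ U.erase v → (contract G u v).Adj a b →
        s(a, b) ∈ (inc G U S \ C.image fun y => s(v, y)).image
          (Sym2.map fun z => if z = v then u else z) := by
      intro a b haS ha hb hab
      obtain ⟨hav, haU⟩ := mem_erase.1 ha
      obtain ⟨hbv, hbU⟩ := mem_erase.1 hb
      by_cases hG : G.Adj a b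
      · refine mem_image.2 ⟨s(a, b), mem_sdiff.2 ⟨mk_mem_inc.2 ⟨haU, hbU, hG, Or.inl haS⟩, ?_⟩, ?_⟩
        · intro h
          obtain ⟨y, -, hy⟩ := mem_image.1 h
          rcases Sym2.eq_iff.1 hy with ⟨h, -⟩ | ⟨h, -⟩
          · exact hav h.symm
          · exact hbv h.symm
        · simp [hav, hbv]
      · rcases hab with h | ⟨rfl, -, h⟩ | ⟨rfl, -, h⟩
        · exact absurd h hG
        · exact absurd haS huS
        · refine mem_image.2 ⟨s(a, v), mem_sdiff.2 ⟨mk_mem_inc.2 ⟨haU, hv, h.symm, Or.inl haS⟩,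
            ?_⟩, ?_⟩
          · intro h'
            obtain ⟨y, hy, hya⟩ := mem_image.1 h'
            rcases Sym2.eq_iff.1 hya with ⟨h1, -⟩ | ⟨-, rfl⟩
            · exact hav h1.symm
            · exact hG (mem_filter.1 hy).2.2.symm
          · simp [hav]
    intro e
    induction e with
    | _ a b =>
      intro he
      obtain ⟨ha, hb, hab, haS | hbS⟩ := mk_mem_inc.1 he
      · exact key a b haS ha hb hab
      · rw [Sym2.eq_swap]
        exact key b a hbS hb ha hab.symm
  have h1 := (card_le_card himg).trans card_image_le
  rw [card_sdiff_of_subset hsub, card_image_of_injective _ hinj] at h1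
  have h2 := card_le_card hsub
  rw [card_image_of_injective _ hinj] at h2
  change rho _ _ _ ≤ rho G U S - _ at h1
  change _ ≤ rho G U S at h2
  omega

/-- Contracting an edge of a critical pair that loses few edges gives an exceptional pair. -/
theorem Critical.contract (hc : Critical G U X) {u v : V} (hu : u ∈ U) (hv : v ∈ U \ X)
    (huv : G.Adj u v) (hcod : codeg G U X u v ≤ 4) :
    Exceptional (contract G u v) (U.erase v) X ∧
      ¬ Linked (CycleMinor.contract G u v) (U.erase v) X := by
  obtain ⟨hvU, hvX⟩ := mem_sdiff.1 hv
  set C := CycleMinor.contract G u v with hCdef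
  set W := U.erase v with hW
  have hXU := hc.massed.subset
  have hX5 := hc.massed.card_le
  have hXW : X ⊆ W := fun x hx => mem_erase.2 ⟨fun h => hvX (h ▸ hx), hXU hx⟩
  have hWlt : W.card < U.card := card_erase_lt_of_mem hvU
  have huW : u ∈ W := mem_erase.2 ⟨huv.ne, hu⟩
  have hins : insert v W = U := insert_erase hvU
  have hnl : ¬ Linked C W X := fun h => hc.not_linked (by
    have := h.of_contract huv (notMem_erase v U)
    rwa [hins] at this)
  have hcardW : (W \ X).card + 1 = (U \ X).card := by
    rw [hW, erase_sdiff_comm]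
    exact card_erase_add_one hv
  have hWX : W \ X ⊆ U \ X := sdiff_subset_sdiff (erase_subset _ _) subset_rfl
  have hm : Massed C W X := by
    refine ⟨hXW, hX5, ?_, ?_⟩
    · have h1 := rho_contract (G := G) hu hv huv
      have h2 := hc.massed.mass
      rw [← hCdef, ← hW] at h1
      omega
    by_contra! hcon
    obtain ⟨T₀, hT₀⟩ := hcon
    obtain ⟨S, hS, hmin⟩ := exists_min_image ((W \ X).powerset.filter fun T =>
      (bdry C W T).card < X.card ∧ 5 * T.card < rho C W T) (fun T => (bdry C W T).card)
      ⟨T₀, by simp only [mem_filter, mem_powerset]; exact ⟨hT₀.1, hT₀.2⟩⟩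
    simp only [mem_filter, mem_powerset] at hS hmin
    obtain ⟨hSW, hSlt, hSm⟩ := hS
    -- If `u ∈ S`, expanding the contracted vertex makes `insert v S` a linked part with the same
    -- small boundary, which is excluded.
    by_cases huS : u ∈ S
    · have hM := massed_restrict (hSW.trans sdiff_subset) (by omega) hSm
        (fun T' hT' hlt' => by
          by_contra hcon
          have := hmin T' ⟨hT'.trans hSW, by omega, not_le.1 hcon⟩
          omega)
      have hsub : S ∪ bdry C W S ⊆ W := union_subset (hSW.trans sdiff_subset) bdry_subset
      have hL := hc.linked_of_card_ne ((card_le_card hsub).trans_lt hWlt) hM (by omega)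
      have hL' := hL.of_contract huv (fun h => notMem_erase v U (hsub h))
      have hb : bdry G U (insert v S) = bdry C W S := by
        ext y
        constructor
        · intro hy
          obtain ⟨hyU, hyS, s, hs, hsy⟩ := mem_bdry.1 hy
          rw [mem_insert, not_or] at hyS
          have hyW : y ∈ W := mem_erase.2 ⟨hyS.1, hyU⟩
          rcases mem_insert.1 hs with rfl | hs
          · exact mem_bdry.2 ⟨hyW, hyS.2, u, huS,
              Or.inr (Or.inl ⟨rfl, fun h => hyS.2 (h ▸ huS), hsy⟩)⟩
          · exact mem_bdry.2 ⟨hyW, hyS.2, s, hs, Or.inl hsy⟩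
        · intro hy
          obtain ⟨hyW, hyS, s, hs, hsy⟩ := mem_bdry.1 hy
          obtain ⟨hyv, hyU⟩ := mem_erase.1 hyW
          have hyI : y ∉ insert v S := by simp [hyv, hyS]
          rcases hsy with h | ⟨-, -, h⟩ | ⟨rfl, -, -⟩
          · exact mem_bdry.2 ⟨hyU, hyI, s, mem_insert_of_mem hs, h⟩
          · exact mem_bdry.2 ⟨hyU, hyI, v, mem_insert_self _ _, h⟩
          · exact absurd huS hyS
      refine hc.not_rigid_of_lt (insert_subset hv (hSW.trans hWX)) ⟨v, mem_insert_self _ _⟩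
        (by rw [hb]; exact hSlt) ?_
      rw [hb, insert_union]
      exact hL'
    -- If `u ∉ S`, both `u` and `v` must be on the boundary in `G`, and the part is exceptional with
    -- `5|S| + 1` edges. Its two common neighbours are also common to `u` and `v`, so contraction
    -- loses two edges there: too many for `S` to violate the bound.
    · have hSX : S ⊆ U \ X := hSW.trans hWX
      have hrho := rho_contract_le hu hvU huv (hSX.trans sdiff_subset) huS
      rw [← hCdef, ← hW] at hrho
      have hbsub : bdry G U S ⊆ insert v (bdry C W S) := by
        intro y hy
        obtain ⟨hyU, hyS, s, hs, hsy⟩ := mem_bdry.1 hy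
        by_cases hyv : y = v
        · exact mem_insert.2 (Or.inl hyv)
        · exact mem_insert_of_mem (mem_bdry.2 ⟨mem_erase.2 ⟨hyv, hyU⟩, hyS, s, hs, Or.inl hsy⟩)
      have hbig : X.card ≤ (bdry G U S).card := by
        by_contra h
        have := hc.massed.sep S hSX (not_le.1 h)
        omega
      have hcard := card_insert_le v (bdry C W S)
      have hbeq : bdry G U S = insert v (bdry C W S) :=
        eq_of_subset_of_card_le hbsub (by omega)
      have hvb : v ∈ bdry G U S := by
        rw [hbeq]
        exact mem_insert_self _ _
      have hub : u ∈ bdry G U S := by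
        obtain ⟨-, -, s, hs, hsv⟩ := mem_bdry.1 hvb
        rw [hbeq]
        exact mem_insert_of_mem (mem_bdry.2 ⟨huW, huS, s, hs,
          Or.inr (Or.inr ⟨rfl, fun h => huS (h ▸ hs), hsv.symm⟩)⟩)
      obtain ⟨⟨-, a, ha, b, hb, hab, haY, hbY⟩, hrS⟩ := hc.exceptional_piece hSX
        ((card_le_card hbsub).trans (by omega)) (fun h => hvX (h ▸ hvb)) (by omega)
      rw [union_bdry_sdiff] at ha hb
      have h2 : ({a, b} : Finset V) ⊆ S.filter fun y => G.Adj v y ∧ G.Adj u y := by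
        intro y hy
        rcases mem_insert.1 hy with rfl | hy
        · exact mem_filter.2 ⟨ha, (haY v hvb).symm, (haY u hub).symm⟩
        · rw [mem_singleton] at hy
          subst hy
          exact mem_filter.2 ⟨hb, (hbY v hvb).symm, (hbY u hub).symm⟩
      have h3 := card_le_card h2
      rw [card_pair hab] at h3
      omega
  exact ⟨(hc.ih C W X hWlt hm).resolve_left hnl, hnl⟩

/-! ### Excluding exceptional contractions: frames, pieces and fans -/

theorem exists_index (hX : X.card = 5) {x : Fin 5 → V} (hx : Function.Injective x)
    (hxX : ∀ i, x i ∈ X) {y : V} (hy : y ∈ X) : ∃ i, x i = y := by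
  rw [← range_eq_of_card hX hx hxX] at hy
  simpa using hy

theorem dg_lt_card {a : V} (h : ∃ y ∈ X, ¬ G.Adj a y) : dg G X a < X.card := by
  refine lt_of_le_of_ne (dg_le_card G X a) fun heq => ?_
  obtain ⟨y, hy, hay⟩ := h
  exact hay (dg_eq_card_iff.1 heq y hy)

theorem exists_only_nonadj {a : V} (h : dg G X a + 1 = X.card) :
    ∃ y ∈ X, ¬ G.Adj a y ∧ ∀ z ∈ X, z ≠ y → G.Adj a z := by
  have h1 := card_filter_add_card_filter_not (s := X) (G.Adj a)
  have h2 : (X.filter fun y => ¬ G.Adj a y).card = 1 := by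
    change dg G X a + _ = _ at h1
    omega
  obtain ⟨y, hy⟩ := card_eq_one.1 h2
  have hy' : y ∈ X.filter fun y => ¬ G.Adj a y := by rw [hy]; simp
  refine ⟨y, (mem_filter.1 hy').1, (mem_filter.1 hy').2, fun z hz hzy => ?_⟩
  by_contra hcon
  have : z ∈ X.filter fun y => ¬ G.Adj a y := mem_filter.2 ⟨hz, hcon⟩
  rw [hy] at this
  exact hzy (by simpa using this)

/-- A connected set through `v` meets the components off `v` in neighbours of `v`. -/
theorem Conn.exists_adj_comp {S A : Finset V} {v s : V} (hS : Conn G S) (hv : v ∈ S)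
    (hvA : v ∉ A) (hSA : S ⊆ insert v A) (hs : s ∈ S) (hsA : s ∈ A) :
    ∃ t ∈ comp G A s, G.Adj v t := by
  by_contra! hcon
  rcases hS.subset_or_disjoint (T := comp G A s) (fun c _ hc d hd hcd => by
    rcases mem_insert.1 (hSA hd) with rfl | hdA
    · exact absurd hcd.symm (hcon c hc)
    · exact comp_closed hsA hc hdA hcd) with h | h
  · exact hvA (comp_subset (h hv))
  · exact disjoint_left.1 h hs (mem_comp_self hsA)

/-- Three vertices `a`, `b`, `v` off which every connected part is attached to at most two roots. -/
structure Frame (G : SimpleGraph V) (U X : Finset V) (a b v : V) : Prop where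
  ha : a ∈ U \ X
  hb : b ∈ U \ X
  hv : v ∈ U \ X
  hab : a ≠ b
  hav : a ≠ v
  hbv : b ≠ v
  attach : ∀ K ⊆ (((U \ X).erase a).erase b).erase v, Conn G K → (bdry G U K ∩ X).card ≤ 2

theorem Frame.mem_rest {a b v y : V} :
    y ∈ (((U \ X).erase a).erase b).erase v ↔ y ≠ v ∧ y ≠ b ∧ y ≠ a ∧ y ∈ U \ X := by
  simp only [mem_erase]

theorem Frame.card_rest {a b v : V} (h : Frame G U X a b v) :
    ((((U \ X).erase a).erase b).erase v).card + 3 = (U \ X).card := by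
  have h1 := card_erase_pair h.ha h.hb h.hab
  have h2 : v ∈ ((U \ X).erase a).erase b :=
    mem_erase.2 ⟨h.hbv.symm, mem_erase.2 ⟨h.hav.symm, h.hv⟩⟩
  have h3 := card_erase_add_one h2
  omega

/-- A component off `a`, `b`, `v` with many edges, attached to the roots `y` and `z`, with two
vertices `p` and `q` adjacent to its whole boundary. -/
structure Piece (G : SimpleGraph V) (U X : Finset V) (a b v : V) (K : Finset V) (y z p q : V) :
    Prop where
  sub : K ⊆ (((U \ X).erase a).erase b).erase v
  conn : Conn G K
  closed : ∀ k ∈ K, ∀ w ∈ (((U \ X).erase a).erase b).erase v, G.Adj k w → w ∈ K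
  rho_eq : rho G U K = 5 * K.card + 1
  hy : y ∈ X
  hz : z ∈ X
  hyz : y ≠ z
  only : ∀ w ∈ bdry G U K, w ∈ X → w = y ∨ w = z
  hv : v ∈ bdry G U K
  hyK : y ∈ bdry G U K
  hzK : z ∈ bdry G U K
  hp : p ∈ K
  hq : q ∈ K
  hpq : p ≠ q
  adj : ∀ w, w = a ∨ w = b ∨ w = v ∨ w = y ∨ w = z → G.Adj p w ∧ G.Adj q w

theorem Piece.swap {a b v y z p q : V} {K : Finset V} (h : Piece G U X a b v K y z p q) :
    Piece G U X a b v K z y p q :=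
  ⟨h.sub, h.conn, h.closed, h.rho_eq, h.hz, h.hy, h.hyz.symm, fun w hw hwX => (h.only w hw hwX).symm,
    h.hv, h.hzK, h.hyK, h.hp, h.hq, h.hpq, fun w hw => h.adj w (by tauto)⟩

/-- A connected set off `a`, `b`, `v` that is attached to another root misses the piece. -/
theorem Piece.disjoint_comp {a b v y z p q s w : V} {K : Finset V}
    (h : Piece G U X a b v K y z p q) (hs : s ∈ (((U \ X).erase a).erase b).erase v)
    (hw : w ∈ X) (hwU : w ∈ U) (hsw : G.Adj s w) (hwy : w ≠ y) (hwz : w ≠ z) :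
    Disjoint (comp G ((((U \ X).erase a).erase b).erase v) s) K := by
  rcases (conn_comp (G := G) hs).subset_or_disjoint (T := K) (fun c _ hcK d hd hcd =>
    h.closed c hcK d (comp_subset hd) hcd) with h1 | h1
  · exfalso
    have hsK := h1 (mem_comp_self hs)
    have hwK : w ∈ bdry G U K := mem_bdry.2 ⟨hwU, fun hwK =>
      (mem_sdiff.1 (Frame.mem_rest.1 (h.sub hwK)).2.2.2).2 hw, s, hsK, hsw⟩
    rcases h.only w hwK hw with h | h
    · exact hwy h
    · exact hwz h
  · exact h1

/-- A heavy component has at least five boundary vertices. Only `a`, `b`, `v` and at most two roots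
are available, so all of them occur, and the piece is exceptional by minimality; `p` and `q` are its
common neighbours. -/
theorem Frame.exists_piece {a b v : V} (h : Frame G U X a b v) (hc : Critical G U X)
    (hX : X.card = 5) {A : Finset V} (hA : A ⊆ (((U \ X).erase a).erase b).erase v)
    (hcl : ∀ k ∈ A, ∀ w ∈ (((U \ X).erase a).erase b).erase v, G.Adj k w → w ∈ A)
    (hm : 5 * A.card < rho G U A) : ∃ K ⊆ A, ∃ y z p q, Piece G U X a b v K y z p q := by
  obtain ⟨K, hKA, hK, hKc, hKm⟩ := exists_conn_closed hm
  have hK3 := hKA.trans hA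
  have hKX : K ⊆ U \ X := fun k hk => (Frame.mem_rest.1 (hK3 hk)).2.2.2
  have hclK : ∀ k ∈ K, ∀ w ∈ (((U \ X).erase a).erase b).erase v, G.Adj k w → w ∈ K :=
    fun k hk w hw hkw => hKc k hk w (hcl k (hKA hk) w hw hkw) hkw
  have hge : 5 ≤ (bdry G U K).card := by
    by_contra hlt
    have := hc.massed.sep K hKX (by omega)
    omega
  have hatt := h.attach K hK3 hK
  have hsub : bdry G U K ⊆ {a, b, v} ∪ (bdry G U K ∩ X) := by
    intro w hw
    obtain ⟨hwU, hwK, k, hk, hkw⟩ := mem_bdry.1 hw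
    by_contra hcon
    simp only [mem_union, mem_insert, mem_singleton, mem_inter, hw, true_and, not_or] at hcon
    exact hwK (hclK k hk w (Frame.mem_rest.2 ⟨hcon.1.2.2, hcon.1.2.1, hcon.1.1,
      mem_sdiff.2 ⟨hwU, hcon.2⟩⟩) hkw)
  have h3 : ({a, b, v} : Finset V).card ≤ 3 := card_le_three
  have hle := (card_le_card hsub).trans (card_union_le _ _)
  have hle' := card_union_le {a, b, v} (bdry G U K ∩ X)
  have heq : bdry G U K = {a, b, v} ∪ (bdry G U K ∩ X) :=
    eq_of_subset_of_card_le hsub (by omega)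
  obtain ⟨y, z, hyz, hyzX⟩ := card_eq_two.1 (show (bdry G U K ∩ X).card = 2 by omega)
  have haK : a ∈ bdry G U K := by rw [heq]; simp
  have hbK : b ∈ bdry G U K := by rw [heq]; simp
  have hvK : v ∈ bdry G U K := by rw [heq]; simp
  have hyK : y ∈ bdry G U K ∩ X := by rw [hyzX]; simp
  have hzK : z ∈ bdry G U K ∩ X := by rw [hyzX]; simp
  obtain ⟨hE, hr⟩ := hc.exceptional_piece hKX (by omega)
    (fun heq' => (mem_sdiff.1 h.ha).2 (heq' ▸ haK)) hKm
  obtain ⟨-, p, hp, q, hq, hpq, hpK, hqK⟩ := hE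
  rw [union_bdry_sdiff] at hp hq
  refine ⟨K, hKA, y, z, p, q, hK3, hK, hclK, hr, (mem_inter.1 hyK).2, (mem_inter.1 hzK).2, hyz,
    fun w hw hwX => ?_, hvK, (mem_inter.1 hyK).1, (mem_inter.1 hzK).1, hp, hq, hpq, ?_⟩
  · have : w ∈ bdry G U K ∩ X := mem_inter.2 ⟨hw, hwX⟩
    rw [hyzX] at this
    simpa using this
  · rintro w (rfl | rfl | rfl | rfl | rfl)
    · exact ⟨hpK _ haK, hqK _ haK⟩
    · exact ⟨hpK _ hbK, hqK _ hbK⟩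
    · exact ⟨hpK _ hvK, hqK _ hvK⟩
    · exact ⟨hpK _ (mem_inter.1 hyK).1, hqK _ (mem_inter.1 hyK).1⟩
    · exact ⟨hpK _ (mem_inter.1 hzK).1, hqK _ (mem_inter.1 hzK).1⟩

theorem conn_pair {a b : V} (h : G.Adj a b) : Conn G {a, b} :=
  (conn_singleton G b).insert_vertex ⟨b, mem_singleton_self b, h⟩

theorem pair_subset {A : Finset V} {a b : V} (ha : a ∈ A) (hb : b ∈ A) : ({a, b} : Finset V) ⊆ A :=
  insert_subset ha (singleton_subset_iff.2 hb)

theorem consecutive_or_skip (hX : X.card = 5) {x : Fin 5 → V} (hx : Function.Injective x)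
    (hxX : ∀ i, x i ∈ X) {y z : V} (hy : y ∈ X) (hz : z ∈ X) (hyz : y ≠ z) :
    Consecutive x y z ∨ ∃ m, (x m = y ∧ x (m + 2) = z) ∨ (x m = z ∧ x (m + 2) = y) := by
  obtain ⟨i, rfl⟩ := exists_index hX hx hxX hy
  obtain ⟨j, rfl⟩ := exists_index hX hx hxX hz
  have hij : i ≠ j := fun h => hyz (h ▸ rfl)
  rcases (by decide : ∀ i j : Fin 5, i ≠ j → j = i + 1 ∨ i = j + 1 ∨ j = i + 2 ∨ i = j + 2)
    i j hij with rfl | rfl | rfl | rfl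
  · exact Or.inl ⟨i, Or.inl ⟨rfl, rfl⟩⟩
  · exact Or.inl ⟨j, Or.inr ⟨rfl, rfl⟩⟩
  · exact Or.inr ⟨i, Or.inl ⟨rfl, rfl⟩⟩
  · exact Or.inr ⟨j, Or.inr ⟨rfl, rfl⟩⟩

/-- Two vertices that miss different roots, and a vertex adjacent to all roots. -/
theorem rootedMinor_of_two_missing (hXU : X ⊆ U) {x : Fin 5 → V}
    (hx : Function.Injective x) (hxX : ∀ i, x i ∈ X) {a b v : V} (ha : a ∈ U \ X)
    (hb : b ∈ U \ X) (hv : v ∈ U \ X) (hab : a ≠ b) (hav : a ≠ v) (hbv : b ≠ v)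
    (hbX : ∀ y ∈ X, G.Adj b y) {i j : Fin 5} (hij : i ≠ j) (hai : ∀ k, k ≠ i → G.Adj a (x k))
    (hvj : ∀ k, k ≠ j → G.Adj v (x k)) : RootedMinor G U x := by
  have hn : ∀ {y : V}, y ∈ U \ X → ∀ i, x i ∉ ({y} : Finset V) := fun hy i h =>
    (mem_sdiff.1 hy).2 (mem_singleton.1 h ▸ hxX i)
  have hs : ∀ {y : V}, y ∈ U \ X → ({y} : Finset V) ⊆ U := fun hy =>
    singleton_subset_iff.2 (mem_sdiff.1 hy).1
  have hd : ∀ {y z : V}, y ≠ z → Disjoint ({y} : Finset V) {z} := fun h =>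
    disjoint_singleton.2 h
  have hadj : ∀ {y z : V}, G.Adj y z → ∃ s ∈ ({y} : Finset V), G.Adj z s := fun {y z} h =>
    ⟨y, mem_singleton_self y, h.symm⟩
  -- A rotation `k` in which one of `a`, `v` serves three consecutive roots, the other the next
  -- stretch of three, and each misses only a root it need not serve.
  rcases (by decide : ∀ i j : Fin 5, i ≠ j → ∃ k,
    ((k + 1 ≠ i ∧ k + 2 ≠ i ∧ k + 3 ≠ i) ∧ k + 3 ≠ j ∧ k + 4 ≠ j ∧ k ≠ j) ∨
    ((k + 1 ≠ j ∧ k + 2 ≠ j ∧ k + 3 ≠ j) ∧ k + 3 ≠ i ∧ k + 4 ≠ i ∧ k ≠ i)) i j hij with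
    ⟨k, ⟨⟨h1, h2, h3⟩, h4, h5, h6⟩ | ⟨⟨h1, h2, h3⟩, h4, h5, h6⟩⟩
  · exact rootedMinor_of_three (P := {a}) (Q := {v}) (S := {b}) hx (fun i => hXU (hxX i)) (hs ha)
      (hs hv) (hs hb) (conn_singleton _ _) (conn_singleton _ _) (conn_singleton _ _) (hd hav)
      (hd hab) (hd hbv.symm) (hn ha) (hn hv) (hn hb) k (hadj (hbX _ (hxX _)))
      (hadj (hbX _ (hxX _))) (hadj (hai _ h1)) (hadj (hai _ h2)) (hadj (hai _ h3))
      (hadj (hvj _ h4)) (hadj (hvj _ h5)) (hadj (hvj _ h6))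
  · exact rootedMinor_of_three (P := {v}) (Q := {a}) (S := {b}) hx (fun i => hXU (hxX i)) (hs hv)
      (hs ha) (hs hb) (conn_singleton _ _) (conn_singleton _ _) (conn_singleton _ _) (hd hav.symm)
      (hd hbv.symm) (hd hab) (hn hv) (hn ha) (hn hb) k (hadj (hbX _ (hxX _)))
      (hadj (hbX _ (hxX _))) (hadj (hvj _ h1)) (hadj (hvj _ h2)) (hadj (hvj _ h3))
      (hadj (hai _ h4)) (hadj (hai _ h5)) (hadj (hai _ h6))

/-- Vertices `g`, `h` helped by `p`, `q`, which are adjacent to two roots at distance two. -/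
theorem rootedMinor_of_helpers (hXU : X ⊆ U) {x : Fin 5 → V}
    (hx : Function.Injective x) (hxX : ∀ i, x i ∈ X) {g h b p q : V} (hg : g ∈ U \ X)
    (hh : h ∈ U \ X) (hb : b ∈ U \ X) (hp : p ∈ U \ X) (hq : q ∈ U \ X)
    (hnd : [g, h, b, p, q].Nodup) (hbX : ∀ y ∈ X, G.Adj b y) (m : Fin 5)
    (hpg : G.Adj p g) (hqh : G.Adj q h) (hp0 : G.Adj p (x m)) (hp2 : G.Adj p (x (m + 2)))
    (hq0 : G.Adj q (x m)) (hq2 : G.Adj q (x (m + 2))) (hg1 : G.Adj g (x (m + 1)))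
    (hh34 : G.Adj h (x (m + 3)) ∨ G.Adj h (x (m + 4))) : RootedMinor G U x := by
  simp only [List.nodup_cons, List.mem_cons, not_or, List.not_mem_nil, not_false_eq_true,
    List.nodup_nil, and_true] at hnd
  obtain ⟨⟨h1, h2, h3, h4⟩, ⟨h5, h6, h7⟩, ⟨h8, h9⟩, h10⟩ := hnd
  have hn : ∀ {A : Finset V}, A ⊆ U \ X → ∀ i, x i ∉ A := fun hA i h =>
    (mem_sdiff.1 (hA h)).2 (hxX i)
  have hU : ∀ {A : Finset V}, A ⊆ U \ X → A ⊆ U := fun hA => hA.trans sdiff_subset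
  have hP := pair_subset hg hp
  have hS := pair_subset hh hq
  have hQ := singleton_subset_iff.2 hb
  have hbw : ∀ i, ∃ s ∈ ({b} : Finset V), G.Adj (x i) s := fun i =>
    ⟨b, mem_singleton_self b, (hbX _ (hxX i)).symm⟩
  have d1 : Disjoint ({g, p} : Finset V) {b} := by simp [Ne.symm h2, h8]
  have d2 : Disjoint ({g, p} : Finset V) {h, q} := by
    simp [Ne.symm h1, Ne.symm h4, h6, Ne.symm h10]
  have d3 : Disjoint ({b} : Finset V) {h, q} := by
    simp [h9, Ne.symm h5]
  have wit : ∀ {c d w : V}, G.Adj d w → ∃ s ∈ ({c, d} : Finset V), G.Adj w s := fun {c d w} hd =>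
    ⟨d, by simp, hd.symm⟩
  have wit' : ∀ {c d w : V}, G.Adj c w → ∃ s ∈ ({c, d} : Finset V), G.Adj w s := fun {c d w} hd =>
    ⟨c, by simp, hd.symm⟩
  -- `{h, q}` serves the consecutive roots `m + 2`, `m + 3` or `m + 4`, `m`, while `{g, p}` serves
  -- `m`, `m + 1`, `m + 2` and `b` the rest.
  rcases hh34 with hh3 | hh4
  · have e1 : m + 2 + 1 = m + 3 := by rw [add_assoc]; rfl
    have e3 : m + 2 + 3 = m := by rw [add_assoc]; exact add_zero m
    have e4 : m + 2 + 4 = m + 1 := by rw [add_assoc]; rfl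
    refine rootedMinor_of_three (P := {b}) (Q := {g, p}) (S := {h, q}) hx
      (fun i => hXU (hxX i)) (hU hQ) (hU hP) (hU hS) (conn_singleton _ _) (conn_pair hpg.symm)
      (conn_pair hqh.symm) d1.symm d3 d2 (hn hQ) (hn hP) (hn hS) (m + 2) (wit hq2) ?_ (hbw _)
      (hbw _) (hbw _) ?_ ?_ (wit hp2)
    · rw [e1]; exact wit' hh3
    · rw [e3]; exact wit hp0
    · rw [e4]; exact wit' hg1
  · have e1 : m + 4 + 1 = m := by rw [add_assoc]; exact add_zero m
    have e2 : m + 4 + 2 = m + 1 := by rw [add_assoc]; rfl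
    have e3 : m + 4 + 3 = m + 2 := by rw [add_assoc]; rfl
    refine rootedMinor_of_three (P := {g, p}) (Q := {b}) (S := {h, q}) hx
      (fun i => hXU (hxX i)) (hU hP) (hU hQ) (hU hS) (conn_pair hpg.symm) (conn_singleton _ _)
      (conn_pair hqh.symm) d1 d2 d3 (hn hP) (hn hQ) (hn hS) (m + 4) (wit' hh4) ?_ ?_ ?_ ?_
      (hbw _) (hbw _) (hbw _)
    · rw [e1]; exact wit hq0
    · rw [e1]; exact wit hp0
    · rw [e2]; exact wit' hg1
    · rw [e3]; exact wit hp2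

/-- A connected set through `v` off `a`, `b` and the piece, attached to the root `w`. -/
theorem Frame.exists_arm {a b v s w : V} (h : Frame G U X a b v) (hXU : X ⊆ U) {S : Finset V}
    (hS : S ⊆ ((U \ X).erase a).erase b) (hSc : Conn G S) (hvS : v ∈ S) (hs : s ∈ S)
    (hwX : w ∈ X) (hsw : G.Adj s w) : ∃ D ⊆ ((U \ X).erase a).erase b, Conn G D ∧ v ∈ D ∧
      (∃ d ∈ D, G.Adj w d) ∧
      ∀ K y z p q, Piece G U X a b v K y z p q → w ≠ y → w ≠ z → Disjoint D K := by
  have hv' : v ∈ ((U \ X).erase a).erase b :=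
    mem_erase.2 ⟨h.hbv.symm, mem_erase.2 ⟨h.hav.symm, h.hv⟩⟩
  by_cases hsv : s = v
  · subst hsv
    refine ⟨{s}, singleton_subset_iff.2 hv', conn_singleton _ _, mem_singleton_self s,
      ⟨s, mem_singleton_self s, hsw.symm⟩, fun K y z p q hK _ _ => ?_⟩
    rw [disjoint_singleton_left]
    exact fun hsK => (Frame.mem_rest.1 (hK.sub hsK)).1 rfl
  · have hsA : s ∈ (((U \ X).erase a).erase b).erase v := mem_erase.2 ⟨hsv, hS hs⟩
    obtain ⟨t, ht, hvt⟩ := hSc.exists_adj_comp hvS (notMem_erase v _)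
      (fun y hy => by
        by_cases hyv : y = v
        · exact mem_insert.2 (Or.inl hyv)
        · exact mem_insert_of_mem (mem_erase.2 ⟨hyv, hS hy⟩)) hs hsA
    refine ⟨insert v (comp G ((((U \ X).erase a).erase b).erase v) s),
      insert_subset hv' (comp_subset.trans (erase_subset _ _)),
      (conn_comp hsA).insert_vertex ⟨t, ht, hvt⟩, mem_insert_self _ _,
      ⟨s, mem_insert_of_mem (mem_comp_self hsA), hsw.symm⟩, fun K y z p q hK h1 h2 => ?_⟩
    rw [disjoint_insert_left]
    exact ⟨fun hvK => (Frame.mem_rest.1 (hK.sub hvK)).1 rfl,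
      hK.disjoint_comp hsA hwX (hXU hwX) hsw h1 h2⟩

theorem rest_swap {A : Finset V} {a b v : V} :
    ((A.erase a).erase b).erase v = ((A.erase v).erase b).erase a := by
  ext
  simp only [mem_erase]
  tauto

theorem Frame.reverse {a b v : V} (h : Frame G U X a b v) : Frame G U X v b a :=
  ⟨h.hv, h.hb, h.ha, h.hbv.symm, h.hav.symm, h.hab.symm, fun K hK =>
    h.attach K (rest_swap (a := v) ▸ hK)⟩

/-- The boundary has at least five vertices, and only `a` and `b` can be non-roots. -/
theorem Critical.three_le_attach {a b : V} (hc : Critical G U X)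
    (hX : X.card = 5) {S : Finset V} (hS : S ⊆ ((U \ X).erase a).erase b)
    (hScl : ∀ k ∈ S, ∀ w ∈ ((U \ X).erase a).erase b, G.Adj k w → w ∈ S)
    (hSm : 5 * S.card < rho G U S) : 3 ≤ (bdry G U S ∩ X).card := by
  have hSX : S ⊆ U \ X := hS.trans ((erase_subset _ _).trans (erase_subset _ _))
  have hge : 5 ≤ (bdry G U S).card := by
    by_contra hlt
    have := hc.massed.sep S hSX (by omega)
    omega
  have hsub : bdry G U S ⊆ {a, b} ∪ (bdry G U S ∩ X) := by
    intro w hw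
    obtain ⟨hwU, hwS, k, hk, hkw⟩ := mem_bdry.1 hw
    by_contra hcon
    simp only [mem_union, mem_insert, mem_singleton, mem_inter, hw, true_and, not_or] at hcon
    exact hwS (hScl k hk w (mem_erase.2 ⟨hcon.1.2, mem_erase.2 ⟨hcon.1.1,
      mem_sdiff.2 ⟨hwU, hcon.2⟩⟩⟩) hkw)
  have h1 := (card_le_card hsub).trans (card_union_le _ _)
  have h2 : ({a, b} : Finset V).card ≤ 2 := card_le_two
  omega

theorem exists_third {S : Finset V} (h : 3 ≤ (bdry G U S ∩ X).card) (y z : V) :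
    ∃ w ∈ X, w ≠ y ∧ w ≠ z ∧ ∃ s ∈ S, G.Adj s w := by
  have h3 : ({y, z} : Finset V).card ≤ 2 := card_le_two
  obtain ⟨w, hw, hwn⟩ := exists_mem_notMem_of_card_lt_card
    (show ({y, z} : Finset V).card < (bdry G U S ∩ X).card by omega)
  obtain ⟨hwS, hwX⟩ := mem_inter.1 hw
  obtain ⟨-, -, s, hs, hsw⟩ := mem_bdry.1 hwS
  simp only [mem_insert, mem_singleton, not_or] at hwn
  exact ⟨w, hwX, hwn.1, hwn.2, s, hs, hsw⟩

/-- The component through `v` when the rest has many edges. -/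
theorem Frame.exists_component {a b v : V} (h : Frame G U X a b v) (hc : Critical G U X)
    (hX : X.card = 5)
    (hm : 5 * (((U \ X).erase a).erase b).card < rho G U (((U \ X).erase a).erase b)) :
    ∃ S ⊆ ((U \ X).erase a).erase b, Conn G S ∧ v ∈ S ∧
      (∀ k ∈ S, ∀ w ∈ ((U \ X).erase a).erase b, G.Adj k w → w ∈ S) ∧
      5 * S.card < rho G U S ∧ 3 ≤ (bdry G U S ∩ X).card := by
  obtain ⟨S, hS, hSc, hScl, hSm⟩ := exists_conn_closed hm
  have h3 := hc.three_le_attach hX hS hScl hSm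
  refine ⟨S, hS, hSc, ?_, hScl, hSm, h3⟩
  -- A component missing `v` would be a part off the frame attached to three roots.
  by_contra hvS
  have := h.attach S (fun s hs => mem_erase.2 ⟨fun e => hvS (e ▸ hs), hS hs⟩) hSc
  omega

theorem adj_pair {c d w : V} (h : G.Adj c w ∨ G.Adj d w) :
    ∃ s ∈ ({c, d} : Finset V), G.Adj w s := by
  rcases h with h | h
  · exact ⟨c, by simp, h.symm⟩
  · exact ⟨d, by simp, h.symm⟩

theorem adj_singleton {c w : V} (h : G.Adj c w) : ∃ s ∈ ({c} : Finset V), G.Adj w s :=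
  ⟨c, mem_singleton_self c, h.symm⟩

/-- Both `{b}` and `{a, p}` reach every root. The third set consists of `q` and an arm through `v`
to a third root `w`: it reaches `y`, `z`, `w`, two of which are consecutive. The arm exists because
`a` misses a root, so that removing `a` and `b` costs at most ten edges. -/
theorem Piece.rootedMinor_of_universal {a b v : V} (h : Frame G U X a b v) (hc : Critical G U X)
    (hX : X.card = 5) {x : Fin 5 → V} (hx : Function.Injective x) (hxX : ∀ i, x i ∈ X)
    (hbX : ∀ y ∈ X, G.Adj b y) (ha : ∃ y ∈ X, ¬ G.Adj a y)
    {K : Finset V} {y z p q : V} (hK : Piece G U X a b v K y z p q)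
    (hap : ∀ w ∈ X, G.Adj a w ∨ w = y ∨ w = z) : RootedMinor G U x := by
  have hXU := hc.massed.subset
  have hpr := Frame.mem_rest.1 (hK.sub hK.hp)
  have hqr := Frame.mem_rest.1 (hK.sub hK.hq)
  have hm : 5 * (((U \ X).erase a).erase b).card < rho G U (((U \ X).erase a).erase b) := by
    have h1 := rho_split_pair (G := G) hXU h.ha h.hb h.hab
    have h2 := hc.rho_eq
    have h3 := dg_lt_card ha
    have h4 := dg_le_card G X b
    have h5 := card_erase_pair h.ha h.hb h.hab
    omega
  obtain ⟨S, hS, hSc, hvS, -, -, hS3⟩ := h.exists_component hc hX hm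
  obtain ⟨w, hwX, hwy, hwz, s, hs, hsw⟩ := exists_third hS3 y z
  obtain ⟨D, hD, hDc, hvD, ⟨d, hd, hwd⟩, hDK⟩ := h.exists_arm hXU hS hSc hvS hs hwX hsw
  have hDK := hDK K y z p q hK hwy hwz
  have hsub : ∀ t ∈ D, t ≠ b ∧ t ≠ a ∧ t ∈ U \ X := fun t ht => by
    simpa only [mem_erase] using hD ht
  obtain ⟨t, ht, t', ht', htt⟩ := exists_consecutive_roots (Y := {y, z, w}) hX hx hxX
    (insert_subset hK.hy (pair_subset hK.hz hwX)) (by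
      rw [card_insert_of_notMem (by simp [hK.hyz, Ne.symm hwy]), card_pair (Ne.symm hwz)])
  have hadj : ∀ t ∈ ({y, z, w} : Finset V), ∃ s ∈ insert q D, G.Adj t s := by
    intro t ht
    simp only [mem_insert, mem_singleton] at ht
    rcases ht with rfl | rfl | rfl
    · exact ⟨q, mem_insert_self _ _, (hK.adj _ (by simp)).2.symm⟩
    · exact ⟨q, mem_insert_self _ _, (hK.adj _ (by simp)).2.symm⟩
    · exact ⟨d, mem_insert_of_mem hd, hwd⟩
  have hpD : p ∉ D := fun hp => disjoint_left.1 hDK hp hK.hp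
  have hap' : G.Adj a p := (hK.adj a (by simp)).1.symm
  refine CycleMinor.rootedMinor_of_universal (P := {b}) (Q := {a, p}) (S := insert q D) hXU hx hxX
    (singleton_subset_iff.2 h.hb) (pair_subset h.ha hpr.2.2.2)
    (insert_subset hqr.2.2.2 fun t ht => (hsub t ht).2.2) (conn_singleton _ _)
    (conn_pair hap') (hDc.insert_vertex ⟨v, hvD, (hK.adj v (by simp)).2⟩)
    ?_ ?_ ?_ (fun y hy => adj_singleton (hbX y hy)) (fun w hw => adj_pair ?_) htt
    (hadj t ht) (hadj t' ht')
  · simp [h.hab.symm, Ne.symm hpr.2.1]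
  · rw [disjoint_singleton_left, mem_insert, not_or]
    exact ⟨Ne.symm hqr.2.1, fun hb => (hsub b hb).1 rfl⟩
  · rw [disjoint_insert_left, disjoint_singleton_left, mem_insert, not_or, mem_insert, not_or]
    exact ⟨⟨Ne.symm hqr.2.2.1, fun ha => (hsub a ha).2.1 rfl⟩, hK.hpq, hpD⟩
  · rcases hap w hw with h | rfl | rfl
    · exact Or.inl h
    · exact Or.inr (hK.adj _ (by simp)).1
    · exact Or.inr (hK.adj _ (by simp)).1

theorem Piece.reverse {a b v y z p q : V} {K : Finset V} (h : Piece G U X a b v K y z p q)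
    (ha : a ∈ bdry G U K) : Piece G U X v b a K y z p q :=
  ⟨rest_swap (a := a) ▸ h.sub, h.conn, fun k hk w hw =>
    h.closed k hk w (rest_swap (a := v) ▸ hw), h.rho_eq, h.hy, h.hz, h.hyz, h.only, ha, h.hyK, h.hzK,
    h.hp, h.hq, h.hpq, fun w hw => h.adj w (by tauto)⟩

theorem Frame.mem_bdry_piece {a b v y z p q : V} {K : Finset V} (hf : Frame G U X a b v)
    (h : Piece G U X a b v K y z p q) : a ∈ bdry G U K :=
  mem_bdry.2 ⟨(mem_sdiff.1 hf.ha).1, fun ha => (Frame.mem_rest.1 (h.sub ha)).2.2.1 rfl,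
    p, h.hp, (h.adj a (by simp)).1⟩

/-- Either `v` reaches one of the roots at `m + 3`, `m + 4`, and then `p` and `q` help `a` and `v`,
or the covering hypothesis makes `a` adjacent to both of these and so `{a, p}` reaches every root.
-/
theorem Piece.rootedMinor_of_skip {a b v : V} (h : Frame G U X a b v) (hc : Critical G U X)
    (hX : X.card = 5) {x : Fin 5 → V} (hx : Function.Injective x) (hxX : ∀ i, x i ∈ X)
    (hbX : ∀ y ∈ X, G.Adj b y) (hcov : ∀ y ∈ X, G.Adj a y ∨ G.Adj v y)
    (ha : ∃ y ∈ X, ¬ G.Adj a y)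
    {K : Finset V} {p q : V} {m : Fin 5} (hK : Piece G U X a b v K (x m) (x (m + 2)) p q)
    (ha1 : G.Adj a (x (m + 1))) : RootedMinor G U x := by
  have hXU := hc.massed.subset
  have hpr := Frame.mem_rest.1 (hK.sub hK.hp)
  have hqr := Frame.mem_rest.1 (hK.sub hK.hq)
  have key : G.Adj v (x (m + 3)) ∨ G.Adj v (x (m + 4)) → RootedMinor G U x := fun hor => by
    refine rootedMinor_of_helpers hXU hx hxX h.ha h.hv h.hb hpr.2.2.2 hqr.2.2.2 ?_ hbX m
      (hK.adj a (by simp)).1 (hK.adj v (by simp)).2 (hK.adj _ (by simp)).1 (hK.adj _ (by simp)).1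
      (hK.adj _ (by simp)).2 (hK.adj _ (by simp)).2 ha1 hor
    simp [h.hav, h.hab, h.hbv.symm, hK.hpq, Ne.symm hpr.1, Ne.symm hpr.2.1, Ne.symm hpr.2.2.1,
      Ne.symm hqr.1, Ne.symm hqr.2.1, Ne.symm hqr.2.2.1]
  by_cases hor : G.Adj v (x (m + 3)) ∨ G.Adj v (x (m + 4))
  · exact key hor
  rw [not_or] at hor
  refine hK.rootedMinor_of_universal h hc hX hx hxX hbX ha fun w hw => ?_
  obtain ⟨i, rfl⟩ := exists_index hX hx hxX hw
  rcases (by decide : ∀ m i : Fin 5, i = m ∨ i = m + 1 ∨ i = m + 2 ∨ i = m + 3 ∨ i = m + 4) m i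
    with rfl | rfl | rfl | rfl | rfl
  · exact Or.inr (Or.inl rfl)
  · exact Or.inl ha1
  · exact Or.inr (Or.inr rfl)
  · exact Or.inl ((hcov _ hw).resolve_right hor.1)
  · exact Or.inl ((hcov _ hw).resolve_right hor.2)

/-- One vertex adjacent to all roots, two adjacent vertices covering the roots. -/
theorem Frame.false_of_cover {a b v : V} (h : Frame G U X a b v) (hc : Critical G U X)
    (hX : X.card = 5) (hbX : ∀ y ∈ X, G.Adj b y) (hav : G.Adj a v)
    (hcov : ∀ y ∈ X, G.Adj a y ∨ G.Adj v y) : False := by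
  have hXU := hc.massed.subset
  have hmiss : ∀ c ∈ U \ X, c ≠ b → ∃ y ∈ X, ¬ G.Adj c y := fun c hcU hcb => by
    by_contra! hcon
    exact hc.not_exceptional ⟨hX, c, hcU, b, h.hb, hcb, hcon, hbX⟩
  have ha := hmiss a h.ha h.hab
  have hv := hmiss v h.hv h.hbv.symm
  refine hc.not_linked (linked_of_rootedMinor hX fun x hx hxX => ?_)
  -- If the rest is not heavy, `a`, `b`, `v` have at least 13 edges to the roots in total; as `a`
  -- and `v` each miss a root, both miss exactly one.
  by_cases hm : rho G U ((((U \ X).erase a).erase b).erase v) ≤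
      5 * ((((U \ X).erase a).erase b).erase v).card
  · have h1 := rho_split_triple (G := G) hXU h.ha h.hb h.hv h.hab h.hav h.hbv
    have h2 := hc.rho_eq
    have h3 := h.card_rest
    have h4 := dg_lt_card ha
    have h5 := dg_lt_card hv
    have h6 := dg_le_card G X b
    obtain ⟨y, hy, hay, hay'⟩ := exists_only_nonadj (G := G) (X := X) (a := a) (by omega)
    obtain ⟨z, hz, hvz, hvz'⟩ := exists_only_nonadj (G := G) (X := X) (a := v) (by omega)
    obtain ⟨i, rfl⟩ := exists_index hX hx hxX hy
    obtain ⟨j, rfl⟩ := exists_index hX hx hxX hz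
    refine rootedMinor_of_two_missing hXU hx hxX h.ha h.hb h.hv h.hab h.hav h.hbv hbX
      (i := i) (j := j) ?_ (fun k hk => hay' _ (hxX k) fun e => hk (hx e))
      (fun k hk => hvz' _ (hxX k) fun e => hk (hx e))
    rintro rfl
    exact (hcov _ hy).elim hay hvz
  · obtain ⟨K, -, y, z, p, q, hK⟩ := h.exists_piece hc hX Subset.rfl
      (fun _ _ w hw _ => hw) (not_le.1 hm)
    have hpr := Frame.mem_rest.1 (hK.sub hK.hp)
    -- If the roots of the piece are consecutive, `p` serves them, while `{a, v}` and `{b}` reach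
    -- every root.
    rcases consecutive_or_skip hX hx hxX hK.hy hK.hz hK.hyz with hyz | ⟨m, hm⟩
    · refine CycleMinor.rootedMinor_of_universal (P := {b}) (Q := {a, v}) (S := {p}) hXU hx hxX
        (singleton_subset_iff.2 h.hb) (pair_subset h.ha h.hv) (singleton_subset_iff.2 hpr.2.2.2)
        (conn_singleton _ _) (conn_pair hav) (conn_singleton _ _) ?_ ?_ ?_
        (fun y hy => adj_singleton (hbX y hy)) (fun w hw => adj_pair (hcov w hw)) hyz
        (adj_singleton (hK.adj _ (by simp)).1) (adj_singleton (hK.adj _ (by simp)).1)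
      · simp [h.hab.symm, h.hbv]
      · simp [Ne.symm hpr.2.1]
      · simp [hpr.1, hpr.2.2.1]
    · have hK' : ∃ K p q, Piece G U X a b v K (x m) (x (m + 2)) p q := by
        rcases hm with ⟨rfl, rfl⟩ | ⟨rfl, rfl⟩
        · exact ⟨K, p, q, hK⟩
        · exact ⟨K, p, q, hK.swap⟩
      obtain ⟨K, p, q, hK⟩ := hK'
      rcases hcov _ (hxX (m + 1)) with h1 | h1
      · exact hK.rootedMinor_of_skip h hc hX hx hxX hbX hcov ha h1
      · exact (hK.reverse (h.mem_bdry_piece hK)).rootedMinor_of_skip h.reverse hc hX hx hxX hbX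
          (fun y hy => (hcov y hy).symm) hv h1

/-- The component through `v` when the rest has two edges more than required. -/
theorem Frame.exists_component_add_two {a b v : V} (h : Frame G U X a b v) (hc : Critical G U X)
    (hX : X.card = 5)
    (hm : 5 * (((U \ X).erase a).erase b).card + 1 < rho G U (((U \ X).erase a).erase b)) :
    ∃ S ⊆ ((U \ X).erase a).erase b, Conn G S ∧ v ∈ S ∧
      (∀ k ∈ S, ∀ w ∈ ((U \ X).erase a).erase b, G.Adj k w → w ∈ S) ∧
      5 * S.card + 1 < rho G U S ∧ 3 ≤ (bdry G U S ∩ X).card := by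
  obtain ⟨S, hS, hSc, hvS, hScl, -, hS3⟩ := h.exists_component hc hX (by omega)
  refine ⟨S, hS, hSc, hvS, hScl, ?_, hS3⟩
  -- If `S` had only one excess edge, another component would be heavy too; it misses `v` but is
  -- attached to three roots, against the frame.
  by_contra hcon
  have h1 := rho_union_le G U S ((((U \ X).erase a).erase b) \ S)
  rw [union_sdiff_of_subset hS] at h1
  have h2 := card_sdiff_add_card_eq_card hS
  obtain ⟨K, hK, hKc, hKcl, hKm⟩ := exists_conn_closed (G := G) (U := U)
    (A := (((U \ X).erase a).erase b) \ S) (by omega)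
  have hKA := hK.trans sdiff_subset
  have h3 := hc.three_le_attach hX hKA (fun k hk w hw hkw => hKcl k hk w (mem_sdiff.2 ⟨hw,
    fun hwS => (mem_sdiff.1 (hK hk)).2 (hScl w hwS k (hKA hk) hkw.symm)⟩) hkw) hKm
  have := h.attach K (fun s hs => mem_erase.2 ⟨fun e => (mem_sdiff.1 (hK hs)).2 (e ▸ hvS),
    hKA hs⟩) hKc
  omega

/-- Two vertices `a`, `b` adjacent to all roots but `r`, and a vertex `v` adjacent to `b` and `r`. -/
structure Fan (G : SimpleGraph V) (U X : Finset V) (a b v r : V) : Prop extends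
    Frame G U X a b v where
  hr : r ∈ X
  har : ¬ G.Adj a r
  hbr : ¬ G.Adj b r
  adj : ∀ y ∈ X, y ≠ r → G.Adj a y ∧ G.Adj b y
  hvb : G.Adj v b
  hvr : G.Adj v r
  attach_root : ∀ K ⊆ (((U \ X).erase a).erase b).erase v, Conn G K → v ∈ bdry G U K →
    (insert r (bdry G U K ∩ X)).card ≤ 2

/-- By `attach_root` the root `r` counts as attached to every piece, whose boundary contains `v`.
Hence `r` is one of the two roots of the piece. -/
theorem Fan.exists_normal {a b v r : V} (h : Fan G U X a b v r) {K : Finset V} {y z p q : V}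
    (hK : Piece G U X a b v K y z p q) : ∃ z, Piece G U X a b v K r z p q := by
  by_cases hy : y = r
  · subst hy; exact ⟨z, hK⟩
  by_cases hz : z = r
  · subst hz; exact ⟨y, hK.swap⟩
  exfalso
  have h1 := h.attach_root K hK.sub hK.conn hK.hv
  have h2 : ({r, y, z} : Finset V).card = 3 := by
    rw [card_insert_of_notMem (by simp [Ne.symm hy, Ne.symm hz]), card_pair hK.hyz]
  have h3 : ({r, y, z} : Finset V) ⊆ insert r (bdry G U K ∩ X) :=
    insert_subset_insert _ (pair_subset (mem_inter.2 ⟨hK.hyK, hK.hy⟩) (mem_inter.2 ⟨hK.hzK, hK.hz⟩))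
  have := card_le_card h3
  omega

theorem Fan.adj_with {a b v r : V} (h : Fan G U X a b v r) {K : Finset V} {z p q : V}
    (hK : Piece G U X a b v K r z p q) {c d : V} (hc : c = a ∨ c = b) (hd : d = p ∨ d = q) :
    ∀ w ∈ X, ∃ s ∈ ({c, d} : Finset V), G.Adj w s := by
  intro w hw
  have hr := hK.adj r (by simp)
  by_cases hwr : w = r
  · subst hwr
    refine adj_pair (Or.inr ?_)
    rcases hd with rfl | rfl
    exacts [hr.1, hr.2]
  · refine adj_pair (Or.inl ?_)
    rcases hc with rfl | rfl
    exacts [(h.adj w hw hwr).1, (h.adj w hw hwr).2]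

/-- `{a, p}` and `{b, v}` reach every root, the second elements making up for `r`, and `q` serves
the pair `r`, `z`. -/
theorem Fan.rootedMinor_of_consecutive {a b v r : V} (h : Fan G U X a b v r) (hXU : X ⊆ U)
    {x : Fin 5 → V} (hx : Function.Injective x) (hxX : ∀ i, x i ∈ X)
    {K : Finset V} {z p q : V} (hK : Piece G U X a b v K r z p q) (hz : Consecutive x r z) :
    RootedMinor G U x := by
  have hpr := Frame.mem_rest.1 (hK.sub hK.hp)
  have hqr := Frame.mem_rest.1 (hK.sub hK.hq)
  refine rootedMinor_of_universal (P := {a, p}) (Q := {b, v}) (S := {q}) hXU hx hxX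
    (pair_subset h.ha hpr.2.2.2) (pair_subset h.hb h.hv) (singleton_subset_iff.2 hqr.2.2.2)
    (conn_pair (hK.adj a (by simp)).1.symm) (conn_pair h.hvb.symm) (conn_singleton _ _) ?_ ?_ ?_
    (h.adj_with hK (Or.inl rfl) (Or.inl rfl)) (fun w hw => adj_pair ?_) hz
    (adj_singleton (hK.adj _ (by simp)).2) (adj_singleton (hK.adj _ (by simp)).2)
  · simp [h.hab.symm, h.hav.symm, Ne.symm hpr.1, Ne.symm hpr.2.1]
  · simp [hqr.2.2.1, hK.hpq.symm]
  · simp [hqr.2.1, hqr.1]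
  · by_cases hwr : w = r
    · subst hwr; exact Or.inr h.hvr
    · exact Or.inl (h.adj w hw hwr).2

/-- Three sets made of the fan, the piece and a further set. -/
theorem Fan.rootedMinor_of_set {a b v r : V} (h : Fan G U X a b v r) (hXU : X ⊆ U)
    {x : Fin 5 → V} (hx : Function.Injective x) (hxX : ∀ i, x i ∈ X)
    {K : Finset V} {z p q : V} (hK : Piece G U X a b v K r z p q) {S : Finset V}
    (hS : S ⊆ ((U \ X).erase a).erase b) (hSc : Conn G S) (hSK : Disjoint S K) {s t : V}
    (hst : Consecutive x s t) (hs : ∃ d ∈ S, G.Adj s d) (ht : ∃ d ∈ S, G.Adj t d) :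
    RootedMinor G U x := by
  have hpr := Frame.mem_rest.1 (hK.sub hK.hp)
  have hqr := Frame.mem_rest.1 (hK.sub hK.hq)
  have hsub : ∀ t ∈ S, t ≠ b ∧ t ≠ a ∧ t ∈ U \ X := fun t ht => by
    simpa only [mem_erase] using hS ht
  refine rootedMinor_of_universal (P := {a, p}) (Q := {b, q}) (S := S) hXU hx hxX
    (pair_subset h.ha hpr.2.2.2) (pair_subset h.hb hqr.2.2.2) (fun t ht => (hsub t ht).2.2)
    (conn_pair (hK.adj a (by simp)).1.symm) (conn_pair (hK.adj b (by simp)).2.symm) hSc ?_ ?_ ?_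
    (h.adj_with hK (Or.inl rfl) (Or.inl rfl)) (h.adj_with hK (Or.inr rfl) (Or.inr rfl)) hst hs ht
  · simp [h.hab.symm, hqr.2.2.1, hK.hpq.symm, Ne.symm hpr.2.1]
  · rw [disjoint_insert_left, disjoint_singleton_left]
    exact ⟨fun ha => (hsub a ha).2.1 rfl, fun hp => disjoint_left.1 hSK hp hK.hp⟩
  · rw [disjoint_insert_left, disjoint_singleton_left]
    exact ⟨fun hb => (hsub b hb).1 rfl, fun hq => disjoint_left.1 hSK hq hK.hq⟩

theorem consecutive_or_both (hX : X.card = 5) {x : Fin 5 → V} (hx : Function.Injective x)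
    (hxX : ∀ i, x i ∈ X) {r y z : V} (hr : r ∈ X) (hy : y ∈ X) (hz : z ∈ X) (hry : r ≠ y)
    (hrz : r ≠ z) (hyz : y ≠ z) :
    Consecutive x r y ∨ Consecutive x r z ∨ Consecutive x y z := by
  obtain ⟨k, rfl⟩ := exists_index hX hx hxX hr
  obtain ⟨i, rfl⟩ := exists_index hX hx hxX hy
  obtain ⟨j, rfl⟩ := exists_index hX hx hxX hz
  have key : ∀ k i j : Fin 5, k ≠ i → k ≠ j → i ≠ j →
      (i = k + 1 ∨ k = i + 1) ∨ (j = k + 1 ∨ k = j + 1) ∨ (j = i + 1 ∨ i = j + 1) := by decide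
  have hcon : ∀ {i j : Fin 5}, (j = i + 1 ∨ i = j + 1) → Consecutive x (x i) (x j) := by
    rintro i j (rfl | rfl)
    · exact ⟨i, Or.inl ⟨rfl, rfl⟩⟩
    · exact ⟨j, Or.inr ⟨rfl, rfl⟩⟩
  exact (key k i j (fun e => hry (e ▸ rfl)) (fun e => hrz (e ▸ rfl)) fun e => hyz (e ▸ rfl)).imp
    hcon (Or.imp hcon hcon)

/-- Unless `v` already serves a consecutive pair containing `r`, it has few neighbours outside its
component, and the count yields a second piece. Two pieces supply enough vertices for three
connected sets. -/
theorem Fan.rootedMinor_of_piece {a b v r : V} (h : Fan G U X a b v r) (hc : Critical G U X)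
    (hX : X.card = 5) {x : Fin 5 → V} (hx : Function.Injective x) (hxX : ∀ i, x i ∈ X)
    {K : Finset V} {z p q : V} (hK : Piece G U X a b v K r z p q) : RootedMinor G U x := by
  have hXU := hc.massed.subset
  have hpr := Frame.mem_rest.1 (hK.sub hK.hp)
  have hv' : v ∈ ((U \ X).erase a).erase b :=
    mem_erase.2 ⟨h.hbv.symm, mem_erase.2 ⟨h.hav.symm, h.hv⟩⟩
  have hvK : v ∉ K := fun hvK => (Frame.mem_rest.1 (hK.sub hvK)).1 rfl
  by_cases hvt : ∃ t, Consecutive x r t ∧ G.Adj v t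
  · obtain ⟨t, hrt, hvt⟩ := hvt
    exact h.rootedMinor_of_set hXU hx hxX hK (singleton_subset_iff.2 hv') (conn_singleton _ _)
      (disjoint_singleton_left.2 hvK) hrt (adj_singleton h.hvr) (adj_singleton hvt)
  push Not at hvt
  obtain ⟨S, hS, hSc, hvS, hScl, hSm, hS3⟩ := h.exists_component_add_two hc hX (by
    have h1 := rho_split_pair (G := G) hXU h.ha h.hb h.hab
    have h2 := hc.rho_eq
    have h3 := dg_lt_card ⟨r, h.hr, h.har⟩
    have h4 := dg_lt_card ⟨r, h.hr, h.hbr⟩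
    have h5 := card_erase_pair h.ha h.hb h.hab
    omega)
  have hSU : S ⊆ U := fun s hs => by
    have := hS hs
    simp only [mem_erase, mem_sdiff] at this
    exact this.2.2.1
  -- Outside its component `v` sees at most `a`, `b` and the three roots that are not cyclic
  -- neighbours of `r`.
  have hdg : dg G (U \ S) v ≤ 5 := by
    obtain ⟨m, rfl⟩ := exists_index hX hx hxX h.hr
    have hsub : (U \ S).filter (G.Adj v) ⊆
        {a, b} ∪ (X.erase (x (m + 1))).erase (x (m + 4)) := by
      intro w hw
      obtain ⟨hw, hvw⟩ := mem_filter.1 hw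
      obtain ⟨hwU, hwS⟩ := mem_sdiff.1 hw
      by_contra hcon
      simp only [mem_union, mem_insert, mem_singleton, mem_erase, not_or, not_and] at hcon
      obtain ⟨⟨hwa, hwb⟩, hcon⟩ := hcon
      have hwX : w ∈ X := by
        by_contra hwX
        exact hwS (hScl v hvS w (mem_erase.2 ⟨hwb, mem_erase.2 ⟨hwa, mem_sdiff.2 ⟨hwU, hwX⟩⟩⟩) hvw)
      by_cases h4 : w = x (m + 4)
      · subst h4
        refine hvt _ ⟨m + 4, Or.inr ⟨rfl, ?_⟩⟩ hvw
        rw [add_assoc]; exact congrArg x (add_zero m)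
      · by_cases h1 : w = x (m + 1)
        · subst h1
          exact hvt _ ⟨m, Or.inl ⟨rfl, rfl⟩⟩ hvw
        · exact hcon h4 h1 hwX
    have h1 := (card_le_card hsub).trans (card_union_le _ _)
    have h2 : ({a, b} : Finset V).card ≤ 2 := card_le_two
    have h3 := card_erase_pair (hxX (m + 1)) (hxX (m + 4)) (fun e => by
      have := add_left_cancel (hx e)
      exact absurd this (by decide))
    change ((U \ S).filter (G.Adj v)).card ≤ 5
    omega
  have hKA : K ⊆ ((U \ X).erase a).erase b := hK.sub.trans (erase_subset _ _)
  have hKS : K ⊆ S := by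
    refine (hK.conn.subset_or_disjoint fun c _ hcS d hd hcd => hScl c hcS d (hKA hd) hcd).resolve_right
      fun hd => disjoint_left.1 hd hK.hp ?_
    exact hScl v hvS p (hKA hK.hp) (hK.adj v (by simp)).1.symm
  have hKSv : K ⊆ S.erase v := fun k hk => mem_erase.2 ⟨fun e => hvK (e ▸ hk), hKS hk⟩
  have hA : S.erase v \ K ⊆ (((U \ X).erase a).erase b).erase v :=
    sdiff_subset.trans (erase_subset_erase _ hS)
  -- From at least `5|S| + 2` edges at `S`, at most five go with `v` and `5|K| + 1` with `K`, which
  -- leaves one more than five per remaining vertex.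
  obtain ⟨K₂, hK₂, y, z₂, p₂, q₂, hP⟩ := h.exists_piece hc hX hA (fun k hk w hw hkw => by
      refine mem_sdiff.2 ⟨mem_erase.2 ⟨(Frame.mem_rest.1 hw).1, hScl k ?_ w (mem_of_mem_erase hw) hkw⟩,
        fun hwK => (mem_sdiff.1 hk).2 (hK.closed w hwK k (hA hk) hkw.symm)⟩
      exact mem_of_mem_erase (mem_sdiff.1 hk).1) (by
    have h1 := rho_erase (G := G) hSU hvS
    have h2 := rho_union_le G U K (S.erase v \ K)
    rw [union_sdiff_of_subset hKSv] at h2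
    have h3 := card_sdiff_add_card_eq_card hKSv
    have h4 := card_erase_add_one hvS
    have h5 := hK.rho_eq
    omega)
  have hdis : Disjoint K₂ K := disjoint_left.2 fun k hk => (mem_sdiff.1 (hK₂ hk)).2
  clear hK₂
  obtain ⟨z₂, hP⟩ := h.exists_normal hP
  have hK₂A : K₂ ⊆ ((U \ X).erase a).erase b := hP.sub.trans (erase_subset _ _)
  by_cases hc1 : Consecutive x r z
  · exact h.rootedMinor_of_consecutive hXU hx hxX hK hc1
  by_cases hc2 : Consecutive x r z₂
  · exact h.rootedMinor_of_consecutive hXU hx hxX hP hc2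
  have hpr₂ := Frame.mem_rest.1 (hP.sub hP.hp)
  have hqr₂ := Frame.mem_rest.1 (hP.sub hP.hq)
  have hqr := Frame.mem_rest.1 (hK.sub hK.hq)
  -- If both pieces have the same roots, the first makes `{a, p}` and `{b, q}` universal. The vertex
  -- `p₂` and an arm through `v` to a third root `w` form a set reaching `r`, `z`, `w`.
  by_cases hzz : z = z₂
  · subst hzz
    obtain ⟨w, hwX, hwy, hwz, s, hs, hsw⟩ := exists_third hS3 r z
    obtain ⟨D, hD, hDc, hvD, ⟨d, hd, hwd⟩, hDK⟩ := h.exists_arm hXU hS hSc hvS hs hwX hsw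
    have hDK := hDK K r z p q hK hwy hwz
    obtain ⟨t, ht, t', ht', htt⟩ := exists_consecutive_roots (Y := {r, z, w}) hX hx hxX
      (insert_subset hK.hy (pair_subset hK.hz hwX)) (by
        rw [card_insert_of_notMem (by simp [hK.hyz, Ne.symm hwy]), card_pair (Ne.symm hwz)])
    have hadj : ∀ t ∈ ({r, z, w} : Finset V), ∃ s ∈ insert p₂ D, G.Adj t s := by
      intro t ht
      simp only [mem_insert, mem_singleton] at ht
      rcases ht with rfl | rfl | rfl
      · exact ⟨p₂, mem_insert_self _ _, (hP.adj _ (by simp)).1.symm⟩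
      · exact ⟨p₂, mem_insert_self _ _, (hP.adj _ (by simp)).1.symm⟩
      · exact ⟨d, mem_insert_of_mem hd, hwd⟩
    refine h.rootedMinor_of_set hXU hx hxX hK (insert_subset (hK₂A hP.hp) hD)
      (hDc.insert_vertex ⟨v, hvD, (hP.adj v (by simp)).1⟩) ?_ htt (hadj t ht) (hadj t' ht')
    exact disjoint_insert_left.2 ⟨fun hp => disjoint_left.1 hdis hP.hp hp, hDK⟩
  -- Two different roots not next to `r` in the 5-cycle are next to each other, and `{q, v, q₂}`
  -- joins them.
  · have hcz : Consecutive x z z₂ :=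
      ((consecutive_or_both hX hx hxX h.hr hK.hz hP.hz hK.hyz hP.hyz hzz).resolve_left
        hc1).resolve_left hc2
    have hne : ∀ {c d : V}, c ∈ K → d ∈ K₂ → c ≠ d := fun hc hd e =>
      disjoint_left.1 hdis hd (e ▸ hc)
    refine rootedMinor_of_universal (P := {a, p}) (Q := {b, p₂}) (S := {q, v, q₂}) hXU hx hxX
      (pair_subset h.ha hpr.2.2.2) (pair_subset h.hb hpr₂.2.2.2)
      (insert_subset hqr.2.2.2 (pair_subset h.hv hqr₂.2.2.2))
      (conn_pair (hK.adj a (by simp)).1.symm) (conn_pair (hP.adj b (by simp)).1.symm)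
      ((conn_pair (hP.adj v (by simp)).2.symm).insert_vertex
        ⟨v, mem_insert_self _ _, (hK.adj v (by simp)).2⟩) ?_ ?_ ?_
      (h.adj_with hK (Or.inl rfl) (Or.inl rfl)) (h.adj_with hP (Or.inr rfl) (Or.inl rfl)) hcz
      ⟨q, by simp, (hK.adj z (by simp)).2.symm⟩ ⟨q₂, by simp, (hP.adj z₂ (by simp)).2.symm⟩
    · simp [h.hab.symm, hpr₂.2.2.1, (hne hK.hp hP.hp).symm, Ne.symm hpr.2.1]
    · simp [hqr.2.2.1, h.hav.symm, hqr₂.2.2.1, hK.hpq.symm, Ne.symm hpr.1, (hne hK.hp hP.hq).symm]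
    · simp [hqr.2.1, h.hbv.symm, hqr₂.2.1, hne hK.hq hP.hp, Ne.symm hpr₂.1, hP.hpq.symm]

/-- Either there is a piece, or the count forces `v` to be adjacent to all five roots, since `a` and
`b` both miss `r`. -/
theorem Fan.not_critical {a b v r : V} (h : Fan G U X a b v r) (hc : Critical G U X)
    (hX : X.card = 5) : False := by
  have hXU := hc.massed.subset
  refine hc.not_linked (linked_of_rootedMinor hX fun x hx hxX => ?_)
  by_cases hm : rho G U ((((U \ X).erase a).erase b).erase v) ≤
      5 * ((((U \ X).erase a).erase b).erase v).card
  · have h1 := rho_split_triple (G := G) hXU h.ha h.hb h.hv h.hab h.hav h.hbv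
    have h2 := hc.rho_eq
    have h3 := h.card_rest
    have h4 := dg_lt_card ⟨r, h.hr, h.har⟩
    have h5 := dg_lt_card ⟨r, h.hr, h.hbr⟩
    have h6 := dg_le_card G X v
    have hvX := dg_eq_card_iff.1 (show dg G X v = X.card by omega)
    obtain ⟨m, rfl⟩ := exists_index hX hx hxX h.hr
    have hn : ∀ {y : V}, y ∈ U \ X → ∀ i, x i ∉ ({y} : Finset V) := fun hy i h =>
      (mem_sdiff.1 hy).2 (mem_singleton.1 h ▸ hxX i)
    have hs : ∀ {y : V}, y ∈ U \ X → ({y} : Finset V) ⊆ U := fun hy =>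
      singleton_subset_iff.2 (mem_sdiff.1 hy).1
    have hne : ∀ i : Fin 5, i ≠ m → G.Adj a (x i) ∧ G.Adj b (x i) := fun i hi =>
      h.adj _ (hxX i) fun e => hi (hx e)
    -- The rotation by `m + 3` puts `r` in the middle of the stretch served by `v`, so that `a` and
    -- `b` never have to reach it.
    refine rootedMinor_of_three (P := {v}) (Q := {a}) (S := {b}) hx (fun i => hXU (hxX i))
      (hs h.hv) (hs h.ha) (hs h.hb) (conn_singleton _ _) (conn_singleton _ _)
      (conn_singleton _ _) (disjoint_singleton.2 h.hav.symm) (disjoint_singleton.2 h.hbv.symm)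
      (disjoint_singleton.2 h.hab) (hn h.hv) (hn h.ha) (hn h.hb) (m + 3)
      (adj_singleton (hne _ ?_).2) (adj_singleton (hne _ ?_).2)
      (adj_singleton (hvX _ (hxX _))) (adj_singleton (hvX _ (hxX _)))
      (adj_singleton (hvX _ (hxX _))) (adj_singleton (hne _ ?_).1) (adj_singleton (hne _ ?_).1)
      (adj_singleton (hne _ ?_).1) <;> clear h hne <;> revert m <;> decide
  · obtain ⟨K, -, y, z, p, q, hK⟩ := h.exists_piece hc hX Subset.rfl
      (fun _ _ w hw _ => hw) (not_le.1 hm)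
    obtain ⟨z, hK⟩ := h.exists_normal hK
    exact h.rootedMinor_of_piece hc hX hx hxX hK

/-- Otherwise the contraction is exceptional, with common neighbours `a` and `b`. If `u` is a root,
each of them not adjacent to `u` is adjacent to `v`: none such makes `G` exceptional, one gives a
vertex universal to the roots and an adjacent pair covering them, two give a fan with `r = u`. If
`u` is no root, either `u` is one of `a`, `b` and covers the roots together with `v`, or `G` is
exceptional. -/
theorem Critical.codeg_ge (hc : Critical G U X) {u v : V} (hu : u ∈ U) (hv : v ∈ U \ X)
    (huv : G.Adj u v) : 5 ≤ codeg G U X u v := by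
  by_contra hlt
  obtain ⟨⟨hX, a, ha, b, hb, hab, haX, hbX⟩, hnl⟩ := hc.contract hu hv huv (by omega)
  have hvX := (mem_sdiff.1 hv).2
  have hXv : X ⊆ U.erase v := fun y hy =>
    mem_erase.2 ⟨fun e => hvX (e ▸ hy), hc.massed.subset hy⟩
  have hattach : ∀ K ⊆ (((U \ X).erase a).erase b).erase v, Conn G K →
      (bdry (CycleMinor.contract G u v) (U.erase v) K ∩ X).card ≤ 2 := by
    intro K hK hKc
    by_contra hcon
    refine hnl (linked_of_rootedMinor hX fun x hx hxX => ?_)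
    refine rootedMinor_of_exceptional hXv hX ha hb hab haX hbX (fun k hk => ?_)
      (fun hk => (Frame.mem_rest.1 (hK hk)).2.2.1 rfl) (fun hk => (Frame.mem_rest.1 (hK hk)).2.1 rfl)
      (hKc.mono (le_contract G u v)) (by omega) hx hxX
    have := Frame.mem_rest.1 (hK hk)
    exact mem_sdiff.2 ⟨mem_erase.2 ⟨this.1, (mem_sdiff.1 this.2.2.2).1⟩,
      (mem_sdiff.1 this.2.2.2).2⟩
  have hbd : ∀ K, bdry G U K ∩ X ⊆ bdry (CycleMinor.contract G u v) (U.erase v) K ∩ X := by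
    intro K y hy
    obtain ⟨hyK, hyX⟩ := mem_inter.1 hy
    obtain ⟨-, hyK, k, hk, hky⟩ := mem_bdry.1 hyK
    exact mem_inter.2 ⟨mem_bdry.2 ⟨hXv hyX, hyK, k, hk, Or.inl hky⟩, hyX⟩
  have hmem : ∀ {c}, c ∈ U.erase v \ X → c ∈ U \ X ∧ c ≠ v := fun hc => by
    simp only [mem_sdiff, mem_erase] at hc ⊢
    tauto
  have hF : Frame G U X a b v :=
    ⟨(hmem ha).1, (hmem hb).1, hv, hab, (hmem ha).2, (hmem hb).2, fun K hK hKc =>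
      (card_le_card (hbd K)).trans (hattach K hK hKc)⟩
  have hF' : Frame G U X b a v :=
    ⟨hF.hb, hF.ha, hv, hab.symm, hF.hbv, hF.hav, fun K hK => hF.attach K (by
      rwa [erase_right_comm (a := a)])⟩
  by_cases huX : u ∈ X
  · have hadj : ∀ {c}, c ∈ U \ X → (∀ y ∈ X, (CycleMinor.contract G u v).Adj c y) →
        (∀ y ∈ X, y ≠ u → G.Adj c y) ∧ (G.Adj c u ∨ G.Adj v c) := by
      intro c hc hcX
      have hcu : c ≠ u := fun e => (mem_sdiff.1 hc).2 (e ▸ huX)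
      refine ⟨fun y hy hyu => ?_, ?_⟩
      · rcases hcX y hy with h | h | h
        exacts [h, absurd h.1 hcu, absurd h.1 hyu]
      · rcases hcX u huX with h | h | h
        exacts [Or.inl h, absurd h.1 hcu, Or.inr h.2.2]
    obtain ⟨haX, hau⟩ := hadj hF.ha haX
    obtain ⟨hbX, hbu⟩ := hadj hF.hb hbX
    have huniv : ∀ {c}, (∀ y ∈ X, y ≠ u → G.Adj c y) → G.Adj c u → ∀ y ∈ X, G.Adj c y :=
      fun h1 h2 y hy => if hyu : y = u then hyu ▸ h2 else h1 y hy hyu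
    have hcov : ∀ {c}, (∀ y ∈ X, y ≠ u → G.Adj c y) → ∀ y ∈ X, G.Adj c y ∨ G.Adj v y :=
      fun h1 y hy => if hyu : y = u then Or.inr (hyu ▸ huv.symm) else Or.inl (h1 y hy hyu)
    by_cases hau' : G.Adj a u
    · by_cases hbu' : G.Adj b u
      · exact hc.not_exceptional ⟨hX, a, hF.ha, b, hF.hb, hab, huniv haX hau', huniv hbX hbu'⟩
      · exact hF'.false_of_cover hc hX (huniv haX hau') (hbu.resolve_left hbu').symm (hcov hbX)
    · by_cases hbu' : G.Adj b u
      · exact hF.false_of_cover hc hX (huniv hbX hbu') (hau.resolve_left hau').symm (hcov haX)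
      · refine Fan.not_critical (a := a) (b := b) (v := v) (r := u) ⟨hF, huX, hau', hbu',
          fun y hy hyu => ⟨haX y hy hyu, hbX y hy hyu⟩,
          hbu.resolve_left hbu', huv.symm, fun K hK hKc hvK => ?_⟩ hc hX
        -- A part touching `v` touches the root `u` after the contraction.
        refine (card_le_card (insert_subset ?_ (hbd K))).trans (hattach K hK hKc)
        obtain ⟨-, -, k, hk, hkv⟩ := mem_bdry.1 hvK
        have huK : u ∉ K := fun huK =>
          (mem_sdiff.1 (Frame.mem_rest.1 (hK huK)).2.2.2).2 huX
        exact mem_inter.2 ⟨mem_bdry.2 ⟨hXv huX, huK, k, hk,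
          Or.inr (Or.inr ⟨rfl, fun e => huK (e ▸ hk), hkv.symm⟩)⟩, huX⟩
  · have hadj : ∀ {c}, (∀ y ∈ X, (CycleMinor.contract G u v).Adj c y) →
        ∀ y ∈ X, G.Adj c y ∨ c = u ∧ G.Adj v y := by
      intro c hcX y hy
      rcases hcX y hy with h | h | h
      exacts [Or.inl h, Or.inr ⟨h.1, h.2.2⟩, absurd (h.1 ▸ hy) huX]
    by_cases hau : a = u
    · subst hau
      exact hF.false_of_cover hc hX (fun y hy => (hadj hbX y hy).resolve_right fun h => hab h.1.symm)
        huv fun y hy => (hadj haX y hy).imp id And.right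
    by_cases hbu : b = u
    · subst hbu
      exact hF'.false_of_cover hc hX (fun y hy => (hadj haX y hy).resolve_right fun h => hab h.1)
        huv fun y hy => (hadj hbX y hy).imp id And.right
    exact hc.not_exceptional ⟨hX, a, hF.ha, b, hF.hb, hab,
      fun y hy => (hadj haX y hy).resolve_right fun h => hau h.1,
      fun y hy => (hadj hbX y hy).resolve_right fun h => hbu h.1⟩

/-! ### Rooted minors in a dense neighbourhood -/

/-- `C` is empty and `y`, `z` are adjacent, or `C` is connected and attached to both. -/
def Joins (G : SimpleGraph V) (y z : V) (C : Finset V) : Prop :=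
  (C = ∅ ∧ G.Adj y z) ∨ (Conn G C ∧ (∃ c ∈ C, G.Adj y c) ∧ ∃ c ∈ C, G.Adj z c)

theorem Joins.conn_insert {y z : V} {C : Finset V} (h : Joins G y z C) : Conn G (insert y C) := by
  rcases h with ⟨rfl, -⟩ | ⟨h, h1, -⟩
  · simpa using conn_singleton G y
  · exact h.insert_vertex h1

theorem Joins.touch {y z : V} {C A : Finset V} (h : Joins G y z C) :
    Touch G (insert y C) (insert z A) := by
  rcases h with ⟨rfl, h⟩ | ⟨-, -, c, hc, hzc⟩
  · exact ⟨y, mem_insert_self _ _, z, mem_insert_self _ _, h⟩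
  · exact ⟨c, mem_insert_of_mem hc, z, mem_insert_self _ _, hzc.symm⟩

/-- Adding `v` to the branch set of `x 0` provides both cycle edges there, so only three consecutive
pairs are left to be joined. -/
theorem rootedMinor_of_joins_zero {x : Fin 5 → V} (hx : Function.Injective x)
    (hxU : ∀ i, x i ∈ U) {v : V} (hv : v ∈ U) (hvx : ∀ i, G.Adj v (x i)) {O : Finset V}
    (hO : O ⊆ U) (hvO : v ∉ O) (hxO : ∀ i, x i ∉ O) {C₁ C₂ C₃ : Finset V} (h₁O : C₁ ⊆ O)
    (h₂O : C₂ ⊆ O) (h₃O : C₃ ⊆ O) (h₁₂ : Disjoint C₁ C₂) (h₁₃ : Disjoint C₁ C₃)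
    (h₂₃ : Disjoint C₂ C₃) (h₁ : Joins G (x 1) (x 2) C₁) (h₂ : Joins G (x 2) (x 3) C₂)
    (h₃ : Joins G (x 3) (x 4) C₃) : RootedMinor G U x := by
  have hvC : ∀ {C : Finset V}, C ⊆ O → Disjoint {v} C := fun h =>
    disjoint_singleton_left.2 fun hv => hvO (h hv)
  have hxv : ∀ i, x i ∉ ({v} : Finset V) := fun i h =>
    (hvx i).ne (mem_singleton.1 h).symm
  refine rootedMinor_of_attach hx hxU ![{v}, C₁, C₂, C₃, ∅] ?_ ?_ ?_ ?_ ?_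
  · intro i
    fin_cases i
    exacts [singleton_subset_iff.2 hv, h₁O.trans hO, h₂O.trans hO, h₃O.trans hO, empty_subset _]
  · intro i j
    fin_cases j
    exacts [hxv i, fun h => hxO i (h₁O h), fun h => hxO i (h₂O h), fun h => hxO i (h₃O h),
      notMem_empty _]
  · intro i j hij
    fin_cases i <;> fin_cases j <;> first
      | exact absurd hij (by decide)
      | exact disjoint_empty_right _
      | exact h₁₂
      | exact h₁₃
      | exact h₂₃
      | exact hvC h₁O
      | exact hvC h₂O
      | exact hvC h₃O
  · intro i
    fin_cases i
    exacts [conn_pair (hvx 0).symm, h₁.conn_insert, h₂.conn_insert, h₃.conn_insert,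
      by simpa using conn_singleton G (x 4)]
  · intro i
    fin_cases i
    exacts [⟨v, by simp, x 1, mem_insert_self _ _, hvx 1⟩, h₁.touch, h₂.touch, h₃.touch,
      ⟨x 4, mem_insert_self _ _, v, by simp, (hvx 4).symm⟩]

/-- A vertex adjacent to all roots serves the root `x k`, and disjoint sets join the other
consecutive pairs. -/
theorem rootedMinor_of_joins {x : Fin 5 → V} (hx : Function.Injective x)
    (hxU : ∀ i, x i ∈ U) {v : V} (hv : v ∈ U) (hvx : ∀ i, G.Adj v (x i)) {O : Finset V}
    (hO : O ⊆ U) (hvO : v ∉ O) (hxO : ∀ i, x i ∉ O) (k : Fin 5) {C₁ C₂ C₃ : Finset V}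
    (h₁O : C₁ ⊆ O) (h₂O : C₂ ⊆ O) (h₃O : C₃ ⊆ O) (h₁₂ : Disjoint C₁ C₂) (h₁₃ : Disjoint C₁ C₃)
    (h₂₃ : Disjoint C₂ C₃) (h₁ : Joins G (x (k + 1)) (x (k + 2)) C₁)
    (h₂ : Joins G (x (k + 2)) (x (k + 3)) C₂) (h₃ : Joins G (x (k + 3)) (x (k + 4)) C₃) :
    RootedMinor G U x := by
  refine RootedMinor.of_rotate k (rootedMinor_of_joins_zero (C₁ := C₁) (C₂ := C₂) (C₃ := C₃)
    (fun i j h => add_right_cancel (hx h)) (fun i => hxU _) hv (fun i => hvx _) hO hvO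
    (fun i => hxO _) h₁O h₂O h₃O h₁₂ h₁₃ h₂₃ ?_ ?_ ?_)
  · rwa [add_comm 1 k, add_comm 2 k]
  · rwa [add_comm 2 k, add_comm 3 k]
  · rwa [add_comm 3 k, add_comm 4 k]

theorem exists_distinct_two {A B : Finset V} (hA : 1 ≤ A.card) (hB : 2 ≤ B.card) :
    ∃ a ∈ A, ∃ b ∈ B, a ≠ b := by
  obtain ⟨a, ha⟩ := card_pos.1 hA
  obtain ⟨b, hb, hba⟩ := exists_mem_ne (by omega : 1 < B.card) a
  exact ⟨a, ha, b, hb, hba.symm⟩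

theorem exists_distinct_three {A B C : Finset V} (hA : 1 ≤ A.card) (hB : 2 ≤ B.card)
    (hC : 3 ≤ C.card) : ∃ a ∈ A, ∃ b ∈ B, ∃ c ∈ C, a ≠ b ∧ a ≠ c ∧ b ≠ c := by
  obtain ⟨a, ha, b, hb, hab⟩ := exists_distinct_two hA hB
  obtain ⟨c, hc, hcn⟩ := exists_mem_notMem_of_card_lt_card (show ({a, b} : Finset V).card < C.card by
    have : ({a, b} : Finset V).card ≤ 2 := card_le_two
    omega)
  simp only [mem_insert, mem_singleton, not_or] at hcn
  exact ⟨a, ha, b, hb, c, hc, hab, Ne.symm hcn.1, Ne.symm hcn.2⟩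

/-- A dense neighbourhood: every vertex of `D` misses at most `e` others, not counting the pairs
inside `W`. -/
structure Dense (G : SimpleGraph V) (D W : Finset V) (e : ℕ) : Prop where
  card : D.card = e + 6
  card_le : W.card + e ≤ 4
  miss : ∀ u ∈ D, ∀ T ⊆ D, (∀ t ∈ T, t ≠ u ∧ ¬ G.Adj u t ∧ ¬ (u ∈ W ∧ t ∈ W)) → T.card ≤ e

/-- The neighbours of `u` among the vertices of `D` that are no roots. -/
noncomputable def spare (G : SimpleGraph V) (D : Finset V) (x : Fin 5 → V) (u : V) : Finset V :=
  (D \ univ.image x).filter (G.Adj u)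

/-- The consecutive roots `x i` and `x (i + 1)` are not adjacent, and not both in `W`. -/
def Gap (G : SimpleGraph V) (W : Finset V) (x : Fin 5 → V) (i : Fin 5) : Prop :=
  ¬ G.Adj (x i) (x (i + 1)) ∧ ¬ (x i ∈ W ∧ x (i + 1) ∈ W)

variable {D W : Finset V} {e : ℕ} {x : Fin 5 → V}

theorem Dense.card_rest (h : Dense G D W e) (hx : Function.Injective x) (hxD : ∀ i, x i ∈ D) :
    (D \ univ.image x).card = e + 1 := by
  have h1 : (univ.image x).card = 5 := by
    rw [card_image_of_injective _ hx, card_univ, Fintype.card_fin]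
  have h2 : univ.image x ⊆ D := by
    intro y hy
    obtain ⟨i, -, rfl⟩ := mem_image.1 hy
    exact hxD i
  have h3 := card_sdiff_add_card_eq_card h2
  have h4 := h.card
  omega

/-- There are `e + 1` non-roots in `D`. Each missed root in `J` uses up one of the `e` permitted
misses of `x i`. -/
theorem Dense.card_spare (h : Dense G D W e) (hx : Function.Injective x) (hxD : ∀ i, x i ∈ D)
    (hW : W ⊆ univ.image x) (i : Fin 5) {J : Finset (Fin 5)}
    (hJ : ∀ j ∈ J, j ≠ i ∧ ¬ G.Adj (x i) (x j) ∧ ¬ (x i ∈ W ∧ x j ∈ W)) :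
    1 + J.card ≤ (spare G D x (x i)).card := by
  have h1 := card_filter_add_card_filter_not (s := D \ univ.image x) (G.Adj (x i))
  rw [h.card_rest hx hxD] at h1
  have h2 := h.miss (x i) (hxD i) (J.image x ∪ (D \ univ.image x).filter fun y => ¬ G.Adj (x i) y)
    (union_subset (fun y hy => by
      obtain ⟨j, -, rfl⟩ := mem_image.1 hy
      exact hxD j) ((filter_subset _ _).trans sdiff_subset)) (fun t ht => by
    rcases mem_union.1 ht with ht | ht
    · obtain ⟨j, hj, rfl⟩ := mem_image.1 ht
      exact ⟨fun e => (hJ j hj).1 (hx e), (hJ j hj).2⟩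
    · obtain ⟨ht, hit⟩ := mem_filter.1 ht
      exact ⟨fun e => (mem_sdiff.1 ht).2 (e ▸ mem_image_of_mem x (mem_univ i)), hit,
        fun hw => (mem_sdiff.1 ht).2 (hW hw.2)⟩)
  rw [card_union_of_disjoint, card_image_of_injective _ hx] at h2
  · change (spare G D x (x i)).card + _ = _ at h1
    omega
  · rw [disjoint_left]
    intro t ht ht'
    obtain ⟨j, -, rfl⟩ := mem_image.1 ht
    exact (mem_sdiff.1 (mem_filter.1 ht').1).2 (mem_image_of_mem x (mem_univ j))

theorem Dense.one_le_spare (h : Dense G D W e) (hx : Function.Injective x) (hxD : ∀ i, x i ∈ D)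
    (hW : W ⊆ univ.image x) (i : Fin 5) : 1 ≤ (spare G D x (x i)).card := by
  simpa using h.card_spare hx hxD hW i (J := ∅) (by simp)

theorem Dense.two_le_spare (h : Dense G D W e) (hx : Function.Injective x) (hxD : ∀ i, x i ∈ D)
    (hW : W ⊆ univ.image x) {i : Fin 5} (hi : Gap G W x i) :
    2 ≤ (spare G D x (x i)).card := by
  simpa using h.card_spare hx hxD hW i (J := {i + 1}) (by simpa [Gap] using hi)

theorem Dense.two_le_spare_succ (h : Dense G D W e) (hx : Function.Injective x)
    (hxD : ∀ i, x i ∈ D) (hW : W ⊆ univ.image x) {i : Fin 5} (hi : Gap G W x i) :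
    2 ≤ (spare G D x (x (i + 1))).card := by
  simpa using h.card_spare hx hxD hW (i + 1) (J := {i}) (by
    rw [Gap, G.adj_comm, and_comm (a := x i ∈ W)] at hi
    simpa using hi)

theorem Dense.three_le_spare (h : Dense G D W e) (hx : Function.Injective x)
    (hxD : ∀ i, x i ∈ D) (hW : W ⊆ univ.image x) {i : Fin 5} (hi : Gap G W x i)
    (hi' : Gap G W x (i + 1)) : 3 ≤ (spare G D x (x (i + 1))).card := by
  have h2 : ({i, i + 1 + 1} : Finset (Fin 5)).card = 2 := card_pair (by clear hi hi'; revert i; decide)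
  have := h.card_spare hx hxD hW (i + 1) (J := {i, i + 1 + 1}) (by
    rw [Gap, G.adj_comm, and_comm (a := x i ∈ W)] at hi
    intro j hj
    rcases mem_insert.1 hj with rfl | hj
    · exact ⟨by simp, hi⟩
    · rw [mem_singleton.1 hj]
      exact ⟨by simp, hi'⟩)
  omega

variable {v : V}

theorem spare_subset {u : V} : spare G D x u ⊆ D \ univ.image x := filter_subset _ _

theorem adj_of_mem_spare {u o : V} (h : o ∈ spare G D x u) : G.Adj u o := (mem_filter.1 h).2

/-- Here `v` serves `x (j + 1)` and so settles the pairs `j` and `j + 1`. Indices are iterated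
successors so that consecutive gaps match without arithmetic. -/
theorem Dense.rootedMinor_of_joins (hv : ∀ u ∈ D, G.Adj v u)
    (hx : Function.Injective x) (hxD : ∀ i, x i ∈ D) (j : Fin 5) {C₁ C₂ C₃ : Finset V}
    (h₁O : C₁ ⊆ D \ univ.image x) (h₂O : C₂ ⊆ D \ univ.image x) (h₃O : C₃ ⊆ D \ univ.image x)
    (h₁₂ : Disjoint C₁ C₂) (h₁₃ : Disjoint C₁ C₃) (h₂₃ : Disjoint C₂ C₃)
    (h₁ : Joins G (x (j + 1 + 1)) (x (j + 1 + 1 + 1)) C₁)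
    (h₂ : Joins G (x (j + 1 + 1 + 1)) (x (j + 1 + 1 + 1 + 1)) C₂)
    (h₃ : Joins G (x (j + 1 + 1 + 1 + 1)) (x (j + 1 + 1 + 1 + 1 + 1)) C₃) :
    RootedMinor G (insert v D) x := by
  have hvD : v ∉ D := fun h => (hv v h).ne rfl
  have e3 : j + 1 + 2 = j + 1 + 1 + 1 := by clear * -; revert j; decide
  have e4 : j + 1 + 3 = j + 1 + 1 + 1 + 1 := by clear * -; revert j; decide
  have e5 : j + 1 + 4 = j + 1 + 1 + 1 + 1 + 1 := by clear * -; revert j; decide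
  refine CycleMinor.rootedMinor_of_joins hx (fun i => mem_insert_of_mem (hxD i))
    (mem_insert_self v D) (fun i => hv _ (hxD i)) (O := D \ univ.image x)
    (sdiff_subset.trans (subset_insert _ _)) (fun h => hvD (mem_sdiff.1 h).1)
    (fun i h => (mem_sdiff.1 h).2 (mem_image_of_mem x (mem_univ i))) (j + 1) h₁O h₂O h₃O h₁₂ h₁₃ h₂₃
    ?_ ?_ ?_
  · rwa [e3]
  · rwa [e3, e4]
  · rwa [e4, e5]

theorem joins_of_not_gap {i : Fin 5} (h : ¬ Gap G W x i) (hW : ¬ (x i ∈ W ∧ x (i + 1) ∈ W)) :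
    Joins G (x i) (x (i + 1)) ∅ :=
  Or.inl ⟨rfl, by_contra fun h' => h ⟨h', hW⟩⟩

theorem joins_of_mem_spare {y z o : V} (h1 : o ∈ spare G D x y) (h2 : o ∈ spare G D x z) :
    Joins G y z {o} :=
  Or.inr ⟨conn_singleton _ _, ⟨o, mem_singleton_self o, adj_of_mem_spare h1⟩,
    o, mem_singleton_self o, adj_of_mem_spare h2⟩

/-- The vertices that can serve the pair `x i`, `x (i + 1)`. -/
noncomputable def pool (G : SimpleGraph V) (D W : Finset V) (x : Fin 5 → V) (i : Fin 5) :
    Finset V :=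
  if Gap G W x i then spare G D x (x i) ∩ spare G D x (x (i + 1)) else D \ univ.image x

theorem pool_subset {i : Fin 5} : pool G D W x i ⊆ D \ univ.image x := by
  rw [pool]
  split_ifs
  · exact inter_subset_left.trans spare_subset
  · exact Subset.rfl

theorem pool_of_gap {i : Fin 5} (h : Gap G W x i) :
    pool G D W x i = spare G D x (x i) ∩ spare G D x (x (i + 1)) := if_pos h

theorem joins_of_mem_pool {i : Fin 5} (hW : ¬ (x i ∈ W ∧ x (i + 1) ∈ W)) {o : V}
    (ho : o ∈ pool G D W x i) :
    ∃ C ⊆ {o}, Joins G (x i) (x (i + 1)) C := by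
  by_cases h : Gap G W x i
  · rw [pool_of_gap h] at ho
    exact ⟨{o}, Subset.rfl, joins_of_mem_spare (mem_inter.1 ho).1 (mem_inter.1 ho).2⟩
  · exact ⟨∅, empty_subset _, joins_of_not_gap h hW⟩

theorem Dense.rootedMinor_of_distinct (hv : ∀ u ∈ D, G.Adj v u)
    (hx : Function.Injective x) (hxD : ∀ i, x i ∈ D) {j : Fin 5}
    (hWj : ∀ i, x i ∈ W → x (i + 1) ∈ W → i = j ∨ i = j + 1)
    (hd : ∃ a ∈ pool G D W x (j + 1 + 1), ∃ b ∈ pool G D W x (j + 1 + 1 + 1),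
      ∃ c ∈ pool G D W x (j + 1 + 1 + 1 + 1), a ≠ b ∧ a ≠ c ∧ b ≠ c) :
    RootedMinor G (insert v D) x := by
  obtain ⟨a, ha, b, hb, c, hc, hab, hac, hbc⟩ := hd
  have hW : ∀ i, i ≠ j → i ≠ j + 1 → ¬ (x i ∈ W ∧ x (i + 1) ∈ W) := fun i h1 h2 h =>
    (hWj i h.1 h.2).elim h1 h2
  obtain ⟨A, hA, h₁⟩ := joins_of_mem_pool (hW _ (by clear * -; revert j; decide)
    (by clear * -; revert j; decide)) ha
  obtain ⟨B, hB, h₂⟩ := joins_of_mem_pool (hW _ (by clear * -; revert j; decide)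
    (by clear * -; revert j; decide)) hb
  obtain ⟨C, hC, h₃⟩ := joins_of_mem_pool (hW _ (by clear * -; revert j; decide)
    (by clear * -; revert j; decide)) hc
  have hO : ∀ {i o}, o ∈ pool G D W x i → ({o} : Finset V) ⊆ D \ univ.image x := fun h =>
    singleton_subset_iff.2 (pool_subset h)
  exact Dense.rootedMinor_of_joins hv hx hxD j (hA.trans (hO ha)) (hB.trans (hO hb))
    (hC.trans (hO hc)) (disjoint_of_subset_left hA (disjoint_of_subset_right hB
      (disjoint_singleton.2 hab))) (disjoint_of_subset_left hA (disjoint_of_subset_right hC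
      (disjoint_singleton.2 hac))) (disjoint_of_subset_left hB (disjoint_of_subset_right hC
      (disjoint_singleton.2 hbc))) h₁ h₂ h₃

/-- Two sets of spare neighbours among `e + 1` non-roots overlap by inclusion–exclusion. -/
theorem Dense.card_pool (h : Dense G D W e) (hx : Function.Injective x) (hxD : ∀ i, x i ∈ D)
    {i : Fin 5} {m n : ℕ} (hm : m ≤ (spare G D x (x i)).card)
    (hn : n ≤ (spare G D x (x (i + 1))).card) : m + n ≤ (pool G D W x i).card + (e + 1) := by
  have h0 := h.card_rest hx hxD
  rw [pool]
  split_ifs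
  · have h1 := card_union_add_card_inter (spare G D x (x i)) (spare G D x (x (i + 1)))
    have h2 := card_le_card (union_subset (spare_subset (G := G) (D := D) (x := x) (u := x i))
      (spare_subset (G := G) (u := x (i + 1))))
    omega
  · have h1 := card_le_card (spare_subset (G := G) (D := D) (x := x) (u := x i))
    have h2 := card_le_card (spare_subset (G := G) (D := D) (x := x) (u := x (i + 1)))
    omega

theorem Dense.card_pool_of_not_gap (h : Dense G D W e) (hx : Function.Injective x)
    (hxD : ∀ i, x i ∈ D) {i : Fin 5} (hi : ¬ Gap G W x i) : (pool G D W x i).card = e + 1 := by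
  rw [pool, if_neg hi, h.card_rest hx hxD]

theorem Dense.card_roots (h : Dense G D W e) (hx : Function.Injective x) :
    (univ.filter fun i => x i ∈ W).card + e ≤ 4 := by
  have h1 : (univ.filter fun i => x i ∈ W).card ≤ W.card :=
    card_le_card_of_injOn x (fun i hi => (mem_filter.1 hi).2) hx.injOn
  have := h.card_le
  omega

/-- The only non-root is adjacent to all roots and there is no gap. At most three pairs lie inside
`W`, in a row; `v` settles two and the non-root the third. -/
theorem Dense.rootedMinor_zero (h : Dense G D W 0) (hv : ∀ u ∈ D, G.Adj v u)
    (hx : Function.Injective x) (hxD : ∀ i, x i ∈ D) (hW : W ⊆ univ.image x) :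
    RootedMinor G (insert v D) x := by
  have key : ∀ J : Finset (Fin 5), J.card ≤ 4 → ∃ j, ∀ i, i ∈ J → i + 1 ∈ J →
      i = j ∨ i = j + 1 ∨ i = j + 1 + 1 := by decide
  obtain ⟨j, hj⟩ := key (univ.filter fun i => x i ∈ W) (h.card_roots hx)
  simp only [mem_filter, mem_univ, true_and] at hj
  have hO := h.card_rest hx hxD
  have hsp : ∀ i, spare G D x (x i) = D \ univ.image x := fun i =>
    eq_of_subset_of_card_le spare_subset (by rw [hO]; exact h.one_le_spare hx hxD hW i)
  have hg : ∀ i, ¬ Gap G W x i := fun i hi => by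
    have := h.two_le_spare hx hxD hW hi
    rw [hsp, hO] at this
    omega
  obtain ⟨o, ho⟩ := card_eq_one.1 hO
  have hnW : ∀ i, i ≠ j → i ≠ j + 1 → i ≠ j + 1 + 1 → ¬ (x i ∈ W ∧ x (i + 1) ∈ W) :=
    fun i h1 h2 h3 h => by
      rcases hj i h.1 h.2 with h | h | h
      exacts [h1 h, h2 h, h3 h]
  refine Dense.rootedMinor_of_joins hv hx hxD j (C₁ := {o}) (C₂ := ∅) (C₃ := ∅) (by rw [ho])
    (empty_subset _) (empty_subset _) (disjoint_empty_right _) (disjoint_empty_right _)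
    (disjoint_empty_right _) (joins_of_mem_spare (D := D) (x := x) (by rw [hsp, ho]; simp)
      (by rw [hsp, ho]; simp)) (joins_of_not_gap (hg _) (hnW _ ?_ ?_ ?_))
    (joins_of_not_gap (hg _) (hnW _ ?_ ?_ ?_)) <;> clear * - <;> revert j <;> decide

/-- Both non-roots serve every gap, and two gaps are never consecutive, as their common root would
need three spare neighbours. So the three pairs left by `v` contain at most two gaps. -/
theorem Dense.rootedMinor_one (h : Dense G D W 1) (hv : ∀ u ∈ D, G.Adj v u)
    (hx : Function.Injective x) (hxD : ∀ i, x i ∈ D) (hW : W ⊆ univ.image x) :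
    RootedMinor G (insert v D) x := by
  have key : ∀ J : Finset (Fin 5), J.card ≤ 3 → ∃ j, ∀ i, i ∈ J → i + 1 ∈ J →
      i = j ∨ i = j + 1 := by decide
  obtain ⟨j, hj⟩ := key (univ.filter fun i => x i ∈ W) (by have := h.card_roots hx; omega)
  simp only [mem_filter, mem_univ, true_and] at hj
  have hO := h.card_rest hx hxD
  obtain ⟨a, b, hab, ho⟩ := card_eq_two.1 hO
  have hsp : ∀ i, 2 ≤ (spare G D x (x i)).card → spare G D x (x i) = {a, b} := fun i hi =>
    ho ▸ eq_of_subset_of_card_le spare_subset (by rw [hO]; exact hi)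
  have hpool : ∀ i, pool G D W x i = {a, b} := fun i => by
    by_cases hi : Gap G W x i
    · rw [pool_of_gap hi, hsp _ (h.two_le_spare hx hxD hW hi),
        hsp _ (h.two_le_spare_succ hx hxD hW hi), inter_self]
    · rw [pool, if_neg hi, ho]
  have hnW : ∀ i, i ≠ j → i ≠ j + 1 → ¬ (x i ∈ W ∧ x (i + 1) ∈ W) :=
    fun i h1 h2 h => (hj i h.1 h.2).elim h1 h2
  have hcon : ∀ i, Gap G W x i → ¬ Gap G W x (i + 1) := fun i h1 h2 => by
    have h3 := h.three_le_spare hx hxD hW h1 h2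
    have h4 := card_le_card (spare_subset (G := G) (D := D) (x := x) (u := x (i + 1)))
    omega
  have ha : ∀ i, a ∈ pool G D W x i := fun i => by rw [hpool]; simp
  have hb : ∀ i, b ∈ pool G D W x i := fun i => by rw [hpool]; simp
  have hne : ∀ i, i = j + 1 + 1 ∨ i = j + 1 + 1 + 1 ∨ i = j + 1 + 1 + 1 + 1 →
      ¬ (x i ∈ W ∧ x (i + 1) ∈ W) := by
    intro i hi
    refine hnW i ?_ ?_ <;> clear * - hi <;> revert i j <;> decide
  have hsa : ({a} : Finset V) ⊆ D \ univ.image x := by rw [ho]; simp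
  have hsb : ({b} : Finset V) ⊆ D \ univ.image x := by rw [ho]; simp
  have hdab : Disjoint ({a} : Finset V) {b} := disjoint_singleton.2 hab
  obtain ⟨C, hC, h₃⟩ := joins_of_mem_pool (hne _ (Or.inr (Or.inr rfl))) (hb _)
  by_cases h1 : Gap G W x (j + 1 + 1)
  · obtain ⟨A, hA, h₁⟩ := joins_of_mem_pool (hne _ (Or.inl rfl)) (ha _)
    exact Dense.rootedMinor_of_joins hv hx hxD j (hA.trans hsa) (empty_subset _) (hC.trans hsb)
      (disjoint_empty_right _) (disjoint_of_subset_left hA (disjoint_of_subset_right hC hdab))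
      (disjoint_empty_left _) h₁ (joins_of_not_gap (hcon _ h1) (hne _ (Or.inr (Or.inl rfl)))) h₃
  · obtain ⟨B, hB, h₂⟩ := joins_of_mem_pool (hne _ (Or.inr (Or.inl rfl))) (ha _)
    exact Dense.rootedMinor_of_joins hv hx hxD j (empty_subset _) (hB.trans hsa) (hC.trans hsb)
      (disjoint_empty_left _) (disjoint_empty_left _)
      (disjoint_of_subset_left hB (disjoint_of_subset_right hC hdab))
      (joins_of_not_gap h1 (hne _ (Or.inl rfl))) h₂ h₃

/-- The pattern gap, non-gap, gap is the only one in which both gap pools might be the same single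
vertex; a further gap next to one of them enlarges its pool. -/
theorem exists_index_two : ∀ (c : Fin 5 → Bool) (s : Fin 5), ∃ j, (s = j ∨ s = j + 1) ∧
    (c (j + 1 + 1) = true → c (j + 1 + 1 + 1) = false → c (j + 1 + 1 + 1 + 1) = true →
      c (j + 1) = true ∨ c j = true) := by
  decide

/-- There are three non-roots and at most one pair inside `W`, which `v` settles. The other three
pairs get distinct representatives from pools of sizes at least 1, 2, 3 in some order. -/
theorem Dense.rootedMinor_two (h : Dense G D W 2) (hv : ∀ u ∈ D, G.Adj v u)
    (hx : Function.Injective x) (hxD : ∀ i, x i ∈ D) (hW : W ⊆ univ.image x) :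
    RootedMinor G (insert v D) x := by
  have key : ∀ J : Finset (Fin 5), J.card ≤ 2 → ∃ s, ∀ i, i ∈ J → i + 1 ∈ J → i = s := by decide
  obtain ⟨s, hs⟩ := key (univ.filter fun i => x i ∈ W) (by have := h.card_roots hx; omega)
  simp only [mem_filter, mem_univ, true_and] at hs
  obtain ⟨j, hsj, hj⟩ := exists_index_two (fun i => decide (Gap G W x i)) s
  simp only [decide_eq_true_eq, decide_eq_false_iff_not] at hj
  have p0 : ∀ i, 1 ≤ (pool G D W x i).card := fun i => by
    by_cases hi : Gap G W x i
    · have := h.card_pool hx hxD (h.two_le_spare hx hxD hW hi) (h.two_le_spare_succ hx hxD hW hi)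
      omega
    · rw [h.card_pool_of_not_gap hx hxD hi]; omega
  have p3 : ∀ i, ¬ Gap G W x i → 3 ≤ (pool G D W x i).card := fun i hi =>
    (h.card_pool_of_not_gap hx hxD hi).ge
  have p1 : ∀ i, Gap G W x i → Gap G W x (i + 1) → 2 ≤ (pool G D W x i).card := fun i h1 h2 => by
    have := h.card_pool hx hxD (h.two_le_spare hx hxD hW h1) (h.three_le_spare hx hxD hW h1 h2)
    omega
  have p2 : ∀ i, Gap G W x i → Gap G W x (i + 1) → 2 ≤ (pool G D W x (i + 1)).card :=
    fun i h1 h2 => by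
      have := h.card_pool hx hxD (h.three_le_spare hx hxD hW h1 h2)
        (h.two_le_spare_succ hx hxD hW h2)
      omega
  have p4 : ∀ i, Gap G W x i → Gap G W x (i + 1) → Gap G W x (i + 1 + 1) →
      3 ≤ (pool G D W x (i + 1)).card := fun i h1 h2 h3 => by
    have := h.card_pool hx hxD (h.three_le_spare hx hxD hW h1 h2)
      (h.three_le_spare hx hxD hW h2 h3)
    omega
  refine Dense.rootedMinor_of_distinct (W := W) (j := j) hv hx hxD
    (fun i h1 h2 => hs i h1 h2 ▸ hsj) ?_
  by_cases g2 : Gap G W x (j + 1 + 1) <;> by_cases g3 : Gap G W x (j + 1 + 1 + 1) <;>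
    by_cases g4 : Gap G W x (j + 1 + 1 + 1 + 1)
  · obtain ⟨a, ha, c, hc, b, hb, h1, h2, h3⟩ := exists_distinct_three (p0 _) (p2 _ g3 g4)
      (p4 _ g2 g3 g4)
    exact ⟨a, ha, b, hb, c, hc, h2, h1, h3.symm⟩
  · obtain ⟨a, ha, b, hb, c, hc, h1, h2, h3⟩ := exists_distinct_three (p0 _) (p2 _ g2 g3)
      (p3 _ g4)
    exact ⟨a, ha, b, hb, c, hc, h1, h2, h3⟩
  · rcases hj g2 g3 g4 with g | g
    · obtain ⟨c, hc, a, ha, b, hb, h1, h2, h3⟩ := exists_distinct_three (p0 _) (p2 _ g g2)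
        (p3 _ g3)
      exact ⟨a, ha, b, hb, c, hc, h3, h1.symm, h2.symm⟩
    · have g' : Gap G W x (j + 1 + 1 + 1 + 1 + 1) := by
        rwa [show j + 1 + 1 + 1 + 1 + 1 = j by clear * -; revert j; decide]
      obtain ⟨a, ha, c, hc, b, hb, h1, h2, h3⟩ := exists_distinct_three (p0 _) (p1 _ g4 g')
        (p3 _ g3)
      exact ⟨a, ha, b, hb, c, hc, h2, h1, h3.symm⟩
  · obtain ⟨a, ha, b, hb, c, hc, h1, h2, h3⟩ := exists_distinct_three (p0 _)
      ((p3 _ g3).trans' (by omega)) (p3 _ g4)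
    exact ⟨a, ha, b, hb, c, hc, h1, h2, h3⟩
  · obtain ⟨c, hc, b, hb, a, ha, h1, h2, h3⟩ := exists_distinct_three (p0 _) (p1 _ g3 g4)
      (p3 _ g2)
    exact ⟨a, ha, b, hb, c, hc, h3.symm, h2.symm, h1.symm⟩
  · obtain ⟨b, hb, a, ha, c, hc, h1, h2, h3⟩ := exists_distinct_three (p0 _)
      ((p3 _ g2).trans' (by omega)) (p3 _ g4)
    exact ⟨a, ha, b, hb, c, hc, h1.symm, h3, h2⟩
  · obtain ⟨c, hc, b, hb, a, ha, h1, h2, h3⟩ := exists_distinct_three (p0 _)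
      ((p3 _ g3).trans' (by omega)) (p3 _ g2)
    exact ⟨a, ha, b, hb, c, hc, h3.symm, h2.symm, h1.symm⟩
  · obtain ⟨a, ha, b, hb, c, hc, h1, h2, h3⟩ := exists_distinct_three (p0 _)
      ((p3 _ g3).trans' (by omega)) (p3 _ g4)
    exact ⟨a, ha, b, hb, c, hc, h1, h2, h3⟩

theorem exists_distinct_three_of_ne {A B C : Finset V} (hAB : A ≠ B) (hA : 2 ≤ A.card)
    (hB : 2 ≤ B.card) (hC : 2 ≤ C.card) :
    ∃ a ∈ A, ∃ b ∈ B, ∃ c ∈ C, a ≠ b ∧ a ≠ c ∧ b ≠ c := by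
  have key : ∀ {A B : Finset V}, 2 ≤ B.card → ¬ A ⊆ B →
      ∃ a ∈ A, ∃ b ∈ B, ∃ c ∈ C, a ≠ b ∧ a ≠ c ∧ b ≠ c := by
    intro A B hB hAB
    obtain ⟨a, ha, haB⟩ := not_subset.1 hAB
    obtain ⟨c, hc, hca⟩ := exists_mem_ne (by omega : 1 < C.card) a
    obtain ⟨b, hb, hbc⟩ := exists_mem_ne (by omega : 1 < B.card) c
    exact ⟨a, ha, b, hb, c, hc, fun e => haB (e ▸ hb), hca.symm, hbc⟩
  by_cases h : A ⊆ B
  · obtain ⟨b, hb, a, ha, c, hc, h1, h2, h3⟩ := key hA fun h' => hAB (h.antisymm h')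
    exact ⟨a, ha, b, hb, c, hc, h1.symm, h3, h2⟩
  · exact key hB h

theorem Dense.not_both (h : Dense G D W 3) (hx : Function.Injective x) (i : Fin 5)
    (h1 : x i ∈ W) : x (i + 1) ∉ W := fun h2 => by
  have := h.card_le
  have h3 := card_le_one.1 (by omega : W.card ≤ 1) _ h1 _ h2
  exact absurd (hx h3) (by clear * -; revert i; decide)

/-- An odd cycle is not 2-colourable. -/
theorem no_alternation {p : Fin 5 → Prop} (h : ∀ i, p (i + 1) ↔ ¬ p i) : False := by
  have h0 : p 1 ↔ ¬ p 0 := h 0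
  have h1 : p 2 ↔ ¬ p 1 := h 1
  have h2 : p 3 ↔ ¬ p 2 := h 2
  have h3 : p 4 ↔ ¬ p 3 := h 3
  have h4 : p 0 ↔ ¬ p 4 := h 4
  tauto

/-- All five consecutive pairs of roots are non-adjacent. -/
theorem Dense.rootedMinor_of_all_gaps (h : Dense G D W 3) (hv : ∀ u ∈ D, G.Adj v u)
    (hx : Function.Injective x) (hxD : ∀ i, x i ∈ D) (hW : W ⊆ univ.image x)
    (hg : ∀ i, Gap G W x i) : RootedMinor G (insert v D) x := by
  have hO := h.card_rest hx hxD
  have hsp : ∀ i, 3 ≤ (spare G D x (x i)).card := fun i => by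
    have := h.three_le_spare hx hxD hW (hg (i + 4)) (hg _)
    rwa [show i + 4 + 1 = i by clear * -; revert i; decide] at this
  have hp : ∀ i, 2 ≤ (pool G D W x i).card := fun i => by
    have := h.card_pool hx hxD (W := W) (hsp i) (hsp (i + 1))
    omega
  -- Two different consecutive pools, together with the next one, have distinct representatives. So
  -- all pools may be taken equal.
  by_cases hall : ∀ i, pool G D W x (i + 1) = pool G D W x i
  swap
  · push Not at hall
    obtain ⟨i, hi⟩ := hall
    have hi3 : i + 3 + 1 + 1 = i := by clear * -; revert i; decide
    refine Dense.rootedMinor_of_distinct (W := W) (j := i + 3) hv hx hxD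
      (fun i h1 h2 => absurd h2 (h.not_both hx i h1)) ?_
    rw [hi3]
    exact exists_distinct_three_of_ne (Ne.symm hi) (hp _) (hp _) (hp _)
  have h1 : pool G D W x 1 = pool G D W x 0 := hall 0
  have h2 : pool G D W x 2 = pool G D W x 0 := (hall 1).trans h1
  have h3 : pool G D W x 3 = pool G D W x 0 := (hall 2).trans h2
  have h4 : pool G D W x 4 = pool G D W x 0 := (hall 3).trans h3
  have heq : ∀ i, pool G D W x i = pool G D W x 0 := by
    intro i
    fin_cases i
    exacts [rfl, h1, h2, h3, h4]
  by_cases hcard : 3 ≤ (pool G D W x 0).card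
  · refine Dense.rootedMinor_of_distinct (W := W) (j := 0) hv hx hxD
      (fun i h1 h2 => absurd h2 (h.not_both hx i h1)) ?_
    simp only [heq]
    exact exists_distinct_three (by omega) (by omega) hcard
  exfalso
  -- Of the four non-roots only `a` and `b` lie outside the common pool. Each root sees one of them,
  -- while consecutive roots share neither, so they alternate around a 5-cycle.
  have hcard' : ((D \ univ.image x) \ pool G D W x 0).card = 2 := by
    have h5 := card_sdiff_add_card_eq_card (pool_subset (G := G) (D := D) (W := W) (x := x) (i := 0))
    have := hp 0
    omega
  obtain ⟨a, b, hab, hrest⟩ := card_eq_two.1 hcard'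
  have hor : ∀ i, a ∈ spare G D x (x i) ∨ b ∈ spare G D x (x i) := by
    intro i
    obtain ⟨o, ho, hop⟩ := exists_mem_notMem_of_card_lt_card
      (show (pool G D W x 0).card < (spare G D x (x i)).card by have := hsp i; omega)
    have : o ∈ (D \ univ.image x) \ pool G D W x 0 := mem_sdiff.2 ⟨spare_subset ho, hop⟩
    rw [hrest, mem_insert, mem_singleton] at this
    rcases this with rfl | rfl
    exacts [Or.inl ho, Or.inr ho]
  have hnot : ∀ o ∈ (D \ univ.image x) \ pool G D W x 0, ∀ i, o ∈ spare G D x (x i) →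
      o ∉ spare G D x (x (i + 1)) := fun o ho i h1 h2 => (mem_sdiff.1 ho).2 (by
    rw [← heq i, pool_of_gap (hg i)]
    exact mem_inter.2 ⟨h1, h2⟩)
  have ha := hnot a (by rw [hrest]; simp)
  have hb := hnot b (by rw [hrest]; simp)
  refine no_alternation (p := fun i => a ∈ spare G D x (x i)) fun i => ⟨fun h1 h2 => ha i h2 h1,
    fun h1 => (hor (i + 1)).resolve_right (hb i ((hor i).resolve_left h1))⟩

/-- The pair at `j + 3` is non-adjacent, those at `j + 2` and `j + 4` are adjacent. -/
theorem Dense.rootedMinor_of_skip (h : Dense G D W 3) (hv : ∀ u ∈ D, G.Adj v u)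
    (hx : Function.Injective x) (hxD : ∀ i, x i ∈ D) (hW : W ⊆ univ.image x) {j : Fin 5}
    (h2 : ¬ Gap G W x (j + 1 + 1)) (h3 : Gap G W x (j + 1 + 1 + 1))
    (h4 : ¬ Gap G W x (j + 1 + 1 + 1 + 1)) : RootedMinor G (insert v D) x := by
  have hnW : ∀ i, ¬ (x i ∈ W ∧ x (i + 1) ∈ W) := fun i hi => h.not_both hx i hi.1 hi.2
  have hs1 := h.two_le_spare hx hxD hW h3
  have hs2 := h.two_le_spare_succ hx hxD hW h3
  have serve : ∀ C ⊆ D \ univ.image x, Joins G (x (j + 1 + 1 + 1)) (x (j + 1 + 1 + 1 + 1)) C →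
      RootedMinor G (insert v D) x := fun C hC hJ =>
    Dense.rootedMinor_of_joins hv hx hxD j (empty_subset _) hC (empty_subset _)
      (disjoint_empty_left _) (disjoint_empty_left _) (disjoint_empty_right _)
      (joins_of_not_gap h2 (hnW _)) hJ (joins_of_not_gap h4 (hnW _))
  by_cases hdis : Disjoint (spare G D x (x (j + 1 + 1 + 1))) (spare G D x (x (j + 1 + 1 + 1 + 1)))
  swap
  · obtain ⟨o, ho1, ho2⟩ := not_disjoint_iff.1 hdis
    exact serve {o} (singleton_subset_iff.2 (spare_subset ho1)) (joins_of_mem_spare ho1 ho2)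
  by_cases hT : ∃ o ∈ spare G D x (x (j + 1 + 1 + 1)),
      ∃ t ∈ spare G D x (x (j + 1 + 1 + 1 + 1)), G.Adj o t
  · obtain ⟨o, ho, t, ht, hot⟩ := hT
    exact serve {o, t} (pair_subset (spare_subset ho) (spare_subset ht))
      (Or.inr ⟨conn_pair hot, ⟨o, by simp, adj_of_mem_spare ho⟩, t, by simp, adj_of_mem_spare ht⟩)
  push Not at hT
  -- Such an `o` already misses `x (j + 4)` and its at least two spare neighbours, which exhausts
  -- the three permitted misses.
  have hadj : ∀ o ∈ spare G D x (x (j + 1 + 1 + 1)), ∀ l, l ≠ j + 1 + 1 + 1 + 1 →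
      o ∈ spare G D x (x l) := by
    intro o ho l hl
    have hoO := spare_subset ho
    obtain ⟨hoD, hoR⟩ := mem_sdiff.1 hoO
    have hne : ∀ i, x i ≠ o := fun i e => hoR (e ▸ mem_image_of_mem x (mem_univ i))
    refine mem_filter.2 ⟨hoO, ?_⟩
    by_contra hlo
    have hmiss := h.miss o hoD (insert (x l) (insert (x (j + 1 + 1 + 1 + 1))
      (spare G D x (x (j + 1 + 1 + 1 + 1))))) (insert_subset (hxD _) (insert_subset (hxD _)
      (spare_subset.trans sdiff_subset))) (fun t ht => by
        have hoW : o ∉ W := fun h => hoR (hW h)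
        simp only [mem_insert] at ht
        rcases ht with rfl | rfl | ht
        · exact ⟨hne _, fun e => hlo e.symm, fun e => hoW e.1⟩
        · exact ⟨hne _, fun e => disjoint_left.1 hdis ho (mem_filter.2 ⟨hoO, e.symm⟩),
            fun e => hoW e.1⟩
        · exact ⟨fun e => disjoint_left.1 hdis ho (e ▸ ht), hT o ho t ht, fun e => hoW e.1⟩)
    have hxs : ∀ i, x i ∉ spare G D x (x (j + 1 + 1 + 1 + 1)) := fun i hi =>
      (mem_sdiff.1 (spare_subset hi)).2 (mem_image_of_mem x (mem_univ i))
    rw [card_insert_of_notMem (by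
        rw [mem_insert, not_or]
        exact ⟨fun e => hl (hx e), hxs _⟩), card_insert_of_notMem (hxs _)] at hmiss
    omega
  obtain ⟨a, ha, b, hb, hab⟩ := one_lt_card.1 (by omega : 1 < (spare G D x (x (j + 1 + 1 + 1))).card)
  have e5 : j + 1 + 1 + 1 + 1 + 1 = j := by clear * -; revert j; decide
  -- Now `v` serves `x (j + 3)`, an end of the bad gap; `a` and `b` serve the pairs at `j` and `j +
  -- 1`.
  refine Dense.rootedMinor_of_joins hv hx hxD (j + 1 + 1) (C₁ := ∅) (C₂ := {a}) (C₃ := {b})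
    (empty_subset _) (singleton_subset_iff.2 (spare_subset ha))
    (singleton_subset_iff.2 (spare_subset hb)) (disjoint_empty_left _) (disjoint_empty_left _)
    (disjoint_singleton.2 hab) (joins_of_not_gap h4 (hnW _)) ?_ ?_
  · refine joins_of_mem_spare (hadj a ha _ ?_) (hadj a ha _ ?_) <;> clear * - <;> revert j <;> decide
  · refine joins_of_mem_spare (hadj b hb _ ?_) (hadj b hb _ ?_) <;> clear * - <;> revert j <;> decide

/-- If some pair is no gap, either two non-gaps are at distance two on the cycle, or there is just
one non-gap, or exactly two and they are consecutive. -/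
theorem exists_index_three : ∀ c : Fin 5 → Bool, (∀ i, c i = true) ∨ ∃ j,
    (c (j + 1 + 1) = false ∧ c (j + 1 + 1 + 1 + 1) = false) ∨
    (c (j + 1) = true ∧ c (j + 1 + 1) = true ∧ c (j + 1 + 1 + 1) = true ∧
      c j = true ∧ c (j + 1 + 1 + 1 + 1) = false) ∨
    (c (j + 1) = true ∧ c (j + 1 + 1) = true ∧ c (j + 1 + 1 + 1) = false ∧
      c (j + 1 + 1 + 1 + 1) = false) := by
  decide

theorem Dense.rootedMinor_three (h : Dense G D W 3) (hv : ∀ u ∈ D, G.Adj v u)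
    (hx : Function.Injective x) (hxD : ∀ i, x i ∈ D) (hW : W ⊆ univ.image x) :
    RootedMinor G (insert v D) x := by
  have hnW : ∀ i, ¬ (x i ∈ W ∧ x (i + 1) ∈ W) := fun i hi => h.not_both hx i hi.1 hi.2
  rcases exists_index_three (fun i => decide (Gap G W x i)) with hg | ⟨j, hj⟩
  · exact h.rootedMinor_of_all_gaps hv hx hxD hW fun i => by simpa using hg i
  simp only [decide_eq_true_eq, decide_eq_false_iff_not] at hj
  have p4 : ∀ i, ¬ Gap G W x i → 4 ≤ (pool G D W x i).card := fun i hi =>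
    (h.card_pool_of_not_gap hx hxD hi).ge
  have p1 : ∀ i, Gap G W x i → Gap G W x (i + 1) → 1 ≤ (pool G D W x (i + 1)).card :=
    fun i h1 h2 => by
      have := h.card_pool hx hxD (h.three_le_spare hx hxD hW h1 h2)
        (h.two_le_spare_succ hx hxD hW h2)
      omega
  have p2 : ∀ i, Gap G W x i → Gap G W x (i + 1) → Gap G W x (i + 1 + 1) →
      2 ≤ (pool G D W x (i + 1)).card := fun i h1 h2 h3 => by
    have := h.card_pool hx hxD (h.three_le_spare hx hxD hW h1 h2)
      (h.three_le_spare hx hxD hW h2 h3)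
    omega
  rcases hj with ⟨g2, g4⟩ | ⟨g1, g2, g3, -, g4⟩ | ⟨g1, g2, g3, g4⟩
  · by_cases g3 : Gap G W x (j + 1 + 1 + 1)
    · exact h.rootedMinor_of_skip hv hx hxD hW g2 g3 g4
    · exact Dense.rootedMinor_of_joins hv hx hxD j (empty_subset _) (empty_subset _)
        (empty_subset _) (disjoint_empty_left _) (disjoint_empty_left _) (disjoint_empty_left _)
        (joins_of_not_gap g2 (hnW _)) (joins_of_not_gap g3 (hnW _)) (joins_of_not_gap g4 (hnW _))
  · refine Dense.rootedMinor_of_distinct (W := W) (j := j) hv hx hxD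
      (fun i h1 h2 => absurd ⟨h1, h2⟩ (hnW i)) ?_
    obtain ⟨b, hb, a, ha, c, hc, h1, h2, h3⟩ := exists_distinct_three (p1 _ g2 g3) (p2 _ g1 g2 g3)
      ((p4 _ g4).trans' (by omega))
    exact ⟨a, ha, b, hb, c, hc, h1.symm, h3, h2⟩
  · refine Dense.rootedMinor_of_distinct (W := W) (j := j) hv hx hxD
      (fun i h1 h2 => absurd ⟨h1, h2⟩ (hnW i)) ?_
    obtain ⟨a, ha, b, hb, c, hc, h1, h2, h3⟩ := exists_distinct_three (p1 _ g1 g2)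
      ((p4 _ g3).trans' (by omega)) ((p4 _ g4).trans' (by omega))
    exact ⟨a, ha, b, hb, c, hc, h1, h2, h3⟩

theorem Dense.rootedMinor (h : Dense G D W e) (hv : ∀ u ∈ D, G.Adj v u)
    (hx : Function.Injective x) (hxD : ∀ i, x i ∈ D) (hW : W ⊆ univ.image x) (he : e ≤ 3) :
    RootedMinor G (insert v D) x := by
  interval_cases e
  · exact h.rootedMinor_zero hv hx hxD hW
  · exact h.rootedMinor_one hv hx hxD hW
  · exact h.rootedMinor_two hv hx hxD hW
  · exact h.rootedMinor_three hv hx hxD hW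

/-! ### No minimal counterexample exists -/

theorem linked_empty (G : SimpleGraph V) (U : Finset V) : Linked G U ∅ := fun _ =>
  ⟨fun _ => ∅, fun _ => empty_subset _, fun _ _ _ => disjoint_empty_left _, by simp, by simp⟩

/-- `K` joins the branch set at the place of one root; being attached to all roots, it supplies
every connection needed. -/
theorem linked_of_card_le_two (hXU : X ⊆ U) {K : Finset V} (hK : K ⊆ U \ X) (hKc : Conn G K)
    (hXK : X ⊆ bdry G U K) (hX : X.card ≤ 2) : Linked G U X := by
  rcases X.eq_empty_or_nonempty with rfl | ⟨x, hx⟩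
  · exact linked_empty G U
  intro col
  have huniq : ∀ y ∈ X, ∀ z ∈ X, y ≠ x → z ≠ x → y = z := fun y hy z hz hyx hzx => by
    have h1 := card_erase_add_one hx
    exact card_le_one.1 (by omega : (X.erase x).card ≤ 1) y (mem_erase.2 ⟨hyx, hy⟩) z
      (mem_erase.2 ⟨hzx, hz⟩)
  have hadj : ∀ y ∈ X, ∃ k ∈ K, G.Adj k y := fun y hy => (mem_bdry.1 (hXK hy)).2.2
  set F : Fin 5 → Finset V := fun i => X.filter fun y => col y = i
  have hF : ∀ {i y}, y ∈ F i ↔ y ∈ X ∧ col y = i := mem_filter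
  have hFd : ∀ i j, i ≠ j → Disjoint (F i) (F j) := fun i j hij =>
    disjoint_left.2 fun y hy hy' => hij ((hF.1 hy).2.symm.trans (hF.1 hy').2)
  have hKF : ∀ i, Disjoint K (F i) := fun i => disjoint_left.2 fun y hy hy' =>
    (mem_sdiff.1 (hK hy)).2 (hF.1 hy').1
  refine ⟨fun i => if i = col x then K ∪ F i else F i, fun i => ?_, fun i j hij => ?_,
    fun y hy => ?_, fun y hy z hz hyz => ?_⟩
  · have h1 : F i ⊆ U := (filter_subset _ _).trans hXU
    dsimp only
    split_ifs
    exacts [union_subset (hK.trans sdiff_subset) h1, h1]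
  · dsimp only
    split_ifs with h1 h2 h2
    · exact absurd (h1.trans h2.symm) hij
    · exact disjoint_union_left.2 ⟨hKF j, hFd i j hij⟩
    · exact disjoint_union_right.2 ⟨(hKF i).symm, hFd i j hij⟩
    · exact hFd i j hij
  · dsimp only
    have hyF : y ∈ F (col y) := hF.2 ⟨hy, rfl⟩
    split_ifs with h
    · refine ⟨mem_union_right _ hyF, ?_⟩
      have := conn_union_core (P := fun z : V => ({z} : Finset V)) (I := F (col y)) hKc
        (fun z _ => conn_singleton G z) fun z hz => by
          obtain ⟨k, hk, hkz⟩ := hadj z (hF.1 hz).1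
          exact Or.inr ⟨k, hk, z, mem_singleton_self z, hkz⟩
      rwa [biUnion_singleton_eq_self] at this
    · refine ⟨hyF, ?_⟩
      have : F (col y) = {y} := by
        refine eq_singleton_iff_unique_mem.2 ⟨hyF, fun z hz => ?_⟩
        obtain ⟨hzX, hzy⟩ := hF.1 hz
        exact huniq z hzX y hy (fun e => h (e ▸ hzy).symm) fun e => h (e ▸ rfl)
      rw [this]
      exact conn_singleton G y
  · have hyF : y ∈ F (col y) := hF.2 ⟨hy, rfl⟩
    have hzF : z ∈ F (col z) := hF.2 ⟨hz, rfl⟩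
    have hne : col z ≠ col y := by
      rw [hyz]
      generalize col y = i
      revert i
      decide
    dsimp only
    split_ifs with h1 h2 h2
    · exact absurd (h2.trans h1.symm) hne
    · obtain ⟨k, hk, hkz⟩ := hadj z hz
      exact ⟨k, mem_union_left _ hk, z, hzF, hkz⟩
    · obtain ⟨k, hk, hky⟩ := hadj y hy
      exact ⟨y, hyF, k, mem_union_left _ hk, hky.symm⟩
    · exact absurd (huniq z hz y hy (fun e => h2 (e ▸ rfl)) fun e => h1 (e ▸ rfl))
        fun e => hne (e ▸ rfl)

theorem Critical.three_le_card (hc : Critical G U X) : 3 ≤ X.card := by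
  by_contra hlt
  obtain ⟨K, hK, hKc, hKcl, hKm⟩ := exists_conn_closed hc.massed.mass
  have hsub : bdry G U K ⊆ X := fun y hy => by
    obtain ⟨hyU, hyK, k, hk, hky⟩ := mem_bdry.1 hy
    by_contra hyX
    exact hyK (hKcl k hk y (mem_sdiff.2 ⟨hyU, hyX⟩) hky)
  have hge : X.card ≤ (bdry G U K).card := by
    by_contra hlt
    have := hc.massed.sep K hK (by omega)
    omega
  exact hc.not_linked (linked_of_card_le_two hc.massed.subset hK hKc
    (eq_of_subset_of_card_le hsub hge).ge (by omega))

/-- If at most two non-roots have root neighbours, they bound the remaining part, which by `sep` has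
at most five edges per vertex. The exact edge count then forces two such vertices, each adjacent to
five roots: the exceptional case. -/
theorem Critical.three_le_contacts (hc : Critical G U X) :
    3 ≤ ((U \ X).filter fun y => 1 ≤ dg G X y).card := by
  by_contra hlt
  set N := (U \ X).filter fun y => 1 ≤ dg G X y with hN
  have hX3 := hc.three_le_card
  have hXU := hc.massed.subset
  have hX5 := hc.massed.card_le
  have hNX : N ⊆ U \ X := filter_subset _ _
  have hbd : bdry G U ((U \ X) \ N) ⊆ N := by
    intro y hy
    obtain ⟨hyU, hyS, s, hs, hsy⟩ := mem_bdry.1 hy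
    obtain ⟨hs, hsN⟩ := mem_sdiff.1 hs
    have hyX : y ∉ X := fun hyX => hsN (mem_filter.2 ⟨hs, card_pos.2 ⟨y, mem_filter.2 ⟨hyX, hsy⟩⟩⟩)
    by_contra hyN
    exact hyS (mem_sdiff.2 ⟨mem_sdiff.2 ⟨hyU, hyX⟩, hyN⟩)
  have hsep := hc.massed.sep _ sdiff_subset ((card_le_card hbd).trans_lt (by omega))
  have hrho := hc.rho_eq
  have hcard := card_sdiff_add_card_eq_card hNX
  rcases (by omega : N.card = 0 ∨ N.card = 1 ∨ N.card = 2) with h | h | h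
  · rw [card_eq_zero.1 h, sdiff_empty] at hsep
    omega
  · obtain ⟨a, ha⟩ := card_eq_one.1 h
    rw [ha, sdiff_singleton_eq_erase] at hsep
    have haX : a ∈ U \ X := hNX (by rw [ha]; simp)
    have h1 := rho_erase (G := G) (sdiff_subset (s := U) (t := X)) haX
    rw [Finset.sdiff_sdiff_eq_self hXU] at h1
    have h2 := dg_le_card G X a
    rw [ha, card_singleton, sdiff_singleton_eq_erase] at hcard
    omega
  · obtain ⟨a, b, hab, hNab⟩ := card_eq_two.1 h
    have haX : a ∈ U \ X := hNX (by rw [hNab]; simp)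
    have hbX : b ∈ U \ X := hNX (by rw [hNab]; simp)
    have h1 := rho_split_pair (G := G) hXU haX hbX hab
    have h2 : (U \ X) \ N = ((U \ X).erase a).erase b := by
      rw [hNab]
      ext y
      simp only [mem_sdiff, mem_insert, mem_singleton, mem_erase]
      tauto
    rw [h2] at hsep hcard
    have h3 := dg_le_card G X a
    have h4 := dg_le_card G X b
    exact hc.not_exceptional ⟨by omega, a, haX, b, hbX, hab,
      dg_eq_card_iff.1 (by omega), dg_eq_card_iff.1 (by omega)⟩

/-- The degree sum is `10|U \ X| + 2`. If the claim failed, every non-root would contribute at least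
10, and the three with root neighbours at least 11. -/
theorem Critical.exists_small (hc : Critical G U X) :
    ∃ v ∈ U \ X, dg G U v + dg G X v ≤ 10 ∧ dg G U v ≤ 9 := by
  by_contra! hcon
  have h1 := sum_dg G (sdiff_subset (s := U) (t := X))
  rw [Finset.sdiff_sdiff_eq_self hc.massed.subset, hc.rho_eq] at h1
  have h2 : ∑ v ∈ U \ X, (10 + if 1 ≤ dg G X v then 1 else 0) ≤
      ∑ v ∈ U \ X, (dg G U v + dg G X v) := sum_le_sum fun v hv => by
    have := hcon v hv
    split_ifs <;> omega
  rw [sum_add_distrib, sum_const, smul_eq_mul, ← card_filter] at h2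
  have := hc.three_le_contacts
  omega

theorem bdry_singleton {v : V} : bdry G U {v} = U.filter (G.Adj v) := by
  ext y
  simp only [mem_bdry, mem_singleton, exists_eq_left, mem_filter]
  exact ⟨fun h => ⟨h.1, h.2.2⟩, fun h => ⟨h.1, h.2.ne', h.2⟩⟩

/-- The bound on `codeg` yields five further neighbours of `v`, each adjacent to `u` or forming a
pair of roots with `u`. They are disjoint from `T`, and `u` itself is the sixth. -/
theorem Critical.card_miss (hc : Critical G U X) {v u : V} (hv : v ∈ U \ X)
    (hu : u ∈ bdry G U {v}) {T : Finset V} (hT : T ⊆ bdry G U {v})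
    (hm : ∀ t ∈ T, t ≠ u ∧ ¬ G.Adj u t ∧
      ¬ (u ∈ bdry G U {v} ∩ X ∧ t ∈ bdry G U {v} ∩ X)) : T.card + 6 ≤ dg G U v := by
  have huD := hu
  rw [bdry_singleton, mem_filter] at huD
  have hcod := hc.codeg_ge huD.1 hv huD.2.symm
  set A := ((bdry G U {v}).erase u).filter fun y => G.Adj u y ∨ (u ∈ X ∧ y ∈ X) with hA
  have h1 : codeg G U X u v ≤ A.card := by
    rw [codeg]
    split_ifs with huX
    · rw [dg, ← card_union_of_disjoint]
      · refine card_le_card fun y hy => ?_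
        rw [hA, bdry_singleton]
        simp only [mem_union, mem_filter, mem_sdiff, mem_erase] at hy ⊢
        rcases hy with ⟨⟨hyU, -⟩, hvy, huy⟩ | ⟨⟨hyu, hyX⟩, hvy⟩
        · exact ⟨⟨huy.ne', hyU, hvy⟩, Or.inl huy⟩
        · exact ⟨⟨hyu, hc.massed.subset hyX, hvy⟩, Or.inr ⟨huX, hyX⟩⟩
      · rw [disjoint_left]
        intro y hy hy'
        exact (mem_sdiff.1 (mem_filter.1 hy).1).2 (mem_of_mem_erase (mem_filter.1 hy').1)
    · refine card_le_card fun y hy => ?_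
      rw [hA, bdry_singleton]
      simp only [mem_filter, mem_erase] at hy ⊢
      exact ⟨⟨hy.2.2.ne', hy.1, hy.2.1⟩, Or.inl hy.2.2⟩
  have h2 : Disjoint A T := disjoint_left.2 fun y hyA hyT => by
    obtain ⟨hyD, hy⟩ := mem_filter.1 hyA
    obtain ⟨-, h3, h4⟩ := hm y hyT
    rcases hy with hy | hy
    · exact h3 hy
    · exact h4 ⟨mem_inter.2 ⟨hu, hy.1⟩, mem_inter.2 ⟨hT hyT, hy.2⟩⟩
  have h3 : A ∪ T ⊆ (bdry G U {v}).erase u :=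
    union_subset (filter_subset _ _) fun t ht => mem_erase.2 ⟨(hm t ht).1, hT ht⟩
  have h4 := card_le_card h3
  rw [card_union_of_disjoint h2] at h4
  have h5 := card_erase_add_one hu
  have h6 : (bdry G U {v}).card = dg G U v := by rw [bdry_singleton]; rfl
  omega

/-- With `e = d - 6` for the degree `d` of the vertex from `Critical.exists_small`, the bounds on
`d` give `e ≤ 3` and at most `4 - e` root neighbours. Every admissible boundary set extends to five
neighbours containing these, so the singleton is a core. -/
theorem not_critical : ¬ Critical G U X := by
  intro hc
  obtain ⟨v, hv, h10, h9⟩ := hc.exists_small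
  have hX5 := hc.massed.card_le
  have hS : ({v} : Finset V) ⊆ U \ X := singleton_subset_iff.2 hv
  refine hc.not_core hS (singleton_nonempty v) fun R hR hXR hRc => ?_
  rcases (bdry G U {v}).eq_empty_or_nonempty with hD | ⟨u, hu⟩
  · rw [hD, subset_empty] at hR
    rw [hR]
    exact linked_empty _ _
  have hdD : (bdry G U {v}).card = dg G U v := by rw [bdry_singleton]; rfl
  have h6 : 6 ≤ dg G U v := by
    have := hc.card_miss hv hu (T := ∅) (empty_subset _) (by simp)
    omega
  have hW : (bdry G U {v} ∩ X).card = dg G X v := by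
    rw [bdry_singleton, dg]
    congr 1
    ext y
    simp only [mem_inter, mem_filter]
    exact ⟨fun h => ⟨h.2, h.1.2⟩, fun h => ⟨⟨hc.massed.subset h.1, h.2⟩, h.1⟩⟩
  have hdense : Dense G (bdry G U {v}) (bdry G U {v} ∩ X) (dg G U v - 6) :=
    ⟨by omega, by omega, fun w hw T hT hm => by
      have := hc.card_miss hv hw hT hm
      omega⟩
  obtain ⟨R', hRR', hR', hR'c⟩ := exists_subsuperset_card_eq hR (by omega : R.card ≤ 5)
    (by omega)
  refine Linked.mono (linked_of_rootedMinor hR'c fun x hx hxR => ?_) subset_rfl hRR'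
  rw [← insert_eq]
  refine hdense.rootedMinor (fun w hw => ?_) hx (fun i => hR' (hxR i)) ?_ (by omega)
  · rw [bdry_singleton] at hw
    exact (mem_filter.1 hw).2
  · rw [range_eq_of_card hR'c hx hxR]
    exact hXR.trans hRR'

theorem Massed.linked_or_exceptional (h : Massed G U X) : Linked G U X ∨ Exceptional G U X := by
  induction hn : U.card using Nat.strong_induction_on generalizing G U X with
  | _ n ih =>
    induction hr : rho G U (U \ X) using Nat.strong_induction_on generalizing G with
    | _ r ih' =>
      by_contra hcon
      rw [not_or] at hcon
      exact not_critical ⟨h, hcon.1, hcon.2, fun H W Y hW hm => ih _ (hn ▸ hW) hm rfl,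
        fun H hH hm => ih' _ (hr ▸ hH) hm rfl⟩

theorem Massed.linked (h : Massed G U X) (hmass : 5 * (U \ X).card + 1 < rho G U (U \ X)) :
    Linked G U X :=
  h.linked_or_exceptional.elim id fun hE => h.linked_of_exceptional hE hmass

/-! ### Ten-connected graphs -/

theorem Conn.induce_connected {S : Finset V} (h : Conn G S) :
    (G.induce (S : Set V)).Connected := by
  obtain ⟨s, hs⟩ := h.1
  refine (SimpleGraph.connected_iff_exists_forall_reachable _).2 ⟨⟨s, hs⟩, fun t => ?_⟩
  rcases h.subset_or_disjoint (T := S.filter fun y => ∃ hy : y ∈ S,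
      (G.induce (S : Set V)).Reachable ⟨s, hs⟩ ⟨y, hy⟩) (fun a ha haT b hb hab => by
    obtain ⟨-, _, hr⟩ := mem_filter.1 haT
    exact mem_filter.2 ⟨hb, hb, hr.trans (SimpleGraph.Adj.reachable (by simpa using hab))⟩)
    with h1 | h1
  · obtain ⟨-, _, hr⟩ := mem_filter.1 (h1 (mem_coe.1 t.2))
    exact hr
  · exact absurd (mem_filter.2 ⟨hs, hs, SimpleGraph.Reachable.refl _⟩) (disjoint_left.1 h1 hs)

theorem RootedMinor.hasRootedCycleMinor {x : Fin 5 → V} (h : RootedMinor G U x) :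
    G.HasRootedCycleMinor x := by
  obtain ⟨B, h1, h2, h3⟩ := h
  refine ⟨fun i => B i, fun i j hij => disjoint_coe.2 (h2 i j hij),
    fun i => (h1 i).2.2.induce_connected, fun i => (h1 i).1, fun i => ?_⟩
  obtain ⟨a, ha, b, hb, hab⟩ := h3 i
  exact ⟨a, ha, b, by rwa [finRotate_apply], hab⟩

/-- A vertex set with vertices on both sides is left by an edge avoiding a small cut set. -/
theorem exists_adj_of_isKConnected {k : ℕ} (hG : G.IsKConnected k) {S T : Finset V}
    (hT : T.card < k) {s t : V} (hs : s ∈ S) (hsT : s ∉ T) (ht : t ∉ S) (htT : t ∉ T) :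
    ∃ a ∈ S, ∃ b, b ∉ S ∧ b ∉ T ∧ G.Adj a b := by
  obtain ⟨p⟩ := (hG.2 T hT).preconnected ⟨s, by simpa using hsT⟩ ⟨t, by simpa using htT⟩
  obtain ⟨d, -, hd1, hd2⟩ := p.exists_boundary_dart {y | (y : V) ∈ S} hs ht
  exact ⟨d.fst, hd1, d.snd, hd2, fun h => d.snd.2 (mem_coe.2 h), d.adj⟩

theorem le_dg_of_isKConnected [Fintype V] {k : ℕ} (hG : G.IsKConnected k) (v : V) :
    k ≤ dg G univ v := by
  by_contra hlt
  have h1 : (insert v (univ.filter (G.Adj v))).card < (univ : Finset V).card := by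
    have := hG.1
    rw [Nat.card_eq_fintype_card, ← card_univ] at this
    have h2 := card_insert_le v (univ.filter (G.Adj v))
    change ¬ k ≤ (univ.filter (G.Adj v)).card at hlt
    omega
  obtain ⟨t, -, ht⟩ := exists_mem_notMem_of_card_lt_card h1
  rw [mem_insert, not_or] at ht
  obtain ⟨a, ha, b, -, hbT, hab⟩ := exists_adj_of_isKConnected hG (S := {v})
    (T := univ.filter (G.Adj v)) (not_le.1 hlt) (mem_singleton_self v) (by simp)
    (by simpa using ht.1) ht.2
  rw [mem_singleton] at ha
  exact hbT (by simpa using ha ▸ hab)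

/-- All degrees are at least ten, and a root has at least six non-root neighbours, each counted once
more in the degree sum; this gives three excess edges. A nonempty `S` with fewer than five boundary
vertices would be cut off from some root. -/
theorem massed_of_isKConnected [Fintype V] (hG : G.IsKConnected 10) (hX : X.card = 5) :
    Massed G univ X ∧ 5 * (univ \ X).card + 1 < rho G univ (univ \ X) := by
  have hmass : 5 * (univ \ X).card + 1 < rho G univ (univ \ X) := by
    obtain ⟨x, hx⟩ := card_pos.1 (by omega : 0 < X.card)
    have h1 := sum_dg G (subset_univ (univ \ X))
    rw [Finset.sdiff_sdiff_eq_self (subset_univ X)] at h1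
    have h2 : ∑ v ∈ univ \ X, (10 + if G.Adj x v then 1 else 0) ≤
        ∑ v ∈ univ \ X, (dg G univ v + dg G X v) := sum_le_sum fun v _ => by
      refine add_le_add (le_dg_of_isKConnected hG v) ?_
      split_ifs with h
      · exact card_pos.2 ⟨x, mem_filter.2 ⟨hx, h.symm⟩⟩
      · exact Nat.zero_le _
    rw [sum_add_distrib, sum_const, smul_eq_mul, ← card_filter] at h2
    have h3 := le_dg_of_isKConnected hG x
    have h4 := dg_union (G := G) x (disjoint_sdiff_self_left : Disjoint (univ \ X) X)
    rw [sdiff_union_of_subset (subset_univ X)] at h4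
    have h5 : dg G X x < X.card := dg_lt_card ⟨x, hx, G.irrefl⟩
    change _ + dg G (univ \ X) x ≤ _ at h2
    omega
  refine ⟨⟨subset_univ X, hX.le, by omega, fun S hS hlt => ?_⟩, hmass⟩
  rcases S.eq_empty_or_nonempty with rfl | ⟨s, hs⟩
  · simp [rho_empty]
  exfalso
  obtain ⟨t, htX, ht⟩ := exists_mem_notMem_of_card_lt_card hlt
  obtain ⟨a, ha, b, hbS, hbT, hab⟩ := exists_adj_of_isKConnected hG (by omega) hs
    (fun h => (mem_bdry.1 h).2.1 hs) (fun htS => (mem_sdiff.1 (hS htS)).2 htX) ht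
  exact hbT (mem_bdry.2 ⟨mem_univ b, hbS, a, ha, hab⟩)

end CycleMinor

theorem mainTheorem2 {V : Type*} [Finite V] (G : SimpleGraph V) (hG : G.IsKConnected 10) :
    G.IsCycleMinorLinked 5 := by
  have := Fintype.ofFinite V
  intro X hX
  obtain ⟨hm, hmass⟩ := CycleMinor.massed_of_isKConnected hG hX
  have hL := hm.linked hmass
  -- The orderings are indexed by `Fin X.card`, so the length is generalised before it is replaced
  -- by `5`.
  have key : ∀ n, n = 5 → ∀ x : Fin n → V, Function.Injective x → Set.range x = (X : Set V) →
      G.HasRootedCycleMinor x := by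
    rintro n rfl x hx hxX
    exact (hL.rootedMinor hx fun i => by
      rw [← Finset.mem_coe, ← hxX]
      exact Set.mem_range_self i).hasRootedCycleMinor
  exact Or.inl ⟨by omega, key _ hX⟩
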